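/- Let $n,d\ge 1$, let $\Sigma$ be a real symmetric positive semidefinite $(n+d)\times(n+d)$ matrix, and let $X_0\in\mathbb R^{n\times d}$ satisfy $\operatorname{rank}\bigl(\Sigma\binom{X_0}{-I_d}\bigr)=d$. Let $\Sigma^\dagger$ denote the Moore–Penrose pseudoinverse and $P_\Sigma=\Sigma\Sigma^\dagger$. For an $m\times(n+d)$ matrix $C$ consider the problem $$\lambda_{\max}(\Delta\Sigma^\dagger\Delta^\top)\to\min\quad\text{subject to}\quad \Delta(I-P_\Sigma)=0,\ \ \operatorname{rank}(C-\Delta)\le n\qquad(\ast)$$ over $m\times(n+d)$ matrices $\Delta$, and, for a solution $\Delta$ of $(\ast)$, the linear equation $$(C-\Delta)\binom{\widehat X}{-I_d}=0\qquad(\ast\ast)$$ in $\widehat X\in\mathbb R^{n\times d}$. 1. For every $m$ and every $C\in\mathbb R^{m\times(n+d)}$ the minimum in $(\ast)$ is attained; and for every $\Delta$ satisfying the constraints there is an $(n+d)\times d$ matrix $\widehat X_{\rm ext}$ of rank $d$ with $(C-\Delta)\widehat X_{\rm ext}=0$. For parts 2 and 3, let $a_1^0,a_2^0,\dots\in\mathbb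 R^n$ be nonrandom vectors, let $A_0=A_0(m)$ be the $m\times n$ matrix with rows $(a_1^0)^\top,\dots,(a_m^0)^\top$, let $\tilde c_1,\tilde c_2,\dots$ be mutually independent random vectors in $\mathbb R^{n+d}$ on a probability space with $\mathsf E\,\tilde c_i=0$ and $\mathsf E\,\tilde c_i\tilde c_i^\top=\Sigma$, write $\tilde c_i=(\delta_{ij})_j$, let $\widetilde C=\widetilde C(m)$ have rows $\tilde c_1^\top,\dots,\tilde c_m^\top$, and let $C=C(m)=[A_0,\ A_0X_0]+\widetilde C$. Let $\lambda_m=\lambda_{\min}(A_0^\top A_0)$. For each $m$, by an estimator $\widehat X=\widehat X(m)$ we mean any solution of $(\ast\ast)$ for any choice of a solution $\Delta$ of $(\ast)$ (arbitrary if $(\ast\ast)$ has no solution for the chosen $\Delta$). 2. Suppose that for some $r\in[1,2]$ one has $\sup_{i,j}\mathsf E|\delta_{ij}|^{2r}<\infty$ and $m^{-1/r}\lambda_m\to\infty$ as $m\to\infty$. Then, with probability tending to $1$ as $m\to\infty$, $(\ast\ast)$ has a solution for every solution $\Delta$ of $(\ast)$; and every estimator satisfies $\widehat X\to X_0$ in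 probability. 3. Suppose that either (a) for some $r\ge2$ and $m_0\ge1$, $\sup_{i,j}\mathsf E|\delta_{ij}|^{2r}<\infty$ and $\sum_{m\ge m_0}(\sqrt m/\lambda_m)^r<\infty$; or (b) for some $r\in[1,2]$ and $m_0\ge1$, $\sup_{i,j}\mathsf E|\delta_{ij}|^{2r}<\infty$ and $\sum_{m\ge m_0}\lambda_m^{-r}<\infty$ (finiteness of the sums including $\lambda_m>0$ for $m\ge m_0$). Then almost surely, for all sufficiently large $m$, $(\ast\ast)$ has a solution for every solution $\Delta$ of $(\ast)$; and every estimator satisfies $\widehat X\to X_0$ almost surely. The statements 1–3 remain true if, for every $m$, the objective in $(\ast)$ is replaced by $|||\Delta(\Sigma^{1/2})^\dagger|||$, where $|||\cdot|||$ is an arbitrary unitarily invariant norm on real $m\times(n+d)$ matrices (that is, a norm with $|||UMV|||=|||M|||$ for all orthogonal $U,V$). The solutions need not be unique: for all $n,d\ge1$ and $\Sigma=I$ there are an $m$ and a matrix $C\in\mathbb R^{m\times(n+d)}$ of rank $n+d$ for which $(\ast\ast)$ has at least two solutions for some solution $\Delta$ of $(\ast)$, and for which, for each unitarily invariant norm,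 the modified problem also leads to at least two different matrices $\widehat X$ (possibly from different $\Delta$). -/

import Mathlib

open MeasureTheory ProbabilityTheory Filter Topology
open scoped ENNReal NNReal Matrix

noncomputable section

namespace TLS

/-! ### Linear algebra -/

/-- Smallest eigenvalue of a real symmetric matrix (the real spectrum is the finite set of
eigenvalues, nonempty as soon as the matrix is not `0 × 0`). -/
def lamMin {ι : Type*} [Fintype ι] [DecidableEq ι] (M : Matrix ι ι ℝ) : ℝ :=
  sInf (spectrum ℝ M)

/-- Largest eigenvalue of a real symmetric matrix (`0` for the `0 × 0` matrix). -/
def lamMax {ι : Type*} [Fintype ι] [DecidableEq ι] (M : Matrix ι ι ℝ) : ℝ :=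
  sSup (spectrum ℝ M)

/-- The four Penrose conditions: `B` is the Moore–Penrose pseudoinverse of `A`. -/
structure IsMoorePenrose {ι κ : Type*} [Fintype ι] [Fintype κ]
    (A : Matrix ι κ ℝ) (B : Matrix κ ι ℝ) : Prop where
  mul_mul_left : A * B * A = A
  mul_mul_right : B * A * B = B
  symm_left : (A * B)ᵀ = A * B
  symm_right : (B * A)ᵀ = B * A

/-- Moore–Penrose pseudoinverse of a symmetric matrix: keep the eigenvectors, invert the nonzero
eigenvalues and keep the zero eigenvalues (functional calculus; `0⁻¹ = 0`).
See `isMoorePenrose_pinv`. -/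
def pinv {ι : Type*} [Fintype ι] [DecidableEq ι] (S : Matrix ι ι ℝ) : Matrix ι ι ℝ :=
  cfc (fun x : ℝ => x⁻¹) S

/-- Positive semidefinite square root `S^{1/2}` of a positive semidefinite matrix.
See `sqrtM_mul_sqrtM` and `posSemidef_sqrtM`. -/
def sqrtM {ι : Type*} [Fintype ι] [DecidableEq ι] (S : Matrix ι ι ℝ) : Matrix ι ι ℝ :=
  cfc Real.sqrt S

/-- `P_S = S S†`, the orthogonal projector onto the column space of `S`. -/
def projCol {ι : Type*} [Fintype ι] [DecidableEq ι] (S : Matrix ι ι ℝ) : Matrix ι ι ℝ :=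
  S * pinv S

/-- The augmented matrix with upper block `X` and lower block `-I`. -/
def ext {n d : ℕ} (X : Matrix (Fin n) (Fin d) ℝ) : Matrix (Fin n ⊕ Fin d) (Fin d) ℝ :=
  Matrix.fromRows X (-1)

/-- `N` is a unitarily invariant norm on real matrices with rows `ι` and columns `κ`
(over the reals the unitary matrices are the orthogonal ones). -/
structure IsUnitarilyInvariantNorm {ι κ : Type*} [Fintype ι] [DecidableEq ι] [Fintype κ]
    [DecidableEq κ] (N : Seminorm ℝ (Matrix ι κ ℝ)) : Prop where
  definite : ∀ M, N M = 0 → M = 0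
  invariant : ∀ U ∈ Matrix.orthogonalGroup ι ℝ, ∀ V ∈ Matrix.orthogonalGroup κ ℝ,
    ∀ M, N (U * M * V) = N M

section Facts

variable {ι : Type*} [Fintype ι] [DecidableEq ι] {S : Matrix ι ι ℝ}

theorem isMoorePenrose_pinv (hS : S.IsHermitian) : IsMoorePenrose S (pinv S) := by
  have hc : ∀ f : ℝ → ℝ, ContinuousOn f (spectrum ℝ S) :=
    fun f => (Matrix.finite_real_spectrum (A := S)).continuousOn f
  have hsa : IsSelfAdjoint S := hS
  have hid : cfc (fun x : ℝ => x) S = S := cfc_id' ℝ S hsa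
  have h1 : S * pinv S = cfc (fun x : ℝ => x * x⁻¹) S := by
    have := cfc_mul (fun x : ℝ => x) (fun x : ℝ => x⁻¹) S (hc _) (hc _)
    rw [hid] at this
    exact this.symm
  have h2 : pinv S * S = cfc (fun x : ℝ => x * x⁻¹) S := by
    have := cfc_mul (fun x : ℝ => x⁻¹) (fun x : ℝ => x) S (hc _) (hc _)
    rw [hid] at this
    rw [pinv, ← this]
    simp only [mul_comm]
  have h3 : (cfc (fun x : ℝ => x * x⁻¹) S)ᵀ = cfc (fun x : ℝ => x * x⁻¹) S := by
    have h : IsSelfAdjoint (cfc (fun x : ℝ => x * x⁻¹) S) := cfc_predicate _ S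
    simpa [IsSelfAdjoint, Matrix.star_eq_conjTranspose] using h
  refine ⟨?_, ?_, ?_, ?_⟩
  · rw [h1]
    have := cfc_mul (fun x : ℝ => x * x⁻¹) (fun x : ℝ => x) S (hc _) (hc _)
    rw [hid] at this
    rw [← this]
    simp [hid]
  · rw [h2, pinv, ← cfc_mul _ _ S (hc _) (hc _)]
    congr 1
    funext x
    by_cases hx : x = 0 <;> simp [hx]
  · rw [h1, h3]
  · rw [h2, h3]

theorem sqrtM_mul_sqrtM (hS : S.PosSemidef) : sqrtM S * sqrtM S = S := by
  have hc : ∀ f : ℝ → ℝ, ContinuousOn f (spectrum ℝ S) :=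
    fun f => (Matrix.finite_real_spectrum (A := S)).continuousOn f
  have hsa : IsSelfAdjoint S := hS.1
  rw [sqrtM, ← cfc_mul _ _ S (hc _) (hc _)]
  conv_rhs => rw [← cfc_id' ℝ S hsa]
  refine cfc_congr fun x hx => ?_
  rw [hS.1.spectrum_real_eq_range_eigenvalues] at hx
  obtain ⟨i, rfl⟩ := hx
  exact Real.mul_self_sqrt (hS.eigenvalues_nonneg i)

theorem posSemidef_sqrtM : (sqrtM S).PosSemidef := by
  have hc : ∀ f : ℝ → ℝ, ContinuousOn f (spectrum ℝ S) :=
    fun f => (Matrix.finite_real_spectrum (A := S)).continuousOn f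
  have h : sqrtM S
      = (cfc (fun x => Real.sqrt (Real.sqrt x)) S)ᴴ * cfc (fun x => Real.sqrt (Real.sqrt x)) S := by
    have hs : IsSelfAdjoint (cfc (fun x => Real.sqrt (Real.sqrt x)) S) := cfc_predicate _ S
    rw [← Matrix.star_eq_conjTranspose, hs.star_eq, ← cfc_mul _ _ S (hc _) (hc _), sqrtM]
    congr 1
    funext x
    exact (Real.mul_self_sqrt (Real.sqrt_nonneg x)).symm
  rw [h]
  exact Matrix.posSemidef_conjTranspose_mul_self _

end Facts

/-! ### The optimization problems -/

section Optimization

variable {m n d : ℕ}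

/-- The constraints `Δ (I - P_S) = 0`, `rank (C - Δ) ≤ n`. -/
def Feasible (S : Matrix (Fin n ⊕ Fin d) (Fin n ⊕ Fin d) ℝ)
    (C Δ : Matrix (Fin m) (Fin n ⊕ Fin d) ℝ) : Prop :=
  Δ * (1 - projCol S) = 0 ∧ (C - Δ).rank ≤ n

/-- `Δ` minimizes the objective `f` under the constraints. -/
def IsMinimizer (S : Matrix (Fin n ⊕ Fin d) (Fin n ⊕ Fin d) ℝ)
    (C : Matrix (Fin m) (Fin n ⊕ Fin d) ℝ) (f : Matrix (Fin m) (Fin n ⊕ Fin d) ℝ → ℝ)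
    (Δ : Matrix (Fin m) (Fin n ⊕ Fin d) ℝ) : Prop :=
  Feasible S C Δ ∧ ∀ Δ', Feasible S C Δ' → f Δ ≤ f Δ'

/-- Spectral-norm objective `λ_max (Δ S† Δᵀ)`. -/
def specObj (S : Matrix (Fin n ⊕ Fin d) (Fin n ⊕ Fin d) ℝ)
    (Δ : Matrix (Fin m) (Fin n ⊕ Fin d) ℝ) : ℝ :=
  lamMax (Δ * pinv S * Δᵀ)

/-- Objective `N (Δ (S^{1/2})†)` for a norm `N`. -/
def normObj (S : Matrix (Fin n ⊕ Fin d) (Fin n ⊕ Fin d) ℝ)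
    (N : Seminorm ℝ (Matrix (Fin m) (Fin n ⊕ Fin d) ℝ))
    (Δ : Matrix (Fin m) (Fin n ⊕ Fin d) ℝ) : ℝ :=
  N (Δ * pinv (sqrtM S))

/-- `X` solves the linear equation `(C - Δ) (X; -I) = 0`. -/
def Solves (C Δ : Matrix (Fin m) (Fin n ⊕ Fin d) ℝ) (X : Matrix (Fin n) (Fin d) ℝ) : Prop :=
  (C - Δ) * ext X = 0

end Optimization

/-! ### The errors-in-variables model -/

section Model

variable {n d : ℕ}

/-- `A₀` for sample size `m`: its rows are the first `m` true regressor vectors. -/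
def A₀ (a : ℕ → Fin n → ℝ) (m : ℕ) : Matrix (Fin m) (Fin n) ℝ :=
  Matrix.of fun (i : Fin m) => a i

/-- `C₀ = [A₀, A₀ X₀]`. -/
def C₀ (a : ℕ → Fin n → ℝ) (X₀ : Matrix (Fin n) (Fin d) ℝ) (m : ℕ) :
    Matrix (Fin m) (Fin n ⊕ Fin d) ℝ :=
  Matrix.fromCols (A₀ a m) (A₀ a m * X₀)

/-- The observations `C = C₀ + C̃`; the rows of `C̃` are the first `m` error vectors. -/
def obs {Ω : Type*} (a : ℕ → Fin n → ℝ) (X₀ : Matrix (Fin n) (Fin d) ℝ)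
    (c : ℕ → Ω → (Fin n ⊕ Fin d) → ℝ) (m : ℕ) (ω : Ω) : Matrix (Fin m) (Fin n ⊕ Fin d) ℝ :=
  C₀ a X₀ m + Matrix.of fun (i : Fin m) => c i ω

/-- The errors `c i` are independent centred random vectors with common covariance matrix `S`. -/
structure ErrorModel {Ω : Type*} [MeasurableSpace Ω] (P : Measure Ω)
    (S : Matrix (Fin n ⊕ Fin d) (Fin n ⊕ Fin d) ℝ)
    (c : ℕ → Ω → (Fin n ⊕ Fin d) → ℝ) : Prop where
  measurable : ∀ i, Measurable (c i)
  indep : iIndepFun c P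
  memLp : ∀ i j, MemLp (fun ω => c i ω j) 2 P
  mean : ∀ i j, ∫ ω, c i ω j ∂P = 0
  cov : ∀ i j k, ∫ ω, c i ω j * c i ω k ∂P = S j k

/-- `sup_{i,j} E |δ_{ij}|^p < ∞`. -/
def BoundedMoments {Ω : Type*} [MeasurableSpace Ω] (P : Measure Ω)
    (c : ℕ → Ω → (Fin n ⊕ Fin d) → ℝ) (p : ℝ) : Prop :=
  ∃ K : ℝ≥0, ∀ i j, ∫⁻ ω, ENNReal.ofReal (|c i ω j| ^ p) ∂P ≤ (K : ℝ≥0∞)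

/-- `λ_min (A₀ᵀ A₀)` for sample size `m`. -/
def lam (a : ℕ → Fin n → ℝ) (m : ℕ) : ℝ :=
  lamMin ((A₀ a m)ᵀ * A₀ a m)

/-- First (weak) set of conditions: `1 ≤ r ≤ 2`, bounded moments of order `2r` and
`m^{-1/r} λ_min (A₀ᵀ A₀) → ∞`. -/
def WeakCond {Ω : Type*} [MeasurableSpace Ω] (P : Measure Ω) (a : ℕ → Fin n → ℝ)
    (c : ℕ → Ω → (Fin n ⊕ Fin d) → ℝ) : Prop :=
  ∃ r : ℝ, 1 ≤ r ∧ r ≤ 2 ∧ BoundedMoments P c (2 * r) ∧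
    Tendsto (fun m : ℕ => (m : ℝ) ^ (-(1 / r)) * lam a m) atTop atTop

/-- Second (strong) set of conditions: `r ≥ 2`, bounded moments of order `2r` and
`∑_{m ≥ m₀} (√m / λ_min (A₀ᵀ A₀))^r < ∞`; a finite sum presupposes nonzero denominators. -/
def StrongCondA {Ω : Type*} [MeasurableSpace Ω] (P : Measure Ω) (a : ℕ → Fin n → ℝ)
    (c : ℕ → Ω → (Fin n ⊕ Fin d) → ℝ) : Prop :=
  ∃ r : ℝ, 2 ≤ r ∧ BoundedMoments P c (2 * r) ∧
    ∃ m₀ : ℕ, 1 ≤ m₀ ∧ (∀ m, m₀ ≤ m → 0 < lam a m) ∧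
      Summable fun k : ℕ => (Real.sqrt ((m₀ + k : ℕ) : ℝ) / lam a (m₀ + k)) ^ r

/-- Third (strong) set of conditions: `1 ≤ r ≤ 2`, bounded moments of order `2r` and
`∑_{m ≥ m₀} 1 / λ_min (A₀ᵀ A₀)^r < ∞`; a finite sum presupposes nonzero denominators. -/
def StrongCondB {Ω : Type*} [MeasurableSpace Ω] (P : Measure Ω) (a : ℕ → Fin n → ℝ)
    (c : ℕ → Ω → (Fin n ⊕ Fin d) → ℝ) : Prop :=
  ∃ r : ℝ, 1 ≤ r ∧ r ≤ 2 ∧ BoundedMoments P c (2 * r) ∧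
    ∃ m₀ : ℕ, 1 ≤ m₀ ∧ (∀ m, m₀ ≤ m → 0 < lam a m) ∧
      Summable fun k : ℕ => 1 / lam a (m₀ + k) ^ r

end Model

/-! ### Asymptotic notions -/

/-- The event `E m` occurs with high probability. Stated through complements, so that for
events which are not known to be measurable it bounds the outer measure of the failure. -/
def WithHighProb {Ω : Type*} [MeasurableSpace Ω] (P : Measure Ω) (E : ℕ → Set Ω) : Prop :=
  Tendsto (fun m => P (E m)ᶜ) atTop (𝓝 0)

/-- The event `E m` occurs eventually: almost surely, for all sufficiently large `m`. -/
def OccursEventually {Ω : Type*} [MeasurableSpace Ω] (P : Measure Ω) (E : ℕ → Set Ω) : Prop :=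
  ∀ᵐ ω ∂P, ∀ᶠ m in atTop, ω ∈ E m

section Estimator

variable {n d : ℕ} {Ω : Type*}

/-- The event that for every minimizer `Δ` the equation `(C - Δ) (X; -I) = 0` has a solution. -/
def solvableEvent (S : Matrix (Fin n ⊕ Fin d) (Fin n ⊕ Fin d) ℝ)
    (f : ∀ m, Matrix (Fin m) (Fin n ⊕ Fin d) ℝ → ℝ)
    (C : ∀ m, Ω → Matrix (Fin m) (Fin n ⊕ Fin d) ℝ) (m : ℕ) : Set Ω :=
  {ω | ∀ Δ, IsMinimizer S (C m ω) (f m) Δ → ∃ X, Solves (C m ω) Δ X}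

/-- `Xhat` is a resulting estimator: for each sample it is obtained from some choice of a
minimizer `Δ` as some solution of `(C - Δ) (Xhat; -I) = 0`, whenever this equation is solvable
(and is arbitrary otherwise). No measurability of the choices is required. -/
def IsEstimator (S : Matrix (Fin n ⊕ Fin d) (Fin n ⊕ Fin d) ℝ)
    (f : ∀ m, Matrix (Fin m) (Fin n ⊕ Fin d) ℝ → ℝ)
    (C : ∀ m, Ω → Matrix (Fin m) (Fin n ⊕ Fin d) ℝ)
    (Xhat : ℕ → Ω → Matrix (Fin n) (Fin d) ℝ) : Prop :=
  ∀ m ω, ∃ Δ, IsMinimizer S (C m ω) (f m) Δ ∧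
    ((∃ X, Solves (C m ω) Δ X) → Solves (C m ω) Δ (Xhat m ω))

/-- Solvability with high probability, and convergence in probability to `X₀` (entrywise, which
for matrices of fixed size is convergence in probability) of every resulting estimator. -/
def WeaklyConsistent [MeasurableSpace Ω] (P : Measure Ω)
    (S : Matrix (Fin n ⊕ Fin d) (Fin n ⊕ Fin d) ℝ) (X₀ : Matrix (Fin n) (Fin d) ℝ)
    (f : ∀ m, Matrix (Fin m) (Fin n ⊕ Fin d) ℝ → ℝ)
    (C : ∀ m, Ω → Matrix (Fin m) (Fin n ⊕ Fin d) ℝ) : Prop :=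
  WithHighProb P (solvableEvent S f C) ∧
    ∀ Xhat, IsEstimator S f C Xhat →
      ∀ i j, TendstoInMeasure P (fun m ω => Xhat m ω i j) atTop (fun _ => X₀ i j)

/-- Solvability eventually, and almost sure convergence to `X₀` of every resulting estimator. -/
def StronglyConsistent [MeasurableSpace Ω] (P : Measure Ω)
    (S : Matrix (Fin n ⊕ Fin d) (Fin n ⊕ Fin d) ℝ) (X₀ : Matrix (Fin n) (Fin d) ℝ)
    (f : ∀ m, Matrix (Fin m) (Fin n ⊕ Fin d) ℝ → ℝ)
    (C : ∀ m, Ω → Matrix (Fin m) (Fin n ⊕ Fin d) ℝ) : Prop :=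
  OccursEventually P (solvableEvent S f C) ∧
    ∀ Xhat, IsEstimator S f C Xhat →
      ∀ᵐ ω ∂P, Tendsto (fun m => Xhat m ω) atTop (𝓝 X₀)

end Estimator

end TLS

end

open TLS

/-! Write `C = C₀ + W` with `C₀ = [A₀, A₀ X₀]`, so that `C₀ * ext X₀ = 0`, and put `R = sqrtM S`, `λ
= lam a m`. Since `λ_max (Δ S† Δᵀ)` is the square of the spectral norm of `Δ R†`, the original
objective has the minimizers of a unitarily invariant one, and a single argument serves all norms.

Deterministic core (`exists_residual_le`). Assume `Wᵀ W - m S` is `O(ε λ)` and the component of `W`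
in the column space of `A₀` has square `O(ε λ)`. With `F = ext X₀ * B` normalized by `Fᵀ S F = 1`,
the matrix `C F Fᵀ S` is feasible, and as `C F = W F` its objective is the norm of a matrix with `d`
singular values at most `√(m + O(ε λ))`. For a minimizer `Δ`, the kernel of `C - Δ` has dimension at
least `d`, and `C v = (Δ R†) (R v)` on it. There `|C v|² ≥ λ/4 |residual|² + (m - O(ε λ)) vᵀ S v`
(`le_mulVec_add`), so `Δ R†` is bounded below on a `d`-dimensional space. The norm comparison
controls the mean of its `d` singular values there; as all of them are at least about `√m`, none
exceeds it by much (`IsUnitarilyInvariantNorm.mulVec_le`). Hence `|C v|² ≤ (m + O(ε λ)) vᵀ S v`, and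
subtraction leaves `|residual|² = O(ε) |v|²`. So the kernel is close to the column space of `ext
X₀`, which yields both solvability and `X ≈ X₀`.

Probability enters only through the events `smallErrors`. Sums of centred products are controlled by
the von Bahr–Esseen inequality of order `r`, which costs a factor `m`; sums weighted by orthonormal
vectors are controlled by a Rosenthal inequality of order `2r`, with a bound free of `m`. Markov's
inequality gives the weak result. For the strong one, martingale convergence and Kronecker's lemma
treat the products, and Borel–Cantelli the weighted sums; condition (a) implies (b) with exponent
`2`.

For nonuniqueness, `C` has orthonormal columns: every `d`-dimensional subspace is then equally cheap
to annihilate. -/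

namespace TLS

/-! ### Orthonormal columns and the thin singular value decomposition -/

section OrthonormalColumns

variable {ι κ : Type*} [Fintype ι] [DecidableEq ι] [Fintype κ] [DecidableEq κ]

/-- A matrix with pairwise orthogonal columns is, up to scaling of the columns, a part of an
orthogonal matrix. -/
theorem exists_orthogonal_extension (e : κ ↪ ι) (G : Matrix ι κ ℝ) (g : κ → ℝ)
    (h : Gᵀ * G = Matrix.diagonal g) :
    ∃ O ∈ Matrix.orthogonalGroup ι ℝ, ∀ i k, G i k = O i (e k) * √(g k) := by
  have hG : ∀ k l, ∑ i, G i k * G i l = if k = l then g k else 0 := by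
    intro k l
    have := congrFun (congrFun h k) l
    simpa [Matrix.mul_apply, Matrix.diagonal_apply] using this
  have hg : ∀ k, 0 ≤ g k := by
    intro k
    have := hG k k
    rw [if_pos rfl] at this
    rw [← this]
    exact Finset.sum_nonneg fun i _ => mul_self_nonneg _
  set w : κ → EuclideanSpace ℝ ι := fun k => WithLp.toLp 2 fun i => G i k / √(g k) with hw
  set v : ι → EuclideanSpace ℝ ι := Function.extend e w 0 with hv
  -- Only nonzero columns have to be kept: if `g k = 0`, the column of `G` vanishes and the factor
  -- `√(g k)` makes the completing column irrelevant.
  set s : Set ι := e '' {k | g k ≠ 0} with hs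
  have hve : ∀ k, v (e k) = w k := fun k => e.injective.extend_apply _ _ _
  have horth : Orthonormal ℝ (s.domRestrict v) := by
    rw [orthonormal_iff_ite]
    rintro ⟨_, k, hk, rfl⟩ ⟨_, l, hl, rfl⟩
    have hk' : √(g k) ≠ 0 := (Real.sqrt_pos.2 ((hg k).lt_of_ne' hk)).ne'
    simp only [Set.domRestrict_apply, hve]
    have : inner ℝ (w k) (w l) = (∑ i, G i k * G i l) / (√(g k) * √(g l)) := by
      simp only [hw, PiLp.inner_apply, Finset.sum_div]
      refine Finset.sum_congr rfl fun i _ => ?_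
      simp only [RCLike.inner_apply, conj_trivial]
      ring
    rw [this, hG]
    by_cases hkl : k = l
    · subst hkl
      rw [if_pos rfl, if_pos rfl, Real.mul_self_sqrt (hg k)]
      exact div_self hk
    · rw [if_neg hkl, zero_div]
      exact (if_neg fun h => hkl (e.injective (Subtype.mk.inj h))).symm
  obtain ⟨b, hb⟩ := horth.exists_orthonormalBasis_extension_of_card_eq (by simp)
  refine ⟨Matrix.of fun i j => b j i, ?_, ?_⟩
  · rw [Matrix.mem_orthogonalGroup_iff']
    ext j k
    have := orthonormal_iff_ite.1 b.orthonormal j k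
    rw [PiLp.inner_apply] at this
    refine (Matrix.mul_apply ..).trans (Eq.trans ?_ (this.trans (Matrix.one_apply ..).symm))
    refine Finset.sum_congr rfl fun i _ => ?_
    simp [Matrix.star_apply, mul_comm]
  · intro i k
    by_cases hk : g k = 0
    · have h0 := hG k k
      rw [if_pos rfl, hk, Finset.sum_eq_zero_iff_of_nonneg fun i _ => mul_self_nonneg _] at h0
      have := h0 i (Finset.mem_univ i)
      simp [mul_self_eq_zero.1 this, hk]
    · have hk' : √(g k) ≠ 0 := (Real.sqrt_pos.2 ((hg k).lt_of_ne' hk)).ne'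
      have := hb (e k) ⟨k, hk, rfl⟩
      simp only [Matrix.of_apply, this, hve, hw]
      field_simp

theorem card_le_of_transpose_mul_self {U : Matrix ι κ ℝ} (hU : Uᵀ * U = 1) :
    Fintype.card κ ≤ Fintype.card ι := by
  have h1 : (Uᵀ * U).rank = Fintype.card κ := by rw [hU, Matrix.rank_one]
  have h2 := Matrix.rank_mul_le_right Uᵀ U
  have h3 := Matrix.rank_le_card_height U
  omega

/-- The orthogonal group acts transitively on matrices with orthonormal columns. -/
theorem exists_orthogonal_mul_eq {U U' : Matrix ι κ ℝ} (hU : Uᵀ * U = 1) (hU' : U'ᵀ * U' = 1) :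
    ∃ O ∈ Matrix.orthogonalGroup ι ℝ, O * U = U' := by
  obtain ⟨e⟩ := Function.Embedding.nonempty_of_card_le (card_le_of_transpose_mul_self hU)
  obtain ⟨O, hO, h⟩ := exists_orthogonal_extension e U 1 (by rw [hU]; exact Matrix.diagonal_one.symm)
  obtain ⟨O', hO', h'⟩ :=
    exists_orthogonal_extension e U' 1 (by rw [hU']; exact Matrix.diagonal_one.symm)
  have hO2 : Oᵀ * O = 1 := by
    have := (Matrix.mem_orthogonalGroup_iff' ι ℝ).1 hO
    simpa [Matrix.star_eq_conjTranspose] using this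
  have e1 : U = O * (1 : Matrix ι ι ℝ).submatrix id e := by
    ext i k; simp [h, Matrix.mul_apply, Matrix.one_apply]
  have e2 : U' = O' * (1 : Matrix ι ι ℝ).submatrix id e := by
    ext i k; simp [h', Matrix.mul_apply, Matrix.one_apply]
  refine ⟨O' * Oᵀ, mul_mem hO' ?_, ?_⟩
  · simpa [Matrix.star_eq_conjTranspose] using Unitary.star_mem hO
  · rw [e1, e2, ← Matrix.mul_assoc, Matrix.mul_assoc O', hO2, Matrix.mul_one]

theorem spectral_decomposition {S : Matrix ι ι ℝ} (hS : S.IsHermitian) :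
    ∃ Q : Matrix ι ι ℝ, Qᵀ * Q = 1 ∧ Q * Qᵀ = 1 ∧ S = Q * Matrix.diagonal hS.eigenvalues * Qᵀ := by
  have hQ1 : (hS.eigenvectorUnitary.1)ᵀ * hS.eigenvectorUnitary.1 = 1 := by
    have := Unitary.coe_star_mul_self hS.eigenvectorUnitary
    simpa [Matrix.star_eq_conjTranspose] using this
  refine ⟨hS.eigenvectorUnitary.1, hQ1, mul_eq_one_comm.1 hQ1, ?_⟩
  have hs := hS.spectral_theorem
  rw [Unitary.conjStarAlgAut_apply] at hs
  simpa [Matrix.star_eq_conjTranspose, Function.comp_def] using hs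

/-- Thin singular value decomposition of a matrix with at least as many rows as columns. -/
theorem exists_thin_svd (hc : Fintype.card κ ≤ Fintype.card ι) (Z : Matrix ι κ ℝ) :
    ∃ (U : Matrix ι κ ℝ) (s : κ → ℝ) (Q : Matrix κ κ ℝ), Uᵀ * U = 1 ∧ Qᵀ * Q = 1 ∧ Q * Qᵀ = 1 ∧
      (∀ k, 0 ≤ s k) ∧ Z = U * Matrix.diagonal s * Qᵀ := by
  obtain ⟨e⟩ := Function.Embedding.nonempty_of_card_le hc
  have hH : (Zᵀ * Z).IsHermitian := by
    simpa using Matrix.isHermitian_conjTranspose_mul_self Z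
  obtain ⟨Q, hQ1, hQ2, hs'⟩ := spectral_decomposition hH
  set μ := hH.eigenvalues with hμ
  clear_value μ
  -- As `Q` diagonalizes `Zᵀ * Z`, the columns of `Z * Q` are orthogonal; normalized and completed,
  -- they are the left singular vectors.
  have hd : (Z * Q)ᵀ * (Z * Q) = Matrix.diagonal μ := by
    calc (Z * Q)ᵀ * (Z * Q) = Qᵀ * (Zᵀ * Z) * Q := by
          rw [Matrix.transpose_mul]; simp only [Matrix.mul_assoc]
      _ = (Qᵀ * Q) * Matrix.diagonal μ * (Qᵀ * Q) := by
          rw [hs']; simp only [Matrix.mul_assoc]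
      _ = _ := by rw [hQ1]; simp
  obtain ⟨O, hO, h⟩ := exists_orthogonal_extension e (Z * Q) _ hd
  have hO2 : Oᵀ * O = 1 := by
    have := (Matrix.mem_orthogonalGroup_iff' ι ℝ).1 hO
    simpa [Matrix.star_eq_conjTranspose] using this
  refine ⟨O.submatrix id e, fun k => √(μ k), Q, ?_, hQ1, hQ2,
    fun k => Real.sqrt_nonneg _, ?_⟩
  · rw [Matrix.transpose_submatrix, ← Matrix.submatrix_mul _ _ _ _ _ Function.bijective_id, hO2,
      Matrix.submatrix_one _ e.injective]
  · have : Z * Q = O.submatrix id e * Matrix.diagonal fun k => √(μ k) := by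
      ext i k
      rw [h, Matrix.mul_diagonal]; rfl
    rw [← this, Matrix.mul_assoc, hQ2, Matrix.mul_one]

end OrthonormalColumns

/-! ### Inequalities for unitarily invariant norms -/

section UnitarilyInvariantNorm

variable {ι κ η : Type*} [Fintype ι] [DecidableEq ι] [Fintype κ] [DecidableEq κ]
  [Fintype η] [DecidableEq η] {N : Seminorm ℝ (Matrix ι κ ℝ)}

theorem submatrix_transpose_mul_self {A : Matrix ι η ℝ} (hA : Aᵀ * A = 1) (π : η ≃ η) :
    (A.submatrix id π)ᵀ * A.submatrix id π = 1 := by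
  rw [Matrix.transpose_submatrix, ← Matrix.submatrix_mul _ _ _ _ _ Function.bijective_id, hA,
    Matrix.submatrix_one _ π.injective]

/-- A unitarily invariant norm only depends on the singular values. -/
theorem IsUnitarilyInvariantNorm.apply_congr (hN : IsUnitarilyInvariantNorm N)
    {U U' : Matrix ι η ℝ} {V V' : Matrix κ η ℝ} (hU : Uᵀ * U = 1) (hU' : U'ᵀ * U' = 1)
    (hV : Vᵀ * V = 1) (hV' : V'ᵀ * V' = 1) (D : Matrix η η ℝ) :
    N (U * D * Vᵀ) = N (U' * D * V'ᵀ) := by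
  obtain ⟨O, hO, rfl⟩ := exists_orthogonal_mul_eq hU hU'
  obtain ⟨O', hO', rfl⟩ := exists_orthogonal_mul_eq hV hV'
  have h2 : O'ᵀ ∈ Matrix.orthogonalGroup κ ℝ := by
    simpa [Matrix.star_eq_conjTranspose] using Unitary.star_mem hO'
  rw [← hN.invariant O hO O'ᵀ h2 (U * D * Vᵀ), Matrix.transpose_mul]
  simp only [Matrix.mul_assoc]

/-- An even convex function is monotone on the positive half-line. -/
theorem seminorm_add_smul_le {E : Type*} [AddCommGroup E] [Module ℝ E] (p : Seminorm ℝ E) (x y : E)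
    {s t : ℝ} (hs : 0 ≤ s) (hst : s ≤ t) (h : p (x + t • y) = p (x - t • y)) :
    p (x + s • y) ≤ p (x + t • y) := by
  rcases (hs.trans hst).eq_or_lt with h0 | h0
  · have : s = t := by linarith
    rw [this]
  · have e : x + s • y = ((t + s) / (2 * t)) • (x + t • y) + ((t - s) / (2 * t)) • (x - t • y) := by
      have h1 : x + s • y = ((t + s) / (2 * t) + (t - s) / (2 * t)) • x
          + (((t + s) / (2 * t) - (t - s) / (2 * t)) * t) • y := by
        congr 1
        · rw [← add_div]
          have : (t + s + (t - s)) / (2 * t) = 1 := by field_simp; ring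
          rw [this, one_smul]
        · congr 1; field_simp; ring
      rw [h1]; module
    have h1 : 0 ≤ (t + s) / (2 * t) := by positivity
    have h2 : 0 ≤ (t - s) / (2 * t) := div_nonneg (by linarith) (by positivity)
    rw [e]
    refine (map_add_le_add p _ _).trans ?_
    rw [map_smul_eq_mul, map_smul_eq_mul, ← h, Real.norm_of_nonneg h1, Real.norm_of_nonneg h2,
      ← add_mul, ← add_div]
    have : (t + s + (t - s)) / (2 * t) = 1 := by field_simp; ring
    rw [this, one_mul]

/-- Flipping signs of singular vectors. -/
theorem IsUnitarilyInvariantNorm.diagonal_neg_single (hN : IsUnitarilyInvariantNorm N)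
    {U : Matrix ι η ℝ} {V : Matrix κ η ℝ} (hU : Uᵀ * U = 1) (hV : Vᵀ * V = 1) (s : η → ℝ) (k : η)
    (t : ℝ) :
    N (U * Matrix.diagonal (Function.update s k (-t)) * Vᵀ)
      = N (U * Matrix.diagonal (Function.update s k t) * Vᵀ) := by
  set σ : η → ℝ := Function.update 1 k (-1) with hσ
  have hσ2 : ∀ i, σ i * σ i = 1 := by
    intro i
    by_cases hi : i = k
    · subst hi; simp [hσ]
    · simp [hσ, hi]
  -- The sign is moved into `U`, whose columns stay orthonormal.
  have e : U * Matrix.diagonal (Function.update s k (-t)) * Vᵀ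
      = (U * Matrix.diagonal σ) * Matrix.diagonal (Function.update s k t) * Vᵀ := by
    rw [Matrix.mul_assoc U (Matrix.diagonal σ), Matrix.diagonal_mul_diagonal]
    congr 3
    funext i
    by_cases hi : i = k
    · subst hi; simp [hσ]
    · simp [hσ, hi]
  rw [e]
  refine hN.apply_congr ?_ hU hV hV _
  rw [Matrix.transpose_mul, Matrix.mul_assoc, ← Matrix.mul_assoc Uᵀ, hU, Matrix.one_mul,
    Matrix.diagonal_transpose, Matrix.diagonal_mul_diagonal]
  simp [hσ2]

/-- In each singular value separately the norm is convex and even, hence nondecreasing on the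
half-line. The values are raised to `t` one at a time. -/
theorem IsUnitarilyInvariantNorm.diagonal_mono (hN : IsUnitarilyInvariantNorm N)
    {U : Matrix ι η ℝ} {V : Matrix κ η ℝ} (hU : Uᵀ * U = 1) (hV : Vᵀ * V = 1) {s : η → ℝ} {t : ℝ}
    (hs : ∀ k, 0 ≤ s k) (hst : ∀ k, s k ≤ t) :
    N (U * Matrix.diagonal s * Vᵀ) ≤ N (U * (Matrix.diagonal fun _ => t : Matrix η η ℝ) * Vᵀ) := by
  have key : ∀ (w : η → ℝ) (k : η) (a b : ℝ), 0 ≤ a → a ≤ b →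
      N (U * Matrix.diagonal (Function.update w k a) * Vᵀ)
        ≤ N (U * Matrix.diagonal (Function.update w k b) * Vᵀ) := by
    intro w k a b ha hab
    have e : ∀ c : ℝ, U * Matrix.diagonal (Function.update w k c) * Vᵀ
        = U * Matrix.diagonal (Function.update w k 0) * Vᵀ
          + c • (U * Matrix.diagonal (Pi.single k (1 : ℝ)) * Vᵀ) := by
      intro c
      have : Matrix.diagonal (Function.update w k c)
          = Matrix.diagonal (Function.update w k 0) + c • Matrix.diagonal (Pi.single k (1 : ℝ)) := by
        rw [← Matrix.diagonal_smul, Matrix.diagonal_add]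
        congr 1
        funext i
        by_cases hi : i = k
        · subst hi; simp
        · simp [hi]
      rw [this, Matrix.mul_add, Matrix.add_mul]
      simp
    have hneg := hN.diagonal_neg_single hU hV w k b
    rw [e a, e b]
    refine seminorm_add_smul_le N _ _ ha hab ?_
    rw [← e b, sub_eq_add_neg, ← neg_smul, ← e (-b), hneg]
  have main : ∀ F : Finset η, N (U * Matrix.diagonal s * Vᵀ)
      ≤ N (U * (Matrix.diagonal fun k => if k ∈ F then t else s k : Matrix η η ℝ) * Vᵀ) := by
    intro F
    induction F using Finset.induction_on with
    | empty => simp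
    | insert k F hk ih =>
      refine ih.trans ?_
      have h := key (fun k => if k ∈ F then t else s k) k (s k) t (hs k) (hst k)
      have e1 : Function.update (fun k => if k ∈ F then t else s k) k (s k)
          = fun k => if k ∈ F then t else s k := by
        rw [Function.update_eq_self_iff]; simp [hk]
      have e2 : Function.update (fun k => if k ∈ F then t else s k) k t
          = fun j => if j ∈ insert k F then t else s j := by
        funext j
        by_cases hj : j = k
        · subst hj; simp
        · simp [hj]
      rwa [e1, e2] at h
  simpa using main Finset.univ

theorem diagonal_const_eq_smul (U : Matrix ι η ℝ) (V : Matrix κ η ℝ) (t : ℝ) :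
    U * (Matrix.diagonal fun _ => t : Matrix η η ℝ) * Vᵀ = t • (U * Vᵀ) := by
  rw [← Matrix.smul_one_eq_diagonal]; simp

theorem dotProduct_mulVec_self_of_transpose_mul_self {A : Matrix ι η ℝ} (hA : Aᵀ * A = 1)
    (x : η → ℝ) : (A *ᵥ x) ⬝ᵥ (A *ᵥ x) = x ⬝ᵥ x := by
  rw [Matrix.dotProduct_mulVec, Matrix.vecMul_mulVec, ← Matrix.dotProduct_mulVec, hA,
    Matrix.one_mulVec]

/-- If `|Z e|² ≤ t² |e|²` for all `e`, then `N (Z Vᵀ)` is at most `t` times the value of `N` at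
partial isometries of the same rank. -/
theorem IsUnitarilyInvariantNorm.mul_transpose_le (hN : IsUnitarilyInvariantNorm N)
    {U Z : Matrix ι η ℝ} {V : Matrix κ η ℝ} (hU : Uᵀ * U = 1) (hV : Vᵀ * V = 1) {t : ℝ}
    (ht : 0 ≤ t) (hZ : ∀ e, (Z *ᵥ e) ⬝ᵥ (Z *ᵥ e) ≤ t ^ 2 * (e ⬝ᵥ e)) :
    N (Z * Vᵀ) ≤ t * N (U * Vᵀ) := by
  obtain ⟨W, s, Q, hW, hQ, hQ', hs, rfl⟩ := exists_thin_svd (card_le_of_transpose_mul_self hU) Z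
  have hst : ∀ k, s k ≤ t := by
    intro k
    have h := hZ (Q *ᵥ Pi.single k 1)
    have e1 : (W * Matrix.diagonal s * Qᵀ) *ᵥ (Q *ᵥ Pi.single k 1) = W *ᵥ Pi.single k (s k) := by
      rw [Matrix.mulVec_mulVec, Matrix.mul_assoc, hQ, Matrix.mul_one, ← Matrix.mulVec_mulVec]
      simp
    rw [e1, dotProduct_mulVec_self_of_transpose_mul_self hW,
      dotProduct_mulVec_self_of_transpose_mul_self hQ] at h
    simp at h
    exact abs_le_of_sq_le_sq' (by nlinarith) ht |>.2
  -- `W * diagonal s * (V * Q)ᵀ` is a singular value decomposition of `Z * Vᵀ`.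
  have hVQ : (V * Q)ᵀ * (V * Q) = 1 := by
    rw [Matrix.transpose_mul, Matrix.mul_assoc, ← Matrix.mul_assoc Vᵀ, hV, Matrix.one_mul, hQ]
  have h := hN.diagonal_mono hW hVQ hs hst
  rw [diagonal_const_eq_smul, map_smul_eq_mul, Real.norm_of_nonneg ht, Matrix.transpose_mul,
    ← Matrix.mul_assoc _ Qᵀ, ← Matrix.mul_assoc _ Qᵀ] at h
  refine h.trans (le_of_eq ?_)
  congr 1
  have := hN.apply_congr hW hU hVQ hV (1 : Matrix η η ℝ)
  rw [Matrix.transpose_mul] at this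
  simpa [Matrix.mul_assoc] using this

/-- The value at a matrix with prescribed singular values is at least the one with all singular
values replaced by their mean. -/
theorem IsUnitarilyInvariantNorm.sum_mul_le (hN : IsUnitarilyInvariantNorm N) {d : ℕ} [NeZero d]
    {U : Matrix ι (Fin d) ℝ} {V : Matrix κ (Fin d) ℝ} (hU : Uᵀ * U = 1) (hV : Vᵀ * V = 1)
    (s : Fin d → ℝ) :
    (∑ k, s k) * N (U * Vᵀ) ≤ d * N (U * Matrix.diagonal s * Vᵀ) := by
  -- Cyclic shifts of the singular values preserve the norm, and the sum over all `d` shifts has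
  -- every entry equal to `∑ k, s k`.
  have hperm : ∀ k : Fin d, N (U * (Matrix.diagonal fun i => s (i + k) : Matrix _ _ ℝ) * Vᵀ)
      = N (U * Matrix.diagonal s * Vᵀ) := by
    intro k
    rw [hN.apply_congr hU (submatrix_transpose_mul_self hU (Equiv.addRight k)) hV
      (submatrix_transpose_mul_self hV (Equiv.addRight k))]
    congr 1
    ext i j
    rw [Matrix.mul_apply, Matrix.mul_apply]
    conv_rhs => rw [← Equiv.sum_comp (Equiv.addRight k)]
    refine Finset.sum_congr rfl fun l _ => ?_
    simp [Matrix.mul_diagonal]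
  have hsum : (∑ k, s k) • (U * Vᵀ)
      = ∑ k : Fin d, U * (Matrix.diagonal fun i => s (i + k) : Matrix _ _ ℝ) * Vᵀ := by
    rw [← diagonal_const_eq_smul, ← Matrix.sum_mul, ← Matrix.mul_sum]
    congr 2
    ext i j
    rw [Matrix.sum_apply]
    by_cases hij : i = j
    · subst hij
      simp only [Matrix.diagonal_apply_eq]
      exact (Equiv.sum_comp (Equiv.addLeft i) s).symm
    · simp [hij]
  calc (∑ k, s k) * N (U * Vᵀ) ≤ ‖∑ k, s k‖ * N (U * Vᵀ) :=
        mul_le_mul_of_nonneg_right (le_abs_self _) (apply_nonneg N _)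
    _ = N (∑ k : Fin d, U * (Matrix.diagonal fun i => s (i + k) : Matrix _ _ ℝ) * Vᵀ) := by
        rw [← map_smul_eq_mul, hsum]
    _ ≤ ∑ k : Fin d, N (U * (Matrix.diagonal fun i => s (i + k) : Matrix _ _ ℝ) * Vᵀ) :=
        Finset.le_sum_of_subadditive N (map_zero N).le (map_add_le_add N) _ _
    _ = _ := by rw [Finset.sum_congr rfl fun k _ => hperm k]; simp

/-- Compression to the column space of `Y` does not increase the norm. -/
theorem IsUnitarilyInvariantNorm.mul_mul_transpose_le (hN : IsUnitarilyInvariantNorm N)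
    {Y : Matrix κ η ℝ} (hY : Yᵀ * Y = 1) (E : Matrix ι κ ℝ) : N (E * Y * Yᵀ) ≤ N E := by
  -- The reflection in the column space of `Y` is orthogonal, and the compression of `E` is the
  -- average of `E` and `E * J`.
  set J : Matrix κ κ ℝ := (2 : ℝ) • (Y * Yᵀ) - 1 with hJ
  have hYY : Y * Yᵀ * (Y * Yᵀ) = Y * Yᵀ := by
    rw [Matrix.mul_assoc, ← Matrix.mul_assoc Yᵀ, hY, Matrix.one_mul]
  have hJT : Jᵀ = J := by simp [hJ, Matrix.transpose_mul]
  have hJJ : J * J = 1 := by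
    simp only [hJ, sub_mul, mul_sub, Matrix.smul_mul, Matrix.mul_smul, hYY, one_mul, mul_one,
      smul_sub]
    module
  have hJO : J ∈ Matrix.orthogonalGroup κ ℝ := by
    rw [Matrix.mem_orthogonalGroup_iff]
    simpa [Matrix.star_eq_conjTranspose, hJT] using hJJ
  have h := hN.invariant 1 (one_mem _) J hJO E
  rw [Matrix.one_mul] at h
  have e : E * Y * Yᵀ = (1 / 2 : ℝ) • (E + E * J) := by
    rw [hJ, Matrix.mul_sub, Matrix.mul_smul, Matrix.mul_one, ← Matrix.mul_assoc]
    module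
  rw [e, map_smul_eq_mul]
  have h2 := map_add_le_add N E (E * J)
  rw [h] at h2
  norm_num
  linarith

theorem IsUnitarilyInvariantNorm.pos (hN : IsUnitarilyInvariantNorm N) [Nonempty η]
    {U : Matrix ι η ℝ} {V : Matrix κ η ℝ} (hU : Uᵀ * U = 1) (hV : Vᵀ * V = 1) :
    0 < N (U * Vᵀ) := by
  refine (apply_nonneg N _).lt_of_ne' fun h => ?_
  have h1 := hN.definite _ h
  have h2 : Uᵀ * (U * Vᵀ) * V = 1 := by
    rw [← Matrix.mul_assoc, hU, Matrix.one_mul, hV]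
  rw [h1] at h2
  simp at h2

/-- If `N E` does not exceed the value of `N` at a matrix of rank `d` with singular values at most
`√b`, and `E` is bounded below by `√a` on a `d`-dimensional space, then `E` is bounded above on that
space by about `√b`. -/
theorem IsUnitarilyInvariantNorm.mulVec_le (hN : IsUnitarilyInvariantNorm N) {d : ℕ} [NeZero d]
    (hd : d ≤ Fintype.card ι) {E : Matrix ι κ ℝ} {Z : Matrix ι (Fin d) ℝ} {V Y : Matrix κ (Fin d) ℝ}
    (hV : Vᵀ * V = 1) (hY : Yᵀ * Y = 1) {a b : ℝ} (hb : 0 ≤ b) (hab : a ≤ b)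
    (hZ : ∀ e, (Z *ᵥ e) ⬝ᵥ (Z *ᵥ e) ≤ b * (e ⬝ᵥ e))
    (hE : ∀ e, a * (e ⬝ᵥ e) ≤ (E *ᵥ Y *ᵥ e) ⬝ᵥ (E *ᵥ Y *ᵥ e)) (hle : N E ≤ N (Z * Vᵀ))
    (e : Fin d → ℝ) :
    (E *ᵥ Y *ᵥ e) ⬝ᵥ (E *ᵥ Y *ᵥ e) ≤ (b + d ^ 2 * (b - a)) * (e ⬝ᵥ e) := by
  obtain ⟨W, s, Q, hW, hQ, hQ', hs, hEY⟩ := exists_thin_svd (by simpa using hd) (E * Y)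
  have hnorm : ∀ e, (E *ᵥ Y *ᵥ e) ⬝ᵥ (E *ᵥ Y *ᵥ e) = ∑ k, s k ^ 2 * (Qᵀ *ᵥ e) k ^ 2 := by
    intro e
    rw [Matrix.mulVec_mulVec, hEY, Matrix.mul_assoc, ← Matrix.mulVec_mulVec,
      dotProduct_mulVec_self_of_transpose_mul_self hW, ← Matrix.mulVec_mulVec, dotProduct]
    refine Finset.sum_congr rfl fun k _ => ?_
    rw [Matrix.mulVec_diagonal]; ring
  have hQe : ∀ e, ∑ k, (Qᵀ *ᵥ e) k ^ 2 = e ⬝ᵥ e := by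
    intro e
    rw [← dotProduct_mulVec_self_of_transpose_mul_self (A := Qᵀ) (by simpa using hQ') e, dotProduct]
    simp only [sq]
  set t := √b with ht
  -- `a` may be negative; then `μ = 0`, and `a ≤ μ ^ 2` still holds.
  set μ := √a with hμ
  have hμs : ∀ k, μ ≤ s k := by
    intro k
    refine Real.sqrt_le_iff.2 ⟨hs k, ?_⟩
    have h := hE (Q *ᵥ Pi.single k 1)
    rw [hnorm, ← hQe, Matrix.mulVec_mulVec, hQ, Matrix.one_mulVec] at h
    simpa [Pi.single_apply] using h
  have hμt : μ ≤ t := Real.sqrt_le_sqrt hab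
  have hμ0 : 0 ≤ μ := Real.sqrt_nonneg a
  have ht0 : 0 ≤ t := Real.sqrt_nonneg b
  have htb : t ^ 2 = b := Real.sq_sqrt hb
  have hμa : a ≤ μ ^ 2 := by
    rcases le_total 0 a with h | h
    · rw [Real.sq_sqrt h]
    · exact h.trans (sq_nonneg _)
  have hVQ : (Y * Q)ᵀ * (Y * Q) = 1 := by
    rw [Matrix.transpose_mul, Matrix.mul_assoc, ← Matrix.mul_assoc Yᵀ, hY, Matrix.one_mul, hQ]
  -- Chain: averaging the singular values, compressing `E` to the span of `Y`, the hypothesis `hle`,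
  -- and the bound of `Z` by `t`. All partial isometries of rank `d` have the same norm, which
  -- cancels.
  have hsum : ∑ k, s k ≤ d * t := by
    have h1 := hN.sum_mul_le hW hVQ s
    have h2 : W * Matrix.diagonal s * (Y * Q)ᵀ = E * Y * Yᵀ := by
      rw [hEY, Matrix.transpose_mul, ← Matrix.mul_assoc]
    have h3 := hN.mul_mul_transpose_le hY E
    have h4 := hN.mul_transpose_le hW hV ht0 (Z := Z) (by rwa [htb])
    have h5 : N (W * (Y * Q)ᵀ) = N (W * Vᵀ) := by
      simpa using hN.apply_congr hW hW hVQ hV (1 : Matrix (Fin d) (Fin d) ℝ)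
    rw [h2, h5] at h1
    have h6 : (∑ k, s k) * N (W * Vᵀ) ≤ (d * t) * N (W * Vᵀ) := by
      refine h1.trans ?_
      rw [mul_assoc]
      exact mul_le_mul_of_nonneg_left (h3.trans (hle.trans h4)) (Nat.cast_nonneg d)
    exact le_of_mul_le_mul_right h6 (hN.pos hW hV)
  have hd1 : (1 : ℝ) ≤ d := by exact_mod_cast NeZero.one_le
  have hsk : ∀ k, s k ^ 2 ≤ b + d ^ 2 * (b - a) := by
    intro k
    have h1 : s k + (d - 1) * μ ≤ ∑ k, s k := by
      rw [← Finset.add_sum_erase _ _ (Finset.mem_univ k)]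
      have := Finset.card_nsmul_le_sum (Finset.univ.erase k) s μ fun i _ => hμs i
      rw [Finset.card_erase_of_mem (Finset.mem_univ k), Finset.card_fin, nsmul_eq_mul,
        Nat.cast_sub NeZero.one_le] at this
      push_cast at this
      linarith
    -- The other `d - 1` values are at least `μ`. Squaring, with `t * (t - μ)` and `(t - μ) ^ 2`
    -- both at most `b - a`, gives the factor `2 (d - 1) + (d - 1)² ≤ d²`.
    have h2 : s k ≤ t + (d - 1) * (t - μ) := by linarith
    have h3 : s k ^ 2 ≤ (t + (d - 1) * (t - μ)) ^ 2 := pow_le_pow_left₀ (hs k) h2 2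
    have h4 : t * (t - μ) ≤ b - a := by nlinarith
    have h5 : (t - μ) ^ 2 ≤ b - a := by nlinarith
    have h6 : 0 ≤ (d : ℝ) - 1 := by linarith
    have h7 := mul_le_mul_of_nonneg_left h4 h6
    have h8 := mul_le_mul_of_nonneg_left h5 (sq_nonneg ((d : ℝ) - 1))
    nlinarith
  rw [hnorm, ← hQe, Finset.mul_sum]
  exact Finset.sum_le_sum fun k _ => mul_le_mul_of_nonneg_right (hsk k) (sq_nonneg _)

end UnitarilyInvariantNorm

/-! ### Square root and pseudoinverse of the covariance matrix -/

section FunctionalCalculus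

variable {ι : Type*} [Fintype ι] [DecidableEq ι] {S : Matrix ι ι ℝ}

theorem transpose_cfc (f : ℝ → ℝ) : (cfc f S)ᵀ = cfc f S := by
  have h : IsSelfAdjoint (cfc f S) := cfc_predicate _ S
  simpa [IsSelfAdjoint, Matrix.star_eq_conjTranspose] using h

theorem transpose_sqrtM : (sqrtM S)ᵀ = sqrtM S := transpose_cfc _

theorem transpose_pinv : (pinv S)ᵀ = pinv S := transpose_cfc _

theorem continuousOn_spectrum (f : ℝ → ℝ) : ContinuousOn f (spectrum ℝ S) :=
  (Matrix.finite_real_spectrum (A := S)).continuousOn f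

theorem pinv_sqrtM (hS : S.PosSemidef) : pinv (sqrtM S) = cfc (fun x => (√x)⁻¹) S := by
  rw [pinv, sqrtM]
  exact (cfc_comp' (fun x : ℝ => x⁻¹) Real.sqrt S
    (((Matrix.finite_real_spectrum (A := S)).image _).continuousOn _) (continuousOn_spectrum _)
    hS.1).symm

/-- On an eigenvalue `x ≥ 0` both sides take the value `1` if `x ≠ 0` and `0` otherwise. The
constraint, stated with `P_S`, can thus be used with the square root. -/
theorem sqrtM_mul_pinv_sqrtM (hS : S.PosSemidef) : sqrtM S * pinv (sqrtM S) = projCol S := by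
  have hsa : IsSelfAdjoint S := hS.1
  rw [projCol, pinv_sqrtM hS, sqrtM, ← cfc_mul _ _ S (continuousOn_spectrum _)
    (continuousOn_spectrum _)]
  have h : S * pinv S = cfc (fun x : ℝ => x * x⁻¹) S := by
    rw [cfc_mul _ _ S (continuousOn_spectrum _) (continuousOn_spectrum _), cfc_id' ℝ S hsa, pinv]
  rw [h]
  refine cfc_congr fun x hx => ?_
  rw [hS.1.spectrum_real_eq_range_eigenvalues] at hx
  obtain ⟨i, rfl⟩ := hx
  by_cases h : hS.1.eigenvalues i = 0
  · simp [h]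
  · have := (Real.sqrt_pos.2 ((hS.eigenvalues_nonneg i).lt_of_ne' h)).ne'
    simp [h, this]

theorem pinv_sqrtM_mul_sqrtM (hS : S.PosSemidef) : pinv (sqrtM S) * sqrtM S = projCol S := by
  rw [← sqrtM_mul_pinv_sqrtM hS, pinv_sqrtM hS, sqrtM, ← cfc_mul _ _ S (continuousOn_spectrum _)
    (continuousOn_spectrum _), ← cfc_mul _ _ S (continuousOn_spectrum _) (continuousOn_spectrum _)]
  simp only [mul_comm]

theorem pinv_sqrtM_mul_self (hS : S.PosSemidef) : pinv (sqrtM S) * pinv (sqrtM S) = pinv S := by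
  rw [pinv_sqrtM hS, pinv, ← cfc_mul _ _ S (continuousOn_spectrum _) (continuousOn_spectrum _)]
  refine cfc_congr fun x hx => ?_
  rw [hS.1.spectrum_real_eq_range_eigenvalues] at hx
  obtain ⟨i, rfl⟩ := hx
  change (√_)⁻¹ * (√_)⁻¹ = _
  rw [← mul_inv, Real.mul_self_sqrt (hS.eigenvalues_nonneg i)]

theorem sqrtM_mul_pinv_mul : sqrtM S * pinv (sqrtM S) * sqrtM S = sqrtM S :=
  (isMoorePenrose_pinv posSemidef_sqrtM.1).mul_mul_left

theorem mul_projCol (hS : S.PosSemidef) : S * projCol S = S := by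
  have h : projCol S = pinv S * S := by
    have := (isMoorePenrose_pinv hS.1).symm_left
    rw [Matrix.transpose_mul, transpose_pinv, show Sᵀ = S from hS.1] at this
    exact this.symm
  rw [h, ← Matrix.mul_assoc]
  exact (isMoorePenrose_pinv hS.1).mul_mul_left

theorem sqrtM_one : sqrtM (1 : Matrix ι ι ℝ) = 1 := by
  have := cfc_algebraMap (A := Matrix ι ι ℝ) (1 : ℝ) Real.sqrt
  simp [sqrtM] at this ⊢

theorem pinv_one : pinv (1 : Matrix ι ι ℝ) = 1 := by
  have := cfc_algebraMap (A := Matrix ι ι ℝ) (1 : ℝ) fun x => x⁻¹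
  simp [pinv] at this ⊢

end FunctionalCalculus

/-! ### Extreme eigenvalues and the spectral norm -/

section Eigenvalues

variable {ι κ : Type*} [Fintype ι] [Fintype κ] [DecidableEq κ] (A : Matrix ι κ ℝ)

theorem dotProduct_mulVec_self (z : κ → ℝ) : (A *ᵥ z) ⬝ᵥ (A *ᵥ z) = z ⬝ᵥ ((Aᵀ * A) *ᵥ z) := by
  rw [← Matrix.mulVec_mulVec, Matrix.dotProduct_mulVec z, Matrix.vecMul_transpose]

theorem lamMin_mul_le (z : κ → ℝ) :
    lamMin (Aᵀ * A) * (z ⬝ᵥ z) ≤ (A *ᵥ z) ⬝ᵥ (A *ᵥ z) := by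
  have hH : (Aᵀ * A).IsHermitian := by simpa using Matrix.isHermitian_conjTranspose_mul_self A
  obtain ⟨Q, hQ1, hQ2, hQ⟩ := spectral_decomposition hH
  have hl : ∀ i, lamMin (Aᵀ * A) ≤ hH.eigenvalues i := fun i => by
    refine csInf_le (Matrix.finite_real_spectrum (A := Aᵀ * A)).bddBelow ?_
    rw [hH.spectrum_real_eq_range_eigenvalues]
    exact ⟨i, rfl⟩
  have e : (A *ᵥ z) ⬝ᵥ (A *ᵥ z) = ∑ i, hH.eigenvalues i * (Qᵀ *ᵥ z) i ^ 2 := by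
    rw [dotProduct_mulVec_self]
    conv_lhs => rw [hQ]
    rw [Matrix.mul_assoc, ← Matrix.mulVec_mulVec, ← Matrix.mulVec_mulVec,
      Matrix.dotProduct_mulVec, ← Matrix.mulVec_transpose, dotProduct]
    refine Finset.sum_congr rfl fun i _ => ?_
    rw [Matrix.mulVec_diagonal]; ring
  have hz : z ⬝ᵥ z = ∑ i, (Qᵀ *ᵥ z) i ^ 2 := by
    rw [← dotProduct_mulVec_self_of_transpose_mul_self (A := Qᵀ) (by simpa using hQ2) z, dotProduct]
    simp only [sq]
  rw [e, hz, Finset.mul_sum]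
  exact Finset.sum_le_sum fun i _ => mul_le_mul_of_nonneg_right (hl i) (sq_nonneg _)

/-- Tested at the eigenvectors. `Nonempty κ` matters: for the empty spectrum `sInf` is `0`. -/
theorem le_lamMin [Nonempty κ] {l : ℝ}
    (h : ∀ z, l * (z ⬝ᵥ z) ≤ (A *ᵥ z) ⬝ᵥ (A *ᵥ z)) : l ≤ lamMin (Aᵀ * A) := by
  have hH : (Aᵀ * A).IsHermitian := by simpa using Matrix.isHermitian_conjTranspose_mul_self A
  obtain ⟨Q, hQ1, hQ2, hQ⟩ := spectral_decomposition hH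
  rw [lamMin, hH.spectrum_real_eq_range_eigenvalues]
  refine le_csInf (Set.range_nonempty _) ?_
  rintro _ ⟨i, rfl⟩
  have h1 := h (Q *ᵥ Pi.single i 1)
  rw [dotProduct_mulVec_self_of_transpose_mul_self hQ1, dotProduct_mulVec_self] at h1
  have e : (Aᵀ * A) *ᵥ Q *ᵥ Pi.single i 1 = hH.eigenvalues i • (Q *ᵥ Pi.single i 1) := by
    have : (Aᵀ * A) * Q = Q * Matrix.diagonal hH.eigenvalues := by
      conv_lhs => rw [hQ]
      rw [Matrix.mul_assoc, hQ1, Matrix.mul_one]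
    rw [Matrix.mulVec_mulVec, this, ← Matrix.mulVec_mulVec, Matrix.diagonal_mulVec_single,
      ← Matrix.mulVec_smul]
    congr 1
    ext j
    by_cases hj : j = i
    · subst hj; simp
    · simp [hj]
  rw [e, dotProduct_smul, dotProduct_mulVec_self_of_transpose_mul_self hQ1] at h1
  simpa using h1

open scoped Matrix.Norms.L2Operator in
/-- The spectral norm of real matrices as a seminorm. -/
noncomputable def specSeminorm (ι κ : Type*) [Fintype ι] [Fintype κ] [DecidableEq κ] :
    Seminorm ℝ (Matrix ι κ ℝ) :=
  normSeminorm ℝ (Matrix ι κ ℝ)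

open scoped Matrix.Norms.L2Operator in
theorem norm_le_one_of_mem_orthogonalGroup {U : Matrix κ κ ℝ}
    (hU : U ∈ Matrix.orthogonalGroup κ ℝ) : ‖U‖ ≤ 1 := by
  have h : Uᴴ * U = 1 := (Matrix.mem_orthogonalGroup_iff' κ ℝ).1 hU
  have h1 := Matrix.l2_opNorm_conjTranspose_mul_self U
  rw [h, ← Matrix.diagonal_one, Matrix.l2_opNorm_diagonal] at h1
  have h2 : ‖(fun _ => 1 : κ → ℝ)‖ ≤ 1 := pi_norm_le_iff_of_nonneg zero_le_one |>.2 (by simp)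
  nlinarith [norm_nonneg U]

open scoped Matrix.Norms.L2Operator in
theorem isUnitarilyInvariantNorm_specSeminorm [DecidableEq ι] :
    IsUnitarilyInvariantNorm (specSeminorm ι κ) := by
  have key : ∀ U ∈ Matrix.orthogonalGroup ι ℝ, ∀ V ∈ Matrix.orthogonalGroup κ ℝ,
      ∀ M : Matrix ι κ ℝ, ‖U * M * V‖ ≤ ‖M‖ := by
    intro U hU V hV M
    have h1 := norm_le_one_of_mem_orthogonalGroup hU
    have h2 := norm_le_one_of_mem_orthogonalGroup hV
    calc ‖U * M * V‖ ≤ ‖U‖ * ‖M‖ * ‖V‖ :=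
          (Matrix.l2_opNorm_mul _ _).trans
            (mul_le_mul_of_nonneg_right (Matrix.l2_opNorm_mul _ _) (norm_nonneg _))
      _ ≤ 1 * ‖M‖ * 1 := by gcongr
      _ = ‖M‖ := by ring
  refine ⟨fun M h => norm_eq_zero.1 h, fun U hU V hV M => le_antisymm (key U hU V hV M) ?_⟩
  have hU' := Unitary.star_mem hU
  have hV' := Unitary.star_mem hV
  have h := key _ hU' _ hV' (U * M * V)
  have e : star U * (U * M * V) * star V = M := by
    have h1 : star U * U = 1 := (Matrix.mem_orthogonalGroup_iff' ι ℝ).1 hU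
    have h2 : V * star V = 1 := (Matrix.mem_orthogonalGroup_iff κ ℝ).1 hV
    rw [Matrix.mul_assoc U, ← Matrix.mul_assoc _ U, h1, Matrix.one_mul, Matrix.mul_assoc, h2,
      Matrix.mul_one]
  rwa [e] at h

-- The identity `‖A‖² = ‖A Aᵀ‖` and orthogonal invariance reduce to a diagonal matrix of nonnegative
-- eigenvalues, whose norm is its largest entry. For empty `ι` both sides are `0`, since `sSup ∅ =
-- 0`.
open scoped Matrix.Norms.L2Operator in
theorem lamMax_mul_transpose [DecidableEq ι] : lamMax (A * Aᵀ) = specSeminorm ι κ A ^ 2 := by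
  have hH : (A * Aᵀ).IsHermitian := by simpa using Matrix.isHermitian_mul_conjTranspose_self A
  have hP : (A * Aᵀ).PosSemidef := by simpa using Matrix.posSemidef_self_mul_conjTranspose A
  have h1 : specSeminorm ι κ A ^ 2 = ‖A * Aᵀ‖ := by
    have := Matrix.l2_opNorm_conjTranspose_mul_self Aᴴ
    rw [Matrix.l2_opNorm_conjTranspose, Matrix.conjTranspose_conjTranspose,
      Matrix.conjTranspose_eq_transpose_of_trivial] at this
    rw [this, sq]; rfl
  obtain ⟨Q, hQ1, hQ2, hQ⟩ := spectral_decomposition hH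
  have hQm : Q ∈ Matrix.orthogonalGroup ι ℝ := by
    rw [Matrix.mem_orthogonalGroup_iff]
    simpa [Matrix.star_eq_conjTranspose] using hQ2
  have hQm' : Qᵀ ∈ Matrix.orthogonalGroup ι ℝ := by
    simpa [Matrix.star_eq_conjTranspose] using Unitary.star_mem hQm
  have h2 : ‖A * Aᵀ‖ = ‖hH.eigenvalues‖ := by
    conv_lhs => rw [hQ]
    rw [← Matrix.l2_opNorm_diagonal]
    exact isUnitarilyInvariantNorm_specSeminorm.invariant Q hQm Qᵀ hQm' _
  rw [h1, h2, lamMax, hH.spectrum_real_eq_range_eigenvalues]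
  apply le_antisymm
  · refine Real.sSup_le ?_ (norm_nonneg _)
    rintro _ ⟨i, rfl⟩
    exact (le_abs_self _).trans (norm_le_pi_norm hH.eigenvalues i)
  · have h0 : 0 ≤ sSup (Set.range hH.eigenvalues) :=
      Real.sSup_nonneg (by rintro _ ⟨i, rfl⟩; exact hP.eigenvalues_nonneg i)
    refine (pi_norm_le_iff_of_nonneg h0).2 fun i => ?_
    rw [Real.norm_of_nonneg (hP.eigenvalues_nonneg i)]
    exact le_csSup (Set.finite_range _).bddAbove ⟨i, rfl⟩

end Eigenvalues

/-! ### Feasible points and reformulation of the objective -/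

section Optimization

variable {m n d : ℕ} {S : Matrix (Fin n ⊕ Fin d) (Fin n ⊕ Fin d) ℝ}
  {C Δ : Matrix (Fin m) (Fin n ⊕ Fin d) ℝ}

/-- Since `S† = (S^{1/2})† (S^{1/2})†`, this makes the original problem a case of the one with a
unitarily invariant norm. -/
theorem specObj_eq (hS : S.PosSemidef) (Δ : Matrix (Fin m) (Fin n ⊕ Fin d) ℝ) :
    specObj S Δ = normObj S (specSeminorm (Fin m) (Fin n ⊕ Fin d)) Δ ^ 2 := by
  rw [specObj, normObj, ← lamMax_mul_transpose, Matrix.transpose_mul, transpose_pinv,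
    ← pinv_sqrtM_mul_self hS]
  simp only [Matrix.mul_assoc]

theorem isMinimizer_specObj_iff (hS : S.PosSemidef) :
    IsMinimizer S C (specObj S) Δ ↔
      IsMinimizer S C (normObj S (specSeminorm (Fin m) (Fin n ⊕ Fin d))) Δ := by
  refine and_congr Iff.rfl (forall_congr' fun Δ' => imp_congr Iff.rfl ?_)
  rw [specObj_eq hS, specObj_eq hS]
  exact pow_le_pow_iff_left₀ (apply_nonneg _ _) (apply_nonneg _ _) two_ne_zero

theorem Feasible.mul_pinv_mul_sqrtM (hS : S.PosSemidef) (h : Feasible S C Δ) :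
    Δ * pinv (sqrtM S) * sqrtM S = Δ := by
  have := h.1
  rw [Matrix.mul_sub, Matrix.mul_one, sub_eq_zero] at this
  rw [Matrix.mul_assoc, pinv_sqrtM_mul_sqrtM hS, ← this]

theorem mulVec_injective_of_rank {ι κ : Type*} [Fintype ι] [Fintype κ] {A : Matrix ι κ ℝ}
    (h : A.rank = Fintype.card κ) : Function.Injective A.mulVec := by
  rw [Matrix.mulVec_injective_iff]
  have := A.rank_eq_finrank_span_cols
  rw [h] at this
  exact linearIndependent_iff_card_eq_finrank_span.2 (by rw [Set.finrank, ← this])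

/-- By the rank condition `sqrtM S * ext X₀` has only nonzero singular values; dividing by them
makes its columns orthonormal. -/
theorem exists_ext_mul_normalized (hS : S.PosSemidef) (X₀ : Matrix (Fin n) (Fin d) ℝ)
    (hrank : (S * ext X₀).rank = d) :
    ∃ B : Matrix (Fin d) (Fin d) ℝ, (ext X₀ * B)ᵀ * S * (ext X₀ * B) = 1 := by
  obtain ⟨U, s, Q, hU, hQ, hQ', hs, h⟩ := exists_thin_svd (by simp) (sqrtM S * ext X₀)
  have hinj : Function.Injective (S * ext X₀).mulVec := mulVec_injective_of_rank (by simpa using hrank)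
  have hs0 : ∀ k, s k ≠ 0 := by
    intro k hk
    have h1 : (sqrtM S * ext X₀) *ᵥ (Q *ᵥ Pi.single k 1) = 0 := by
      rw [h, Matrix.mulVec_mulVec, Matrix.mul_assoc, hQ, Matrix.mul_one, ← Matrix.mulVec_mulVec]
      simp [hk]
    have h2 : (S * ext X₀) *ᵥ (Q *ᵥ Pi.single k 1) = 0 := by
      rw [← sqrtM_mul_sqrtM hS, Matrix.mul_assoc, ← Matrix.mulVec_mulVec, h1, Matrix.mulVec_zero]
    have h3 : Q *ᵥ Pi.single k 1 = 0 := hinj (h2.trans (Matrix.mulVec_zero _).symm)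
    have h4 : Qᵀ *ᵥ Q *ᵥ Pi.single k 1 = 0 := by rw [h3, Matrix.mulVec_zero]
    rw [Matrix.mulVec_mulVec, hQ, Matrix.one_mulVec] at h4
    simpa using congrFun h4 k
  refine ⟨Q * Matrix.diagonal fun k => (s k)⁻¹, ?_⟩
  have h5 : sqrtM S * (ext X₀ * (Q * Matrix.diagonal fun k => (s k)⁻¹)) = U := by
    rw [← Matrix.mul_assoc, h, ← Matrix.mul_assoc, Matrix.mul_assoc _ Qᵀ, hQ, Matrix.mul_one,
      Matrix.mul_assoc, Matrix.diagonal_mul_diagonal]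
    simp [hs0]
  set F := ext X₀ * (Q * Matrix.diagonal fun k => (s k)⁻¹) with hF
  clear_value F
  calc Fᵀ * S * F = (sqrtM S * F)ᵀ * (sqrtM S * F) := by
        rw [Matrix.transpose_mul, transpose_sqrtM, Matrix.mul_assoc Fᵀ (sqrtM S),
          ← Matrix.mul_assoc _ _ F, sqrtM_mul_sqrtM hS, Matrix.mul_assoc]
    _ = 1 := by rw [h5, hU]

/-- The competitor for all comparisons: `C - Δ = C (1 - F Fᵀ S)` annihilates the `d` independent
columns of `F`, hence has rank at most `n`. -/
theorem feasible_mul_of_normalized (hS : S.PosSemidef) {F : Matrix (Fin n ⊕ Fin d) (Fin d) ℝ}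
    (hF : Fᵀ * S * F = 1) (C : Matrix (Fin m) (Fin n ⊕ Fin d) ℝ) :
    Feasible S C (C * F * Fᵀ * S) := by
  constructor
  · rw [Matrix.mul_sub, Matrix.mul_assoc _ S (projCol S), mul_projCol hS, Matrix.mul_one, sub_self]
  · have h0 : (C - C * F * Fᵀ * S) * F = 0 := by
      rw [Matrix.sub_mul, Matrix.mul_assoc _ S, Matrix.mul_assoc _ Fᵀ, ← Matrix.mul_assoc Fᵀ, hF,
        Matrix.mul_one, sub_self]
    have h1 : F.rank = d := by
      refine le_antisymm (by simpa using F.rank_le_card_width) ?_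
      have := Matrix.rank_mul_le_right (Fᵀ * S) F
      rwa [hF, Matrix.rank_one, Fintype.card_fin] at this
    have h2 := Matrix.rank_add_rank_le_card_of_mul_eq_zero h0
    rw [h1, Fintype.card_sum, Fintype.card_fin, Fintype.card_fin] at h2
    omega

theorem le_finrank_ker (h : Feasible S C Δ) :
    d ≤ Module.finrank ℝ (LinearMap.ker (C - Δ).mulVecLin) := by
  have h1 := LinearMap.finrank_range_add_finrank_ker (C - Δ).mulVecLin
  have h2 : Module.finrank ℝ (LinearMap.range (C - Δ).mulVecLin) ≤ n := h.2
  rw [Module.finrank_fintype_fun_eq_card, Fintype.card_sum, Fintype.card_fin, Fintype.card_fin] at h1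
  omega

theorem exists_full_rank_solution (h : Feasible S C Δ) :
    ∃ Xext : Matrix (Fin n ⊕ Fin d) (Fin d) ℝ, (C - Δ) * Xext = 0 ∧ Xext.rank = d := by
  have hk := le_finrank_ker h
  obtain ⟨f, hf⟩ := exists_linearIndependent_of_le_finrank hk
  refine ⟨Matrix.of fun i j => (f j : (Fin n ⊕ Fin d) → ℝ) i, ?_, ?_⟩
  · ext i j
    have := congrFun (LinearMap.mem_ker.1 (f j).2) i
    exact this
  · have h1 : LinearIndependent ℝ fun j => (f j : (Fin n ⊕ Fin d) → ℝ) :=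
      hf.map' (Submodule.subtype _) (Submodule.ker_subtype _)
    rw [← Matrix.rank_transpose]
    exact (LinearIndependent.rank_matrix (M := Matrix.of fun j i =>
      (f j : (Fin n ⊕ Fin d) → ℝ) i) h1).trans (by simp)

end Optimization

/-! ### Existence of minimizers -/

section Attainment

variable {E : Type*} [NormedAddCommGroup E] [NormedSpace ℝ E] [FiniteDimensional ℝ E]

theorem seminorm_continuous_of_finiteDimensional (p : Seminorm ℝ E) : Continuous p := by
  have := (p.convexOn.continuousOn isOpen_univ)
  exact continuousOn_univ.1 this

theorem exists_pos_mul_norm_le (p : Seminorm ℝ E) (hp : ∀ x, p x = 0 → x = 0) :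
    ∃ c > 0, ∀ x, c * ‖x‖ ≤ p x := by
  have : ProperSpace E := FiniteDimensional.proper ℝ E
  rcases (Metric.sphere (0 : E) 1).eq_empty_or_nonempty with h | h
  · refine ⟨1, one_pos, fun x => ?_⟩
    have : x = 0 := by
      by_contra hx
      have : ‖x‖⁻¹ • x ∈ Metric.sphere (0 : E) 1 := by
        simp [norm_smul, hx]
      rw [h] at this
      exact this
    simp [this]
  · obtain ⟨x₀, hx₀, hmin⟩ := (isCompact_sphere (0 : E) 1).exists_isMinOn h
      (seminorm_continuous_of_finiteDimensional p).continuousOn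
    have hx0 : x₀ ≠ 0 := by
      rintro rfl; simp at hx₀
    refine ⟨p x₀, (apply_nonneg p x₀).lt_of_ne' fun h => hx0 (hp _ h), fun x => ?_⟩
    by_cases hx : x = 0
    · simp [hx]
    have hm : ‖x‖⁻¹ • x ∈ Metric.sphere (0 : E) 1 := by
      simp [norm_smul, hx]
    have h1 := hmin hm
    simp only [Set.mem_ofPred_eq, map_smul_eq_mul, norm_inv, norm_norm] at h1
    have h2 : 0 < ‖x‖ := norm_pos_iff.2 hx
    rwa [inv_mul_eq_div, le_div_iff₀ h2] at h1

variable {m n d : ℕ} {S : Matrix (Fin n ⊕ Fin d) (Fin n ⊕ Fin d) ℝ}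

/-- Lower semicontinuity of the rank, transferred from continuous linear maps. -/
theorem isClosed_rank_le {ι κ : Type*} [Fintype ι] [Fintype κ] [DecidableEq κ] (k : ℕ) :
    IsClosed {M : Matrix ι κ ℝ | M.rank ≤ k} := by
  have h := (isOpen_setOfPred_nat_le_rank (𝕜 := ℝ) (E := κ → ℝ) (F := ι → ℝ) (k + 1)).isClosed_compl
  let L : Matrix ι κ ℝ →ₗ[ℝ] ((κ → ℝ) →L[ℝ] (ι → ℝ)) :=
    LinearMap.toContinuousLinearMap.toLinearMap ∘ₗ (Matrix.toLin' (R := ℝ)).toLinearMap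
  have hL : Continuous L := LinearMap.continuous_of_finiteDimensional L
  convert h.preimage hL using 1
  ext M
  have : ((L M : (κ → ℝ) →L[ℝ] (ι → ℝ)) : (κ → ℝ) →ₗ[ℝ] (ι → ℝ)).rank = (M.rank : Cardinal) := by
    rw [LinearMap.rank, ← Module.finrank_eq_rank]
    rfl
  simp only [Set.mem_ofPred_eq, Set.mem_preimage, Set.mem_compl_iff, this]
  rw [not_le]
  norm_cast
  omega

-- For singular `S` the objective is not coercive on all matrices, but it is on the closed feasible
-- set: there `Δ` is recovered from `Δ * pinv (sqrtM S)` by multiplication with `sqrtM S`.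
open scoped Matrix.Norms.L2Operator in
theorem exists_isMinimizer_normObj (hS : S.PosSemidef) (X₀ : Matrix (Fin n) (Fin d) ℝ)
    (hrank : (S * ext X₀).rank = d) (C : Matrix (Fin m) (Fin n ⊕ Fin d) ℝ)
    (N : Seminorm ℝ (Matrix (Fin m) (Fin n ⊕ Fin d) ℝ)) (hN : ∀ M, N M = 0 → M = 0) :
    ∃ Δ, IsMinimizer S C (normObj S N) Δ := by
  obtain ⟨B, hB⟩ := exists_ext_mul_normalized hS X₀ hrank
  set Δ₀ := C * (ext X₀ * B) * (ext X₀ * B)ᵀ * S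
  have hΔ₀ : Feasible S C Δ₀ := feasible_mul_of_normalized hS hB C
  have hcl : IsClosed {Δ | Feasible S C Δ} := by
    refine IsClosed.inter (s₁ := {Δ : Matrix (Fin m) (Fin n ⊕ Fin d) ℝ | Δ * (1 - projCol S) = 0})
      (s₂ := {Δ | (C - Δ).rank ≤ n}) ?_ ?_
    · exact isClosed_eq (by fun_prop) continuous_const
    · exact (isClosed_rank_le n).preimage (f := fun Δ => C - Δ) (by fun_prop)
  have hcont : Continuous (normObj S N) :=
    (seminorm_continuous_of_finiteDimensional N).comp (by fun_prop)
  obtain ⟨c, hc, hcN⟩ := exists_pos_mul_norm_le N hN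
  have hco : ∀ᶠ Δ in cocompact _ ⊓ 𝓟 {Δ | Feasible S C Δ}, normObj S N Δ₀ ≤ normObj S N Δ := by
    rw [eventually_inf_principal]
    have : ProperSpace (Matrix (Fin m) (Fin n ⊕ Fin d) ℝ) := FiniteDimensional.proper ℝ _
    have ht := (tendsto_norm_cocompact_atTop (E := Matrix (Fin m) (Fin n ⊕ Fin d) ℝ))
    filter_upwards [ht.eventually_ge_atTop ((normObj S N Δ₀ / c) * ‖sqrtM S‖ + 1)] with Δ hΔ hf
    have h1 : ‖Δ‖ ≤ ‖Δ * pinv (sqrtM S)‖ * ‖sqrtM S‖ := by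
      conv_lhs => rw [← hf.mul_pinv_mul_sqrtM hS]
      exact Matrix.l2_opNorm_mul _ _
    have h2 := hcN (Δ * pinv (sqrtM S))
    by_contra! hlt
    have h3 : ‖Δ * pinv (sqrtM S)‖ ≤ normObj S N Δ₀ / c := by
      rw [le_div_iff₀ hc, mul_comm]
      exact h2.trans hlt.le
    have h4 := mul_le_mul_of_nonneg_right h3 (norm_nonneg (sqrtM S))
    linarith
  obtain ⟨Δ, hΔ, hmin⟩ := hcont.continuousOn.exists_isMinOn' hcl hΔ₀ hco
  exact ⟨Δ, hΔ, fun Δ' h => hmin h⟩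

end Attainment

/-! ### Quadratic forms and orthonormal systems -/

section QuadraticForms

variable {ι κ : Type*} [Fintype ι] [Fintype κ]

theorem dotProduct_self_nonneg' (z : κ → ℝ) : 0 ≤ z ⬝ᵥ z :=
  Finset.sum_nonneg fun _ _ => mul_self_nonneg _

theorem lamMin_pos_of_injective [DecidableEq κ] [Nonempty κ] {A : Matrix ι κ ℝ}
    (hA : Function.Injective A.mulVec) : 0 < lamMin (Aᵀ * A) := by
  have hH : (Aᵀ * A).PosDef := by simpa using Matrix.PosDef.conjTranspose_mul_self A hA
  have hmem : lamMin (Aᵀ * A) ∈ Set.range hH.1.eigenvalues := by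
    rw [lamMin, hH.1.spectrum_real_eq_range_eigenvalues]
    exact (Set.range_nonempty _).csInf_mem (Set.finite_range _)
  obtain ⟨i, hi⟩ := hmem
  rw [← hi]
  exact hH.eigenvalues_pos i

theorem mulVec_dotProduct_le (A : Matrix ι κ ℝ) (z : κ → ℝ) :
    (A *ᵥ z) ⬝ᵥ (A *ᵥ z) ≤ (∑ i, ∑ j, A i j ^ 2) * (z ⬝ᵥ z) := by
  rw [Finset.sum_mul, dotProduct]
  refine Finset.sum_le_sum fun i _ => ?_
  have := Finset.sum_mul_sq_le_sq_mul_sq Finset.univ (A i) z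
  have hz : z ⬝ᵥ z = ∑ j, z j ^ 2 := by simp only [dotProduct, sq]
  rw [hz, ← sq]
  exact this

theorem exists_mulVec_le (A : Matrix ι κ ℝ) :
    ∃ K : ℝ, 0 ≤ K ∧ ∀ z, (A *ᵥ z) ⬝ᵥ (A *ᵥ z) ≤ K * (z ⬝ᵥ z) :=
  ⟨∑ i, ∑ j, A i j ^ 2, Finset.sum_nonneg fun _ _ => Finset.sum_nonneg fun _ _ => sq_nonneg _,
    mulVec_dotProduct_le A⟩

theorem dotProduct_mulVec_eq_sqrtM [DecidableEq κ] {S : Matrix κ κ ℝ} (hS : S.PosSemidef)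
    (v : κ → ℝ) : v ⬝ᵥ (S *ᵥ v) = (sqrtM S *ᵥ v) ⬝ᵥ (sqrtM S *ᵥ v) := by
  rw [dotProduct_mulVec_self, transpose_sqrtM, sqrtM_mul_sqrtM hS]

/-- A subspace of dimension at least `d` contains an orthonormal system of size `d` whose span
contains a given vector. -/
theorem exists_orthonormal_columns {d : ℕ} (hd : 0 < d) (W : Submodule ℝ (κ → ℝ))
    (hW : d ≤ Module.finrank ℝ W) {w : κ → ℝ} (hw : w ∈ W) (hw0 : w ≠ 0) :
    ∃ Y : Matrix κ (Fin d) ℝ, Yᵀ * Y = 1 ∧ (∀ e, Y *ᵥ e ∈ W) ∧ ∃ e, Y *ᵥ e = w := by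
  let L : (κ → ℝ) ≃ₗ[ℝ] EuclideanSpace ℝ κ := (WithLp.linearEquiv 2 ℝ (κ → ℝ)).symm
  set W' : Submodule ℝ (EuclideanSpace ℝ κ) := W.map L.toLinearMap with hW'
  have hfin : Module.finrank ℝ W' = Module.finrank ℝ W := L.finrank_map_eq W
  set D := Module.finrank ℝ W with hD
  let w' : W' := ⟨L w, Submodule.mem_map_of_mem hw⟩
  have hw'0 : ‖w'‖ ≠ 0 := by
    rw [norm_ne_zero_iff]
    intro h
    exact hw0 (L.map_eq_zero_iff.1 (congrArg Subtype.val h))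
  let i₀ : Fin d := ⟨0, hd⟩
  -- Only the value at the first index is prescribed for the basis, so a constant family suffices.
  let v : Fin D → W' := fun _ => ‖w'‖⁻¹ • w'
  have hv : Orthonormal ℝ (({Fin.castLE hW i₀} : Set (Fin D)).domRestrict v) := by
    constructor
    · intro i
      change ‖‖w'‖⁻¹ • w'‖ = 1
      rw [norm_smul, norm_inv, norm_norm, inv_mul_cancel₀ hw'0]
    · intro i j hij
      exact absurd (Subsingleton.elim i j) hij
  obtain ⟨b, hb⟩ := hv.exists_orthonormalBasis_extension_of_card_eq (by simp [hfin])
  refine ⟨Matrix.of fun k j => (b (Fin.castLE hW j) : EuclideanSpace ℝ κ) k, ?_, ?_, ?_⟩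
  · ext j k
    have := orthonormal_iff_ite.1 b.orthonormal (Fin.castLE hW j) (Fin.castLE hW k)
    rw [Submodule.coe_inner, PiLp.inner_apply] at this
    rw [Matrix.mul_apply, Matrix.one_apply]
    simp only [(Fin.castLE_injective hW).eq_iff] at this
    rw [← this]
    refine Finset.sum_congr rfl fun i _ => ?_
    simp [mul_comm]
  · intro e
    have h1 : ∑ j, e j • (b (Fin.castLE hW j) : EuclideanSpace ℝ κ) ∈ W' :=
      Submodule.sum_mem _ fun j _ => Submodule.smul_mem _ _ (b _).2
    obtain ⟨x, hx, hxe⟩ := h1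
    have : (Matrix.of fun k j => (b (Fin.castLE hW j) : EuclideanSpace ℝ κ) k) *ᵥ e = x := by
      have hx' : x = L.symm (∑ j, e j • (b (Fin.castLE hW j) : EuclideanSpace ℝ κ)) := by
        rw [← hxe]; simp
      rw [hx']
      ext k
      simp [L, Matrix.mulVec, dotProduct, mul_comm]
    rw [this]
    exact hx
  · refine ⟨Pi.single i₀ ‖w'‖, ?_⟩
    have h1 := hb _ (Set.mem_singleton _)
    ext k
    simp only [Matrix.mulVec_single, Matrix.col_apply, Matrix.of_apply, Pi.smul_apply, h1, v]
    simp only [MulOpposite.smul_eq_mul_unop, MulOpposite.unop_op, Submodule.coe_smul,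
      PiLp.smul_apply, smul_eq_mul]
    have : (w' : EuclideanSpace ℝ κ) k = w k := rfl
    rw [this]
    field_simp

end QuadraticForms

/-! ### Deterministic perturbation bounds for minimizers -/

section Residual

variable {n d : ℕ}

/-- The vector `x + X₀ y` for `v = (x; y)`, which vanishes exactly on the columns space of
`ext X₀`. -/
def residual (X₀ : Matrix (Fin n) (Fin d) ℝ) (v : Fin n ⊕ Fin d → ℝ) : Fin n → ℝ :=
  v ∘ Sum.inl + X₀ *ᵥ (v ∘ Sum.inr)

variable {X₀ : Matrix (Fin n) (Fin d) ℝ}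

theorem fromCols_mulVec_eq {m : ℕ} (A : Matrix (Fin m) (Fin n) ℝ) (v : Fin n ⊕ Fin d → ℝ) :
    Matrix.fromCols A (A * X₀) *ᵥ v = A *ᵥ residual X₀ v := by
  rw [residual, Matrix.mulVec_add, Matrix.mulVec_mulVec, ← Matrix.fromCols_mulVec_sumElim,
    Sum.elim_comp_inl_inr]

/-- If both terms vanish, `v` lies in the column space of `ext X₀` and in the kernel of `S`, so `v =
0` by the rank condition. Hence the stacked matrix `J` is injective, and `K` is the inverse of the
least eigenvalue of `Jᵀ * J`. -/
theorem exists_coercive {S : Matrix (Fin n ⊕ Fin d) (Fin n ⊕ Fin d) ℝ} (hn : 0 < n)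
    (hS : S.PosSemidef) (hrank : (S * ext X₀).rank = d) :
    ∃ K : ℝ, 0 < K ∧ ∀ v, v ⬝ᵥ v ≤ K * (residual X₀ v ⬝ᵥ residual X₀ v + v ⬝ᵥ (S *ᵥ v)) := by
  have : NeZero n := ⟨hn.ne'⟩
  set J : Matrix (Fin n ⊕ (Fin n ⊕ Fin d)) (Fin n ⊕ Fin d) ℝ :=
    Matrix.fromRows (Matrix.fromCols 1 X₀) (sqrtM S) with hJ
  have hJv : ∀ v, J *ᵥ v = Sum.elim (residual X₀ v) (sqrtM S *ᵥ v) := by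
    intro v
    rw [hJ, Matrix.fromRows_mulVec, residual]
    congr 1
    conv_lhs => rw [← Sum.elim_comp_inl_inr v, Matrix.fromCols_mulVec_sumElim, Matrix.one_mulVec]
  have hinj : Function.Injective J.mulVec := by
    refine (injective_iff_map_eq_zero J.mulVecLin).2 fun v hv => ?_
    rw [Matrix.mulVecLin_apply, hJv] at hv
    have hz : residual X₀ v = 0 := by
      ext i; simpa using congrFun hv (Sum.inl i)
    have hR : sqrtM S *ᵥ v = 0 := by
      ext i; simpa using congrFun hv (Sum.inr i)
    have hve : v = ext X₀ *ᵥ (-(v ∘ Sum.inr)) := by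
      rw [ext, Matrix.fromRows_mulVec, ← Sum.elim_comp_inl_inr v]
      congr 1
      · have : v ∘ Sum.inl = -(X₀ *ᵥ (v ∘ Sum.inr)) := eq_neg_of_add_eq_zero_left hz
        rw [Sum.elim_comp_inr, this, Matrix.mulVec_neg]
      · simp [Matrix.neg_mulVec, Matrix.mulVec_neg]
    have h0 : (S * ext X₀) *ᵥ (-(v ∘ Sum.inr)) = 0 := by
      rw [← Matrix.mulVec_mulVec, ← hve, ← sqrtM_mul_sqrtM hS, ← Matrix.mulVec_mulVec, hR,
        Matrix.mulVec_zero]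
    have h1 := mulVec_injective_of_rank (by simpa using hrank)
      (h0.trans (Matrix.mulVec_zero _).symm)
    rw [hve, h1, Matrix.mulVec_zero]
  have hpos := lamMin_pos_of_injective hinj
  refine ⟨(lamMin (Jᵀ * J))⁻¹, inv_pos.2 hpos, fun v => ?_⟩
  have h := lamMin_mul_le J v
  rw [hJv, sumElim_dotProduct_sumElim, ← dotProduct_mulVec_eq_sqrtM hS] at h
  rw [inv_mul_eq_div, le_div_iff₀ hpos, mul_comm]
  exact h

variable {m : ℕ} {S : Matrix (Fin n ⊕ Fin d) (Fin n ⊕ Fin d) ℝ}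

/-- A lower bound for `|C v|²` where `C = [A, A X₀] + W`. -/
theorem le_mulVec_add {K ε l : ℝ} (hε : 0 ≤ ε) (hl : 0 ≤ l) (hK : 0 < K) (hKε : 12 * (ε * K) ≤ 1)
    (hcoer : ∀ v, v ⬝ᵥ v ≤ K * (residual X₀ v ⬝ᵥ residual X₀ v + v ⬝ᵥ (S *ᵥ v)))
    {A : Matrix (Fin m) (Fin n) ℝ} {W : Matrix (Fin m) (Fin n ⊕ Fin d) ℝ}
    (hA : ∀ z, l * (z ⬝ᵥ z) ≤ (A *ᵥ z) ⬝ᵥ (A *ᵥ z))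
    (h1 : ∀ v, |(W *ᵥ v) ⬝ᵥ (W *ᵥ v) - m * (v ⬝ᵥ (S *ᵥ v))| ≤ ε * l * (v ⬝ᵥ v))
    (h2 : ∀ z v, ((A *ᵥ z) ⬝ᵥ (W *ᵥ v)) ^ 2 ≤ ε * l * ((A *ᵥ z) ⬝ᵥ (A *ᵥ z)) * (v ⬝ᵥ v))
    (v : Fin n ⊕ Fin d → ℝ) :
    1 / 4 * (l * (residual X₀ v ⬝ᵥ residual X₀ v)) + (m - 3 * (ε * K * l)) * (v ⬝ᵥ (S *ᵥ v))
      ≤ ((Matrix.fromCols A (A * X₀) + W) *ᵥ v) ⬝ᵥ ((Matrix.fromCols A (A * X₀) + W) *ᵥ v) := by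
  set z := residual X₀ v with hz
  have e : ((Matrix.fromCols A (A * X₀) + W) *ᵥ v) ⬝ᵥ ((Matrix.fromCols A (A * X₀) + W) *ᵥ v)
      = (A *ᵥ z) ⬝ᵥ (A *ᵥ z) + 2 * ((A *ᵥ z) ⬝ᵥ (W *ᵥ v)) + (W *ᵥ v) ⬝ᵥ (W *ᵥ v) := by
    rw [Matrix.add_mulVec, fromCols_mulVec_eq, add_dotProduct, dotProduct_add, dotProduct_add,
      dotProduct_comm (W *ᵥ v) (A *ᵥ _)]
    ring
  rw [e]
  have hz0 := dotProduct_self_nonneg' z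
  have hq0 := dotProduct_self_nonneg' v
  have ha0 := dotProduct_self_nonneg' (A *ᵥ z)
  have hAz := hA z
  have hw := (abs_le.1 (h1 v)).1
  have hb := h2 z v
  have hc := hcoer v
  rw [← hz] at hc
  generalize (A *ᵥ z) ⬝ᵥ (A *ᵥ z) = a at *
  generalize (A *ᵥ z) ⬝ᵥ (W *ᵥ v) = b at *
  generalize (W *ᵥ v) ⬝ᵥ (W *ᵥ v) = w at *
  generalize v ⬝ᵥ (S *ᵥ v) = σ at *
  generalize v ⬝ᵥ v = q at *
  generalize z ⬝ᵥ z = y at *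
  -- Half of `a = |A z|²` pays for the cross term, by the inequality between arithmetic and
  -- geometric mean. By coercivity and `12 ε K ≤ 1`, another quarter covers the residual part of the
  -- total error `3 ε l |v|²`; the rest of that error lowers the coefficient of `σ`.
  have hb' : -(a / 2 + 2 * (ε * l * q)) ≤ 2 * b := by
    refine (abs_le_of_sq_le_sq' ?_ (by positivity)).1
    nlinarith [sq_nonneg (a / 2 - 2 * (ε * l * q))]
  have h3 : ε * l * q ≤ ε * l * (K * (y + σ)) := mul_le_mul_of_nonneg_left hc (by positivity)
  have h4 : ε * K * (l * y) ≤ ε * K * a := mul_le_mul_of_nonneg_left hAz (by positivity)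
  have h5 : 12 * (ε * K) * a ≤ 1 * a := mul_le_mul_of_nonneg_right hKε ha0
  nlinarith

variable {C Δ : Matrix (Fin m) (Fin n ⊕ Fin d) ℝ}

/-- If the residual is small on the kernel of `C - Δ`, the linear equation is solvable. -/
theorem exists_solves (hf : Feasible S C Δ) {κ : ℝ} (hκ : κ < 1)
    (h : ∀ v, (C - Δ) *ᵥ v = 0 → residual X₀ v ⬝ᵥ residual X₀ v ≤ κ * (v ⬝ᵥ v)) :
    ∃ X, Solves C Δ X := by
  -- A kernel vector with zero lower block equals its own residual in norm, so `κ < 1` forces it to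
  -- vanish. Thus `φ` is injective, bijective by dimension, and the preimages of the unit vectors
  -- are the columns of `ext X`.
  let φ : LinearMap.ker (C - Δ).mulVecLin →ₗ[ℝ] (Fin d → ℝ) :=
    (-(LinearMap.funLeft ℝ ℝ Sum.inr)) ∘ₗ Submodule.subtype _
  have hφ : ∀ v, φ v = -((v : Fin n ⊕ Fin d → ℝ) ∘ Sum.inr) := fun v => rfl
  have hinj : Function.Injective φ := by
    refine (injective_iff_map_eq_zero φ).2 fun v hv => ?_
    rw [hφ, neg_eq_zero] at hv
    have h1 := h v v.2
    have h2 : residual X₀ v = v.1 ∘ Sum.inl := by rw [residual, hv, Matrix.mulVec_zero, add_zero]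
    have h3 : v.1 ⬝ᵥ v.1 = (v.1 ∘ Sum.inl) ⬝ᵥ (v.1 ∘ Sum.inl) := by
      conv_lhs => rw [← Sum.elim_comp_inl_inr v.1, sumElim_dotProduct_sumElim, hv]
      simp
    rw [h2, ← h3] at h1
    have h4 := dotProduct_self_nonneg' v.1
    have h5 : v.1 ⬝ᵥ v.1 = 0 := by nlinarith
    exact Subtype.ext (dotProduct_self_eq_zero.1 h5)
  have hfin : Module.finrank ℝ (LinearMap.ker (C - Δ).mulVecLin) = Module.finrank ℝ (Fin d → ℝ) := by
    refine le_antisymm (LinearMap.finrank_le_finrank_of_injective hinj) ?_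
    rw [Module.finrank_fin_fun]
    exact le_finrank_ker hf
  have hsurj := (LinearMap.injective_iff_surjective_of_finrank_eq_finrank hfin).1 hinj
  choose v hv using fun j : Fin d => hsurj (Pi.single j 1)
  refine ⟨Matrix.of fun i j => v j |>.1 (Sum.inl i), ?_⟩
  have e : ∀ k j, ext (Matrix.of fun i j => v j |>.1 (Sum.inl i)) k j = (v j).1 k := by
    rintro (i | i) j
    · rfl
    · have := congrFun (hv j) i
      rw [hφ] at this
      simp only [Pi.neg_apply, Function.comp_apply] at this
      simp only [ext, Matrix.fromRows_apply_inr, Matrix.neg_apply]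
      rw [neg_eq_iff_eq_neg] at this
      rw [this, Matrix.one_apply, Pi.single_apply]
  unfold Solves
  ext i j
  have := congrFun (LinearMap.mem_ker.1 (v j).2) i
  rw [Matrix.mul_apply]
  simp only [e]
  exact this

/-- The residual of a column of `ext X` is the corresponding column of `X - X₀`. The length of the
former is bounded through `|x|² ≤ 2 |x - x₀|² + 2 |x₀|²`, and `κ ≤ 1 / 4` absorbs the term in `x -
x₀`. -/
theorem solves_sub_sq_le {κ : ℝ} (hκ0 : 0 ≤ κ) (hκ : κ ≤ 1 / 4)
    (h : ∀ v, (C - Δ) *ᵥ v = 0 → residual X₀ v ⬝ᵥ residual X₀ v ≤ κ * (v ⬝ᵥ v))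
    {X : Matrix (Fin n) (Fin d) ℝ} (hX : Solves C Δ X) (i : Fin n) (j : Fin d) :
    (X i j - X₀ i j) ^ 2 ≤ 2 * κ * (2 * ∑ k, X₀ k j ^ 2 + 1) := by
  have h0 : (C - Δ) *ᵥ (ext X *ᵥ Pi.single j 1) = 0 := by
    rw [Matrix.mulVec_mulVec, show (C - Δ) * ext X = 0 from hX, Matrix.zero_mulVec]
  have h1 := h _ h0
  have e : ext X *ᵥ Pi.single j 1 = Sum.elim (X.col j) (-(Pi.single j 1)) := by
    rw [ext, Matrix.fromRows_mulVec]
    congr 1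
    · simp
    · rw [Matrix.neg_mulVec, Matrix.one_mulVec]
  have er : residual X₀ (ext X *ᵥ Pi.single j 1) = fun k => X k j - X₀ k j := by
    rw [residual, e, Sum.elim_comp_inl, Sum.elim_comp_inr, Matrix.mulVec_neg]
    ext k
    simp [sub_eq_add_neg]
  rw [er, e, sumElim_dotProduct_sumElim] at h1
  have e2 : (-(Pi.single j 1 : Fin d → ℝ)) ⬝ᵥ (-(Pi.single j 1)) = 1 := by simp
  rw [e2] at h1
  simp only [dotProduct, Matrix.col_apply, ← sq] at h1
  have h2 : ∑ k, X k j ^ 2 ≤ 2 * ∑ k, (X k j - X₀ k j) ^ 2 + 2 * ∑ k, X₀ k j ^ 2 := by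
    rw [Finset.mul_sum, Finset.mul_sum, ← Finset.sum_add_distrib]
    refine Finset.sum_le_sum fun k _ => ?_
    nlinarith [sq_nonneg (X k j - 2 * X₀ k j)]
  have h3 : (X i j - X₀ i j) ^ 2 ≤ ∑ k, (X k j - X₀ k j) ^ 2 :=
    Finset.single_le_sum (f := fun k => (X k j - X₀ k j) ^ 2) (fun k _ => sq_nonneg _)
      (Finset.mem_univ i)
  have h4 : 0 ≤ ∑ k, (X k j - X₀ k j) ^ 2 := Finset.sum_nonneg fun k _ => sq_nonneg _
  have h5 : 0 ≤ ∑ k, X₀ k j ^ 2 := Finset.sum_nonneg fun k _ => sq_nonneg _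
  generalize ∑ k, (X k j - X₀ k j) ^ 2 = y at *
  generalize ∑ k, X k j ^ 2 = x at *
  generalize ∑ k, X₀ k j ^ 2 = x₀ at *
  have h6 := mul_le_mul_of_nonneg_left h2 hκ0
  have h7 := mul_le_mul_of_nonneg_right hκ h4
  nlinarith

/-- The residual of the kernel vectors of `C - Δ` is small for a minimizer `Δ` if the errors are
small relative to `l`. -/
theorem exists_residual_le {S : Matrix (Fin n ⊕ Fin d) (Fin n ⊕ Fin d) ℝ} (hn : 0 < n) (hd : 0 < d)
    (hS : S.PosSemidef) (hrank : (S * ext X₀).rank = d) :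
    ∃ K : ℝ, 0 < K ∧ ∀ (m : ℕ), d ≤ m → ∀ (ε l : ℝ), 0 ≤ ε → 0 < l → K * ε ≤ 1 →
      ∀ (A : Matrix (Fin m) (Fin n) ℝ) (W : Matrix (Fin m) (Fin n ⊕ Fin d) ℝ),
      (∀ z, l * (z ⬝ᵥ z) ≤ (A *ᵥ z) ⬝ᵥ (A *ᵥ z)) →
      (∀ v, |(W *ᵥ v) ⬝ᵥ (W *ᵥ v) - m * (v ⬝ᵥ (S *ᵥ v))| ≤ ε * l * (v ⬝ᵥ v)) →
      (∀ z v, ((A *ᵥ z) ⬝ᵥ (W *ᵥ v)) ^ 2 ≤ ε * l * ((A *ᵥ z) ⬝ᵥ (A *ᵥ z)) * (v ⬝ᵥ v)) →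
      ∀ N : Seminorm ℝ (Matrix (Fin m) (Fin n ⊕ Fin d) ℝ), IsUnitarilyInvariantNorm N →
      ∀ Δ, IsMinimizer S (Matrix.fromCols A (A * X₀) + W) (normObj S N) Δ →
      ∀ v, (Matrix.fromCols A (A * X₀) + W - Δ) *ᵥ v = 0 →
        residual X₀ v ⬝ᵥ residual X₀ v ≤ K * ε * (v ⬝ᵥ v) := by
  have : NeZero d := ⟨hd.ne'⟩
  obtain ⟨K, hK, hcoer⟩ := exists_coercive hn hS hrank
  obtain ⟨B, hB⟩ := exists_ext_mul_normalized hS X₀ hrank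
  set F := ext X₀ * B with hF
  obtain ⟨KF, hKF, hFe⟩ := exists_mulVec_le F
  obtain ⟨KS, hKS, hSv⟩ := exists_mulVec_le (sqrtM S)
  set K₃ := KF + d ^ 2 * (KF + 3 * K) with hK₃
  have hK₃0 : 0 ≤ K₃ := by positivity
  -- The first summand secures `12 ε K ≤ 1` for `le_mulVec_add`; the second is the constant of the
  -- final estimate.
  refine ⟨12 * K + 4 * (K₃ + 3 * K) * KS, by positivity, ?_⟩
  intro m hm ε l hε hl hKε A W hA h1 h2 N hN Δ hΔ v hv
  set C := Matrix.fromCols A (A * X₀) + W with hC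
  have hKε' : 12 * (ε * K) ≤ 1 := by
    have : 0 ≤ 4 * (K₃ + 3 * K) * KS * ε := by positivity
    nlinarith
  have hlow := le_mulVec_add hε hl.le hK hKε' hcoer hA h1 h2
  set R := sqrtM S with hR
  set T := pinv R with hT
  set E := Δ * T with hE
  have hER : E * R = Δ := hΔ.1.mul_pinv_mul_sqrtM hS
  have hker : ∀ u, (C - Δ) *ᵥ u = 0 → C *ᵥ u = E *ᵥ R *ᵥ u := by
    intro u hu
    rw [Matrix.mulVec_mulVec, hER]
    rwa [Matrix.sub_mulVec, sub_eq_zero] at hu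
  -- On the kernel, `R u = 0` implies `C u = 0`, and the lower bound leaves no residual. By
  -- coercivity, `R` is therefore injective on the kernel.
  have hzero : ∀ u, (C - Δ) *ᵥ u = 0 → R *ᵥ u = 0 →
      residual X₀ u ⬝ᵥ residual X₀ u = 0 ∧ u ⬝ᵥ (S *ᵥ u) = 0 := by
    intro u hu hRu
    have h3 := hlow u
    have h4 : u ⬝ᵥ (S *ᵥ u) = 0 := by
      rw [dotProduct_mulVec_eq_sqrtM hS, ← hR, hRu, zero_dotProduct]
    rw [h4, ← hC, hker u hu, hRu, Matrix.mulVec_zero, zero_dotProduct] at h3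
    have h5 := dotProduct_self_nonneg' (residual X₀ u)
    refine ⟨le_antisymm ?_ h5, h4⟩
    by_contra! h6
    nlinarith [mul_pos hl h6]
  by_cases hRv : R *ᵥ v = 0
  · rw [(hzero v hv hRv).1]
    have := dotProduct_self_nonneg' v
    positivity
  -- the subspace on which `E` is bounded below
  have hinj : Function.Injective (R.mulVecLin.domRestrict (LinearMap.ker (C - Δ).mulVecLin)) := by
    refine (injective_iff_map_eq_zero _).2 fun u hu => ?_
    obtain ⟨h3, h4⟩ := hzero u u.2 hu
    have h5 := hcoer u
    rw [h3, h4, add_zero, mul_zero] at h5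
    exact Subtype.ext (dotProduct_self_eq_zero.1 (le_antisymm h5 (dotProduct_self_nonneg' _)))
  have hfin : d ≤ Module.finrank ℝ ((LinearMap.ker (C - Δ).mulVecLin).map R.mulVecLin) := by
    rw [← LinearMap.range_domRestrict, LinearMap.finrank_range_of_inj hinj]
    exact le_finrank_ker hΔ.1
  obtain ⟨Y, hY, hYmem, e₀, he₀⟩ := exists_orthonormal_columns hd _ hfin
    (Submodule.mem_map_of_mem (f := R.mulVecLin) (show v ∈ LinearMap.ker (C - Δ).mulVecLin from hv))
    hRv
  rw [Matrix.mulVecLin_apply] at he₀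
  -- comparison with an explicit feasible point
  have hRR : R * R = S := sqrtM_mul_sqrtM hS
  have hRT : Rᵀ = R := transpose_sqrtM
  have hRRT : R * (R * T) = R := by
    have h3 : R * T = T * R := by
      rw [hT, hR, sqrtM_mul_pinv_sqrtM hS, pinv_sqrtM_mul_sqrtM hS]
    rw [h3, ← Matrix.mul_assoc]
    exact sqrtM_mul_pinv_mul
  have hST : S * T = R := by rw [← hRR, Matrix.mul_assoc, hRRT]
  -- The true data annihilate `ext X₀`, so the competitor's value depends on the errors alone.
  have hCF : C * F = W * F := by
    have : Matrix.fromCols A (A * X₀) * ext X₀ = 0 := by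
      rw [ext, Matrix.fromCols_mul_fromRows]; simp
    rw [hC, Matrix.add_mul, hF, ← Matrix.mul_assoc, this, Matrix.zero_mul, zero_add]
  have hV : (R * F)ᵀ * (R * F) = 1 := by
    rw [Matrix.transpose_mul, hRT, Matrix.mul_assoc, ← Matrix.mul_assoc R R, hRR,
      ← Matrix.mul_assoc, hB]
  have hle : N E ≤ N (W * F * (R * F)ᵀ) := by
    have h3 := hΔ.2 _ (feasible_mul_of_normalized hS hB C)
    have h4 : C * F * Fᵀ * S * T = W * F * (R * F)ᵀ := by
      rw [Matrix.mul_assoc _ S, hST, hCF, Matrix.transpose_mul R F, hRT, Matrix.mul_assoc _ Fᵀ]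
    simp only [normObj] at h3
    rw [← hR, ← hT, h4] at h3
    exact h3
  have hFS : ∀ e, (F *ᵥ e) ⬝ᵥ (S *ᵥ F *ᵥ e) = e ⬝ᵥ e := by
    intro e
    rw [dotProduct_mulVec_eq_sqrtM hS, ← hR, Matrix.mulVec_mulVec,
      dotProduct_mulVec_self_of_transpose_mul_self hV]
  have hεl : 0 ≤ ε * l := by positivity
  -- The upper value `b` comes from `|W F e|²` with `F` normalized in `S`; the lower value `a` comes
  -- from `hlow` with the residual dropped.
  have hbound := hN.mulVec_le (E := E) (Z := W * F) (V := R * F) (Y := Y)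
    (a := m - 3 * (ε * K * l)) (b := m + ε * l * KF) (by simpa using hm) hV hY (by positivity)
    (by nlinarith [mul_nonneg hεl hKF, mul_nonneg hεl hK.le]) (by
      intro e
      rw [← Matrix.mulVec_mulVec]
      have h3 := (abs_le.1 (h1 (F *ᵥ e))).2
      rw [hFS] at h3
      have h4 := mul_le_mul_of_nonneg_left (hFe e) hεl
      nlinarith) (by
      intro e
      obtain ⟨u, hu, hue⟩ := hYmem e
      rw [Matrix.mulVecLin_apply] at hue
      have h3 := hlow u
      rw [← hC, hker u hu, hue, dotProduct_mulVec_eq_sqrtM hS, ← hR, hue,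
        dotProduct_mulVec_self_of_transpose_mul_self hY] at h3
      have h5 := mul_nonneg hl.le (dotProduct_self_nonneg' (residual X₀ u))
      linarith) hle e₀
  have hσ : e₀ ⬝ᵥ e₀ = v ⬝ᵥ (S *ᵥ v) := by
    rw [dotProduct_mulVec_eq_sqrtM hS, ← hR, ← he₀, dotProduct_mulVec_self_of_transpose_mul_self hY]
  have hlv := hlow v
  rw [he₀, hσ, ← hker v hv] at hbound
  rw [← hC] at hlv
  have hσS : v ⬝ᵥ (S *ᵥ v) ≤ KS * (v ⬝ᵥ v) := by
    rw [dotProduct_mulVec_eq_sqrtM hS]; exact hSv v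
  have hσ0 : 0 ≤ v ⬝ᵥ (S *ᵥ v) := hσ ▸ dotProduct_self_nonneg' e₀
  have hq0 := dotProduct_self_nonneg' v
  generalize (C *ᵥ v) ⬝ᵥ (C *ᵥ v) = c at *
  generalize v ⬝ᵥ (S *ᵥ v) = σ at *
  generalize v ⬝ᵥ v = q at *
  generalize residual X₀ v ⬝ᵥ residual X₀ v = y at *
  -- The terms `m σ` in the upper and lower bounds of `|C v|²` cancel; `b + d² (b - a) - m` equals
  -- `ε l K₃`.
  have h3 : l * y ≤ l * (4 * ε * (K₃ + 3 * K) * σ) := by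
    rw [hK₃]; nlinarith
  have h4 : y ≤ 4 * ε * (K₃ + 3 * K) * σ := le_of_mul_le_mul_left h3 hl
  have h5 : 4 * ε * (K₃ + 3 * K) * σ ≤ 4 * ε * (K₃ + 3 * K) * (KS * q) :=
    mul_le_mul_of_nonneg_left hσS (by positivity)
  have h6 : 0 ≤ 12 * K * ε * q := by positivity
  nlinarith

/-- Deterministic core of the consistency proofs: if the errors are small relative to `l`, the
linear equation is solvable for each minimizer, and all solutions are close to `X₀`. -/
theorem exists_solves_and_close {S : Matrix (Fin n ⊕ Fin d) (Fin n ⊕ Fin d) ℝ} (hn : 0 < n)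
    (hd : 0 < d) (hS : S.PosSemidef) (hrank : (S * ext X₀).rank = d) :
    ∃ K : ℝ, 0 < K ∧ ∀ (m : ℕ), d ≤ m → ∀ (ε l : ℝ), 0 ≤ ε → 0 < l → K * ε ≤ 1 →
      ∀ (A : Matrix (Fin m) (Fin n) ℝ) (W : Matrix (Fin m) (Fin n ⊕ Fin d) ℝ),
      (∀ z, l * (z ⬝ᵥ z) ≤ (A *ᵥ z) ⬝ᵥ (A *ᵥ z)) →
      (∀ v, |(W *ᵥ v) ⬝ᵥ (W *ᵥ v) - m * (v ⬝ᵥ (S *ᵥ v))| ≤ ε * l * (v ⬝ᵥ v)) →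
      (∀ z v, ((A *ᵥ z) ⬝ᵥ (W *ᵥ v)) ^ 2 ≤ ε * l * ((A *ᵥ z) ⬝ᵥ (A *ᵥ z)) * (v ⬝ᵥ v)) →
      ∀ N : Seminorm ℝ (Matrix (Fin m) (Fin n ⊕ Fin d) ℝ), IsUnitarilyInvariantNorm N →
      ∀ Δ, IsMinimizer S (Matrix.fromCols A (A * X₀) + W) (normObj S N) Δ →
        (∃ X, Solves (Matrix.fromCols A (A * X₀) + W) Δ X) ∧
        ∀ X, Solves (Matrix.fromCols A (A * X₀) + W) Δ X →
          ∀ i j, (X i j - X₀ i j) ^ 2 ≤ K * ε := by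
  obtain ⟨K, hK, h⟩ := exists_residual_le (X₀ := X₀) hn hd hS hrank
  set M := ∑ j, ∑ k, X₀ k j ^ 2 with hM
  have hM0 : 0 ≤ M := Finset.sum_nonneg fun j _ => Finset.sum_nonneg fun k _ => sq_nonneg _
  -- Large enough for `K ε ≤ 1 / 4` and for the constant in `solves_sub_sq_le`, uniformly in the
  -- column.
  refine ⟨4 * K * (2 * M + 1), by positivity, ?_⟩
  intro m hm ε l hε hl hKε A W hA h1 h2 N hN Δ hΔ
  have hKε' : K * ε ≤ 1 / 4 := by
    nlinarith [mul_nonneg (mul_nonneg hK.le hε) hM0]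
  have hres := h m hm ε l hε hl (by linarith) A W hA h1 h2 N hN Δ hΔ
  refine ⟨exists_solves hΔ.1 (by linarith) hres, fun X hX i j => ?_⟩
  refine (solves_sub_sq_le (by positivity) hKε' hres hX i j).trans ?_
  have hj : ∑ k, X₀ k j ^ 2 ≤ M :=
    Finset.single_le_sum (f := fun j => ∑ k, X₀ k j ^ 2)
      (fun j _ => Finset.sum_nonneg fun k _ => sq_nonneg _) (Finset.mem_univ j)
  have h3 := mul_le_mul_of_nonneg_left hj (mul_nonneg hK.le hε)
  nlinarith [mul_nonneg (mul_nonneg hK.le hε) hM0, mul_nonneg hK.le hε]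

end Residual

/-! ### Pointwise inequalities for powers -/

section Pointwise

/-- The signed power `sign x * |x| ^ q`. -/
noncomputable def signedPow (q x : ℝ) : ℝ := x * |x| ^ (q - 1)

theorem signedPow_neg (q x : ℝ) : signedPow q (-x) = -signedPow q x := by
  simp [signedPow]

theorem signedPow_of_pos {q x : ℝ} (hx : 0 < x) : signedPow q x = x ^ q := by
  rw [signedPow, abs_of_pos hx, Real.rpow_sub_one hx.ne']
  field_simp

theorem abs_signedPow_le (q x : ℝ) : |signedPow q x| ≤ |x| ^ q := by
  rcases eq_or_ne x 0 with rfl | hx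
  · simp only [signedPow, zero_mul, abs_zero]; positivity
  · have : 0 < |x| := abs_pos.2 hx
    rw [signedPow, abs_mul, abs_of_nonneg (a := |x| ^ (q - 1)) (by positivity),
      Real.rpow_sub_one this.ne']
    field_simp
    exact le_rfl

theorem signedPow_mul_self {p : ℝ} (hp : 0 < p) (x : ℝ) : signedPow (p - 1) x * x = |x| ^ p := by
  rcases eq_or_ne x 0 with rfl | hx
  · simp [hp.ne']
  · have : 0 < |x| := abs_pos.2 hx
    have h2 : |x| ^ (p - 1 - 1) = |x| ^ p / (|x| * |x|) := by
      rw [Real.rpow_sub_one this.ne', Real.rpow_sub_one this.ne', div_div]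
    rw [signedPow, h2, abs_mul_abs_self]
    field_simp

theorem rpow_sub_one_mul_le {p x y : ℝ} (hp : 1 ≤ p) (hx : 0 ≤ x) (hy : 0 ≤ y) :
    p * (x ^ (p - 1) * y) ≤ (p - 1) * x ^ p + y ^ p := by
  have hp0 : 0 < p := by linarith
  have h := Real.geom_mean_le_arith_mean2_weighted (w₁ := (p - 1) / p) (w₂ := 1 / p)
    (p₁ := x ^ p) (p₂ := y ^ p) (div_nonneg (by linarith) hp0.le) (by positivity) (by positivity)
    (by positivity) (by field_simp; ring)
  rw [← Real.rpow_mul hx, ← Real.rpow_mul hy, mul_div_cancel₀ _ hp0.ne', mul_one_div_cancel hp0.ne',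
    Real.rpow_one] at h
  calc p * (x ^ (p - 1) * y) ≤ p * ((p - 1) / p * x ^ p + 1 / p * y ^ p) :=
        mul_le_mul_of_nonneg_left h hp0.le
    _ = _ := by field_simp

/-- Convexity of `|x| ^ p`. -/
theorem abs_add_rpow_le {p : ℝ} (hp : 1 ≤ p) (a b : ℝ) :
    |a + b| ^ p ≤ |a| ^ p + p * (signedPow (p - 1) a * b)
      + p * (|signedPow (p - 1) (a + b) - signedPow (p - 1) a| * |b|) := by
  -- This yields the tangent inequality at `a + b`; replacing its slope by the one at `a` produces
  -- the remainder.
  have h1 := rpow_sub_one_mul_le hp (abs_nonneg (a + b)) (abs_nonneg a)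
  have h2 : signedPow (p - 1) (a + b) * a ≤ |a + b| ^ (p - 1) * |a| := by
    refine (le_abs_self _).trans ?_
    rw [abs_mul]
    exact mul_le_mul_of_nonneg_right (abs_signedPow_le _ _) (abs_nonneg _)
  have h3 := signedPow_mul_self (by linarith : 0 < p) (a + b)
  have h4 : (signedPow (p - 1) (a + b) - signedPow (p - 1) a) * b
      ≤ |signedPow (p - 1) (a + b) - signedPow (p - 1) a| * |b| := by
    rw [← abs_mul]; exact le_abs_self _
  have h5 := mul_le_mul_of_nonneg_left h2 (by linarith : 0 ≤ p)
  have h6 := mul_le_mul_of_nonneg_left h4 (by linarith : 0 ≤ p)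
  nlinarith

theorem signedPow_induction {P : ℝ → ℝ → Prop} (hsymm : ∀ x y, P x y → P y x)
    (hneg : ∀ x y, P x y → P (-x) (-y)) (h0 : ∀ x, P x 0)
    (hpos : ∀ x y, 0 < y → y ≤ x → P x y) (hopp : ∀ x y, 0 < x → y < 0 → P x y) (x y : ℝ) :
    P x y := by
  have hpos' : ∀ x y, 0 < x → 0 < y → P x y := fun x y hx hy =>
    (le_total y x).elim (hpos x y hy) fun h => hsymm _ _ (hpos y x hx h)
  rcases lt_trichotomy x 0 with hx | rfl | hx <;> rcases lt_trichotomy y 0 with hy | rfl | hy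
  · simpa using hneg _ _ (hpos' (-x) (-y) (by linarith) (by linarith))
  · exact h0 x
  · exact hsymm _ _ (hopp y x hy hx)
  · exact hsymm _ _ (h0 y)
  · exact h0 0
  · exact hsymm _ _ (h0 y)
  · exact hopp x y hx hy
  · exact h0 x
  · exact hpos' x y hx hy

/-- For equal signs this is subadditivity of `t ^ q`; for opposite signs each of `|x|`, `|y|` is at
most `|x - y|`, whence the factor `2`. -/
theorem abs_signedPow_sub_le_of_le_one {q : ℝ} (hq : 0 ≤ q) (hq1 : q ≤ 1) (x y : ℝ) :
    |signedPow q x - signedPow q y| ≤ 2 * |x - y| ^ q := by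
  refine signedPow_induction (P := fun x y => |signedPow q x - signedPow q y| ≤ 2 * |x - y| ^ q)
    ?_ ?_ ?_ ?_ ?_ x y
  · intro x y h
    rwa [abs_sub_comm, abs_sub_comm y x]
  · intro x y h
    rw [signedPow_neg, signedPow_neg, neg_sub_neg, neg_sub_neg]
    rwa [abs_sub_comm, abs_sub_comm y x]
  · intro x
    have h1 := abs_signedPow_le q x
    have h2 : 0 ≤ |x| ^ q := by positivity
    have : signedPow q 0 = 0 := by simp [signedPow]
    rw [this, sub_zero, sub_zero]
    linarith
  · intro x y hy hyx
    rw [signedPow_of_pos hy, signedPow_of_pos (hy.trans_le hyx), abs_of_nonneg (sub_nonneg.2 hyx),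
      abs_of_nonneg (sub_nonneg.2 (Real.rpow_le_rpow hy.le hyx hq))]
    have h := Real.rpow_add_le_add_rpow hy.le (sub_nonneg.2 hyx) hq hq1
    rw [add_sub_cancel] at h
    have : 0 ≤ (x - y) ^ q := Real.rpow_nonneg (sub_nonneg.2 hyx) _
    linarith
  · intro x y hx hy
    have h1 : |signedPow q x - signedPow q y| ≤ |x| ^ q + |y| ^ q :=
      (abs_sub _ _).trans (add_le_add (abs_signedPow_le _ _) (abs_signedPow_le _ _))
    have h2 : |x| ^ q ≤ |x - y| ^ q := by
      refine Real.rpow_le_rpow (abs_nonneg _) ?_ hq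
      rw [abs_of_pos hx, abs_of_pos (by linarith)]; linarith
    have h3 : |y| ^ q ≤ |x - y| ^ q := by
      refine Real.rpow_le_rpow (abs_nonneg _) ?_ hq
      rw [abs_of_neg hy, abs_of_pos (by linarith)]; linarith
    linarith

theorem abs_signedPow_sub_le_of_one_le {q : ℝ} (hq : 1 ≤ q) (x y : ℝ) :
    |signedPow q x - signedPow q y| ≤ q * |x - y| * (|x| ^ (q - 1) + |y| ^ (q - 1)) := by
  refine signedPow_induction (P := fun x y => |signedPow q x - signedPow q y|
    ≤ q * |x - y| * (|x| ^ (q - 1) + |y| ^ (q - 1))) ?_ ?_ ?_ ?_ ?_ x y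
  · intro x y h
    rwa [abs_sub_comm, abs_sub_comm y x, add_comm (|y| ^ _)]
  · intro x y h
    rw [signedPow_neg, signedPow_neg, neg_sub_neg, neg_sub_neg, abs_neg, abs_neg]
    rwa [abs_sub_comm, abs_sub_comm y x]
  · intro x
    have : signedPow q 0 = 0 := by simp [signedPow]
    rw [this, sub_zero, sub_zero, signedPow, abs_mul, abs_of_nonneg (a := |x| ^ (q - 1)) (by positivity)]
    have h1 : 0 ≤ |x| * |x| ^ (q - 1) := by positivity
    have h2 : 0 ≤ |x| * |(0 : ℝ)| ^ (q - 1) := by positivity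
    nlinarith
  · intro x y hy hyx
    have hx := hy.trans_le hyx
    rw [signedPow_of_pos hy, signedPow_of_pos hx, abs_of_nonneg (sub_nonneg.2 hyx), abs_of_pos hx,
      abs_of_pos hy, abs_of_nonneg (sub_nonneg.2 (Real.rpow_le_rpow hy.le hyx (by linarith)))]
    have h := rpow_sub_one_mul_le hq hx.le hy.le
    have h1 : x ^ (q - 1) * x = x ^ q := by
      rw [Real.rpow_sub_one hx.ne']; field_simp
    have h2 : 0 ≤ q * (x - y) * y ^ (q - 1) :=
      mul_nonneg (mul_nonneg (by linarith) (sub_nonneg.2 hyx)) (Real.rpow_nonneg hy.le _)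
    nlinarith
  · intro x y hx hy
    have e : ∀ z : ℝ, |signedPow q z| = |z| * |z| ^ (q - 1) := by
      intro z
      rw [signedPow, abs_mul, abs_of_nonneg (a := |z| ^ (q - 1)) (by positivity)]
    have h1 : |signedPow q x - signedPow q y| ≤ |x| * |x| ^ (q - 1) + |y| * |y| ^ (q - 1) := by
      rw [← e, ← e]; exact abs_sub _ _
    have hx1 : |x| ≤ |x - y| := by rw [abs_of_pos hx, abs_of_pos (by linarith)]; linarith
    have hy1 : |y| ≤ |x - y| := by rw [abs_of_neg hy, abs_of_pos (by linarith)]; linarith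
    have h2 : |x| * |x| ^ (q - 1) ≤ |x - y| * |x| ^ (q - 1) :=
      mul_le_mul_of_nonneg_right hx1 (by positivity)
    have h3 : |y| * |y| ^ (q - 1) ≤ |x - y| * |y| ^ (q - 1) :=
      mul_le_mul_of_nonneg_right hy1 (by positivity)
    have h4 : 0 ≤ |x - y| * (|x| ^ (q - 1) + |y| ^ (q - 1)) := by positivity
    nlinarith

/-- Hölder continuity of the signed power bounds the remainder by `2 p |b| ^ p`, and `p ≤ 2`. The
middle term is linear in `b` and disappears under expectation. -/
theorem abs_add_rpow_le_of_le_two {p : ℝ} (hp : 1 ≤ p) (hp2 : p ≤ 2) (a b : ℝ) :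
    |a + b| ^ p ≤ |a| ^ p + p * (signedPow (p - 1) a * b) + 4 * |b| ^ p := by
  refine (abs_add_rpow_le hp a b).trans ?_
  have h := abs_signedPow_sub_le_of_le_one (q := p - 1) (by linarith) (by linarith) (a + b) a
  rw [add_sub_cancel_left] at h
  have h1 := mul_le_mul_of_nonneg_right h (abs_nonneg b)
  have h2 : |b| ^ (p - 1) * |b| ≤ |b| ^ p := by
    rcases eq_or_ne b 0 with rfl | hb
    · simp; positivity
    · rw [Real.rpow_sub_one (abs_pos.2 hb).ne', div_mul_cancel₀ _ (abs_pos.2 hb).ne']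
  have h3 : 0 ≤ |b| ^ p := by positivity
  nlinarith

/-- The bound `|a| ^ (p - 2) ≤ 1 + a²` leaves only a second moment of the partial sum in the
recursion. The constants are `5` and `4` times `p (p - 1) ≤ 12`. -/
theorem abs_add_rpow_le_of_two_le {p : ℝ} (hp : 2 ≤ p) (hp4 : p ≤ 4) (a b : ℝ) :
    |a + b| ^ p ≤ |a| ^ p + p * (signedPow (p - 1) a * b)
      + (60 * ((1 + a ^ 2) * b ^ 2) + 48 * |b| ^ p) := by
  refine (abs_add_rpow_le (by linarith) a b).trans ?_
  have h := abs_signedPow_sub_le_of_one_le (q := p - 1) (by linarith) (a + b) a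
  rw [add_sub_cancel_left, show p - 1 - 1 = p - 2 by ring] at h
  have hab : |a + b| ^ (p - 2) ≤ 4 * (|a| ^ (p - 2) + |b| ^ (p - 2)) := by
    have h2 : (2 : ℝ) ^ (p - 2) ≤ 4 := by
      calc (2 : ℝ) ^ (p - 2) ≤ 2 ^ (2 : ℝ) :=
            Real.rpow_le_rpow_of_exponent_le one_le_two (by linarith)
        _ = 4 := by norm_num
    have key : ∀ x y : ℝ, |x| ≤ |y| → |x + y| ^ (p - 2) ≤ 4 * |y| ^ (p - 2) := by
      intro x y hxy
      calc |x + y| ^ (p - 2) ≤ (2 * |y|) ^ (p - 2) :=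
            Real.rpow_le_rpow (abs_nonneg _) ((abs_add_le x y).trans (by linarith)) (by linarith)
        _ = 2 ^ (p - 2) * |y| ^ (p - 2) := Real.mul_rpow two_pos.le (abs_nonneg _)
        _ ≤ _ := mul_le_mul_of_nonneg_right h2 (by positivity)
    have ha : 0 ≤ |a| ^ (p - 2) := by positivity
    have hb : 0 ≤ |b| ^ (p - 2) := by positivity
    rcases le_total |a| |b| with hle | hle
    · linarith [key a b hle]
    · have := key b a hle
      rw [add_comm b a] at this
      linarith
  have ha2 : |a| ^ (p - 2) ≤ 1 + a ^ 2 := by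
    rcases le_total |a| 1 with h1 | h1
    · have := Real.rpow_le_one (abs_nonneg a) h1 (by linarith : 0 ≤ p - 2)
      nlinarith [sq_nonneg a]
    · have := Real.rpow_le_rpow_of_exponent_le h1 (by linarith : p - 2 ≤ 2)
      rw [Real.rpow_two, sq_abs] at this
      linarith
  have hb2 : b ^ 2 * |b| ^ (p - 2) ≤ |b| ^ p := by
    rcases eq_or_ne b 0 with rfl | hb
    · simp; positivity
    · have hb' := abs_pos.2 hb
      rw [← sq_abs, ← Real.rpow_two, ← Real.rpow_add hb']
      simp
  have hbb : |b| * |b| = b ^ 2 := by rw [← sq, sq_abs]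
  have hp1 : (p - 1) ≤ 3 := by linarith
  have hb0 : 0 ≤ b ^ 2 := sq_nonneg b
  have hsum : |a + b| ^ (p - 2) + |a| ^ (p - 2) ≤ 5 * (1 + a ^ 2) + 4 * |b| ^ (p - 2) := by
    linarith
  have h1 := mul_le_mul_of_nonneg_right h (abs_nonneg b)
  have h2 : (p - 1) * |b| * (|a + b| ^ (p - 2) + |a| ^ (p - 2)) * |b|
      = (p - 1) * (b ^ 2 * (|a + b| ^ (p - 2) + |a| ^ (p - 2))) := by rw [← hbb]; ring
  rw [h2] at h1
  have h3 : b ^ 2 * (|a + b| ^ (p - 2) + |a| ^ (p - 2)) ≤ 5 * ((1 + a ^ 2) * b ^ 2) + 4 * |b| ^ p := by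
    have := mul_le_mul_of_nonneg_left hsum hb0
    nlinarith
  have h4 : 0 ≤ b ^ 2 * (|a + b| ^ (p - 2) + |a| ^ (p - 2)) := by positivity
  have h5 : p * (p - 1) ≤ 12 := by nlinarith
  have h6 := mul_le_mul_of_nonneg_left h1 (by linarith : 0 ≤ p)
  have h7 := mul_le_mul_of_nonneg_right h5 h4
  nlinarith

end Pointwise

/-! ### Moment inequalities for sums of independent variables -/

section Moments

variable {Ω : Type*} [MeasurableSpace Ω] {P : Measure Ω} [IsProbabilityMeasure P]

theorem memLp_iff_integrable_abs_rpow {y : Ω → ℝ} (hy : Measurable y) {p : ℝ} (hp : 0 < p) :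
    MemLp y (ENNReal.ofReal p) P ↔ Integrable (fun ω => |y ω| ^ p) P := by
  rw [← integrable_norm_rpow_iff hy.aestronglyMeasurable (by simpa using hp) ENNReal.ofReal_ne_top,
    ENNReal.toReal_ofReal hp.le]
  simp only [Real.norm_eq_abs]

theorem measurable_signedPow (q : ℝ) : Measurable (signedPow q) := by
  unfold signedPow; fun_prop

theorem integrable_signedPow {p : ℝ} (hp : 1 ≤ p) {X : Ω → ℝ} (hX : Measurable X)
    (hXp : Integrable (fun ω => |X ω| ^ p) P) :
    Integrable (fun ω => signedPow (p - 1) (X ω)) P := by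
  refine ((integrable_const (1 : ℝ)).add hXp).mono'
    ((measurable_signedPow _).comp hX).aestronglyMeasurable (ae_of_all _ fun ω => ?_)
  refine (abs_signedPow_le _ _).trans ?_
  change |X ω| ^ (p - 1) ≤ 1 + |X ω| ^ p
  have h0 : 0 ≤ |X ω| ^ p := by positivity
  rcases le_total |X ω| 1 with h | h
  · have := Real.rpow_le_one (abs_nonneg (X ω)) h (by linarith : 0 ≤ p - 1)
    linarith
  · have := Real.rpow_le_rpow_of_exponent_le h (by linarith : p - 1 ≤ p)
    linarith

theorem integrable_of_abs_rpow {p : ℝ} (hp : 1 ≤ p) {X : Ω → ℝ} (hX : Measurable X)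
    (hXp : Integrable (fun ω => |X ω| ^ p) P) : Integrable X P := by
  have h := (memLp_iff_integrable_abs_rpow hX (by linarith)).2 hXp
  exact memLp_one_iff_integrable.1 (h.mono_exponent (by simpa using hp))

theorem integrable_abs_add_rpow {p : ℝ} (hp : 1 ≤ p) {X Y : Ω → ℝ} (hX : Measurable X)
    (hY : Measurable Y) (hXp : Integrable (fun ω => |X ω| ^ p) P)
    (hYp : Integrable (fun ω => |Y ω| ^ p) P) : Integrable (fun ω => |X ω + Y ω| ^ p) P := by
  have hp0 : 0 < p := by linarith
  exact (memLp_iff_integrable_abs_rpow (hX.add hY) hp0).1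
    (((memLp_iff_integrable_abs_rpow hX hp0).2 hXp).add
      ((memLp_iff_integrable_abs_rpow hY hp0).2 hYp))

theorem integrable_sq_of_abs_rpow {p : ℝ} (hp : 2 ≤ p) {X : Ω → ℝ} (hX : Measurable X)
    (hXp : Integrable (fun ω => |X ω| ^ p) P) : Integrable (fun ω => X ω ^ 2) P := by
  have h := (memLp_iff_integrable_abs_rpow hX (by linarith)).2 hXp
  have h2 : MemLp X 2 P := h.mono_exponent (by
    rw [← ENNReal.ofReal_ofNat]; exact ENNReal.ofReal_le_ofReal hp)
  exact h2.integrable_sq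

/-- Independence factors the expectation, and `Y` is centred: the first-order term of the pointwise
inequalities drops out. -/
theorem integral_cross_eq_zero {p : ℝ} (hp : 1 ≤ p) {X Y : Ω → ℝ} (hX : Measurable X)
    (hY : Measurable Y) (hind : IndepFun X Y P) (hXp : Integrable (fun ω => |X ω| ^ p) P)
    (hYp : Integrable (fun ω => |Y ω| ^ p) P) (hY0 : ∫ ω, Y ω ∂P = 0) :
    Integrable (fun ω => signedPow (p - 1) (X ω) * Y ω) P ∧
      ∫ ω, signedPow (p - 1) (X ω) * Y ω ∂P = 0 := by
  have hi : IndepFun (fun ω => signedPow (p - 1) (X ω)) Y P :=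
    hind.comp (measurable_signedPow (p - 1)) measurable_id
  have hint := integrable_signedPow hp hX hXp
  refine ⟨hi.integrable_mul hint (integrable_of_abs_rpow hp hY hYp), ?_⟩
  have := hi.integral_mul_eq_mul_integral hint.aestronglyMeasurable hY.aestronglyMeasurable
  rw [hY0, mul_zero] at this
  exact this

/-- One step of the von Bahr–Esseen inequality. -/
theorem integral_abs_add_rpow_le_of_le_two {p : ℝ} (hp : 1 ≤ p) (hp2 : p ≤ 2) {X Y : Ω → ℝ}
    (hX : Measurable X) (hY : Measurable Y) (hind : IndepFun X Y P)
    (hXp : Integrable (fun ω => |X ω| ^ p) P) (hYp : Integrable (fun ω => |Y ω| ^ p) P)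
    (hY0 : ∫ ω, Y ω ∂P = 0) :
    ∫ ω, |X ω + Y ω| ^ p ∂P ≤ ∫ ω, |X ω| ^ p ∂P + 4 * ∫ ω, |Y ω| ^ p ∂P := by
  obtain ⟨h1, h2⟩ := integral_cross_eq_zero hp hX hY hind hXp hYp hY0
  calc ∫ ω, |X ω + Y ω| ^ p ∂P
      ≤ ∫ ω, (|X ω| ^ p + p * (signedPow (p - 1) (X ω) * Y ω) + 4 * |Y ω| ^ p) ∂P :=
        integral_mono (integrable_abs_add_rpow hp hX hY hXp hYp)
          ((hXp.add (h1.const_mul p)).add (hYp.const_mul 4))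
          fun ω => abs_add_rpow_le_of_le_two hp hp2 _ _
    _ = _ := by
        rw [integral_add (f := fun ω => |X ω| ^ p + p * (signedPow (p - 1) (X ω) * Y ω))
            (hXp.add (h1.const_mul p)) (hYp.const_mul 4),
          integral_add hXp (h1.const_mul p), integral_const_mul, integral_const_mul, h2]
        ring

/-- One step of a Rosenthal type inequality. -/
theorem integral_abs_add_rpow_le_of_two_le {p : ℝ} (hp : 2 ≤ p) (hp4 : p ≤ 4) {X Y : Ω → ℝ}
    (hX : Measurable X) (hY : Measurable Y) (hind : IndepFun X Y P)
    (hXp : Integrable (fun ω => |X ω| ^ p) P) (hYp : Integrable (fun ω => |Y ω| ^ p) P)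
    (hY0 : ∫ ω, Y ω ∂P = 0) :
    ∫ ω, |X ω + Y ω| ^ p ∂P ≤ ∫ ω, |X ω| ^ p ∂P
      + (60 * ((1 + ∫ ω, X ω ^ 2 ∂P) * ∫ ω, Y ω ^ 2 ∂P) + 48 * ∫ ω, |Y ω| ^ p ∂P) := by
  have hp1 : 1 ≤ p := by linarith
  obtain ⟨h1, h2⟩ := integral_cross_eq_zero hp1 hX hY hind hXp hYp hY0
  have hX2 := integrable_sq_of_abs_rpow hp hX hXp
  have hY2 := integrable_sq_of_abs_rpow hp hY hYp
  have hi : IndepFun (fun ω => 1 + X ω ^ 2) (fun ω => Y ω ^ 2) P :=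
    hind.comp (φ := fun x => 1 + x ^ 2) (ψ := fun x => x ^ 2) (by fun_prop) (by fun_prop)
  have hX2' : Integrable (fun ω => 1 + X ω ^ 2) P := (integrable_const _).add hX2
  have h3 : Integrable (fun ω => (1 + X ω ^ 2) * Y ω ^ 2) P := hi.integrable_mul hX2' hY2
  have h4 : ∫ ω, (1 + X ω ^ 2) * Y ω ^ 2 ∂P = (1 + ∫ ω, X ω ^ 2 ∂P) * ∫ ω, Y ω ^ 2 ∂P := by
    have := hi.integral_mul_eq_mul_integral hX2'.aestronglyMeasurable hY2.aestronglyMeasurable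
    rw [integral_add (integrable_const _) hX2] at this
    simpa using this
  calc ∫ ω, |X ω + Y ω| ^ p ∂P
      ≤ ∫ ω, (|X ω| ^ p + p * (signedPow (p - 1) (X ω) * Y ω)
          + (60 * ((1 + X ω ^ 2) * Y ω ^ 2) + 48 * |Y ω| ^ p)) ∂P :=
        integral_mono (integrable_abs_add_rpow hp1 hX hY hXp hYp)
          ((hXp.add (h1.const_mul p)).add ((h3.const_mul 60).add (hYp.const_mul 48)))
          fun ω => abs_add_rpow_le_of_two_le hp hp4 _ _
    _ = _ := by
        rw [integral_add (f := fun ω => |X ω| ^ p + p * (signedPow (p - 1) (X ω) * Y ω))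
            (g := fun ω => 60 * ((1 + X ω ^ 2) * Y ω ^ 2) + 48 * |Y ω| ^ p)
            (hXp.add (h1.const_mul p)) ((h3.const_mul 60).add (hYp.const_mul 48)),
          integral_add hXp (h1.const_mul p), integral_add (h3.const_mul 60) (hYp.const_mul 48),
          integral_const_mul, integral_const_mul, integral_const_mul, h2, h4]
        ring

variable {y : ℕ → Ω → ℝ}

theorem integrable_abs_sum_rpow {p : ℝ} (hp : 1 ≤ p) (hm : ∀ i, Measurable (y i))
    (hint : ∀ i, Integrable (fun ω => |y i ω| ^ p) P) (k : ℕ) :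
    Integrable (fun ω => |∑ i ∈ Finset.range k, y i ω| ^ p) P := by
  induction k with
  | zero => simp
  | succ k ih =>
    simp only [Finset.sum_range_succ]
    exact integrable_abs_add_rpow hp (Finset.measurable_fun_sum _ fun i _ => hm i) (hm k) ih (hint k)

theorem indepFun_sum_range (hm : ∀ i, Measurable (y i)) (hind : iIndepFun y P) (k : ℕ) :
    IndepFun (fun ω => ∑ i ∈ Finset.range k, y i ω) (y k) P := by
  have := hind.indepFun_finsetSum_of_notMem hm (s := Finset.range k) (i := k) (by simp)
  convert this using 1
  ext ω
  simp

/-- The von Bahr–Esseen inequality (with a non-optimal constant). -/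
theorem integral_abs_sum_rpow_le {p : ℝ} (hp : 1 ≤ p) (hp2 : p ≤ 2) (hm : ∀ i, Measurable (y i))
    (hind : iIndepFun y P) (hint : ∀ i, Integrable (fun ω => |y i ω| ^ p) P)
    (h0 : ∀ i, ∫ ω, y i ω ∂P = 0) (k : ℕ) :
    ∫ ω, |∑ i ∈ Finset.range k, y i ω| ^ p ∂P
      ≤ 4 * ∑ i ∈ Finset.range k, ∫ ω, |y i ω| ^ p ∂P := by
  induction k with
  | zero => simp [(by linarith : p ≠ 0)]
  | succ k ih =>
    simp only [Finset.sum_range_succ]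
    have := integral_abs_add_rpow_le_of_le_two hp hp2
      (Finset.measurable_fun_sum (Finset.range k) fun i _ => hm i) (hm k)
      (indepFun_sum_range hm hind k) (integrable_abs_sum_rpow hp hm hint k) (hint k) (h0 k)
    linarith

/-- A Rosenthal type inequality for weighted sums. -/
theorem integral_abs_weighted_sum_rpow_le {p : ℝ} (hp : 2 ≤ p) (hp4 : p ≤ 4)
    (hm : ∀ i, Measurable (y i)) (hind : iIndepFun y P)
    (hint : ∀ i, Integrable (fun ω => |y i ω| ^ p) P) (h0 : ∀ i, ∫ ω, y i ω ∂P = 0) {K : ℝ}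
    (hK : ∀ i, ∫ ω, y i ω ^ 2 ∂P ≤ K) (hKp : ∀ i, ∫ ω, |y i ω| ^ p ∂P ≤ K) {h : ℕ → ℝ} {k : ℕ}
    (hh : ∑ i ∈ Finset.range k, h i ^ 2 ≤ 1) :
    ∫ ω, |∑ i ∈ Finset.range k, h i * y i ω| ^ p ∂P ≤ 60 * (1 + 4 * K) * K + 48 * K := by
  have hp1 : 1 ≤ p := by linarith
  have hK0 : 0 ≤ K := le_trans (integral_nonneg fun ω => sq_nonneg _) (hK 0)
  set x : ℕ → Ω → ℝ := fun i ω => h i * y i ω with hx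
  have hxm : ∀ i, Measurable (x i) := fun i => (hm i).const_mul _
  have hxind : iIndepFun x P := hind.comp (fun i t => h i * t) fun i => by fun_prop
  have hxint : ∀ i, Integrable (fun ω => |x i ω| ^ p) P := fun i => by
    simp only [hx, abs_mul, Real.mul_rpow (abs_nonneg _) (abs_nonneg _)]
    exact (hint i).const_mul _
  have hx0 : ∀ i, ∫ ω, x i ω ∂P = 0 := fun i => by
    simp only [hx]; rw [integral_const_mul, h0, mul_zero]
  have hx2 : ∀ i, ∫ ω, x i ω ^ 2 ∂P ≤ h i ^ 2 * K := fun i => by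
    simp only [hx, mul_pow]
    rw [integral_const_mul]
    exact mul_le_mul_of_nonneg_left (hK i) (sq_nonneg _)
  have hxp : ∀ i ∈ Finset.range k, ∫ ω, |x i ω| ^ p ∂P ≤ h i ^ 2 * K := fun i hi => by
    simp only [hx, abs_mul, Real.mul_rpow (abs_nonneg _) (abs_nonneg _)]
    rw [integral_const_mul]
    have h1 : h i ^ 2 ≤ 1 :=
      (Finset.single_le_sum (f := fun i => h i ^ 2) (fun i _ => sq_nonneg _) hi).trans hh
    -- Here `|h i| ≤ 1` and `p ≥ 2` make all moments proportional to `h i ^ 2`, so the bound does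
    -- not grow with `k`.
    have h2 : |h i| ^ p ≤ h i ^ 2 := by
      rcases (abs_nonneg (h i)).eq_or_lt with h3 | h3
      · rw [← h3, Real.zero_rpow (by linarith)]; exact sq_nonneg _
      · rw [← sq_abs, ← Real.rpow_two]
        exact Real.rpow_le_rpow_of_exponent_ge h3 (abs_le_one_iff_mul_self_le_one.2 (by nlinarith)) hp
    exact mul_le_mul h2 (hKp i) (integral_nonneg fun ω => by positivity) (sq_nonneg _)
  have hx2i : ∀ i, Integrable (fun ω => |x i ω| ^ (2 : ℝ)) P := fun i => by
    simp only [Real.rpow_two, sq_abs]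
    exact integrable_sq_of_abs_rpow hp (hxm i) (hxint i)
  -- The second moment of the partial sums, from the von Bahr–Esseen inequality at `p = 2`.
  have hS2 : ∀ j ≤ k, ∫ ω, (∑ i ∈ Finset.range j, x i ω) ^ 2 ∂P ≤ 4 * K := by
    intro j hj
    have h1 := integral_abs_sum_rpow_le (p := 2) one_le_two le_rfl hxm hxind hx2i hx0 j
    simp only [Real.rpow_two, sq_abs] at h1
    refine h1.trans (mul_le_mul_of_nonneg_left ?_ (by norm_num))
    calc ∑ i ∈ Finset.range j, ∫ ω, x i ω ^ 2 ∂P ≤ ∑ i ∈ Finset.range k, h i ^ 2 * K :=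
          (Finset.sum_le_sum fun i _ => hx2 i).trans
            (Finset.sum_le_sum_of_subset_of_nonneg (Finset.range_mono hj) fun i _ _ => by positivity)
      _ ≤ 1 * K := by rw [← Finset.sum_mul]; exact mul_le_mul_of_nonneg_right hh hK0
      _ = K := one_mul K
  have main : ∀ j ≤ k, ∫ ω, |∑ i ∈ Finset.range j, x i ω| ^ p ∂P
      ≤ (60 * (1 + 4 * K) * K + 48 * K) * ∑ i ∈ Finset.range j, h i ^ 2 := by
    intro j
    induction j with
    | zero => simp [(by linarith : p ≠ 0)]
    | succ j ih =>
      intro hj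
      simp only [Finset.sum_range_succ]
      have h1 := integral_abs_add_rpow_le_of_two_le hp hp4
        (Finset.measurable_fun_sum (Finset.range j) fun i _ => hxm i) (hxm j)
        (indepFun_sum_range hxm hxind j) (integrable_abs_sum_rpow hp1 hxm hxint j) (hxint j) (hx0 j)
      have h2 := ih (by omega)
      have h3 := hS2 j (by omega)
      have h4 := hx2 j
      have h5 := hxp j (Finset.mem_range.2 hj)
      have h6 : (1 + ∫ ω, (∑ i ∈ Finset.range j, x i ω) ^ 2 ∂P) * ∫ ω, x j ω ^ 2 ∂P
          ≤ (1 + 4 * K) * (h j ^ 2 * K) :=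
        mul_le_mul (by linarith) h4 (integral_nonneg fun ω => sq_nonneg _) (by positivity)
      linarith
  refine (main k le_rfl).trans ?_
  exact mul_le_of_le_one_right (by positivity) hh

end Moments

/-! ### Kronecker's lemma and a strong law -/

section StrongLaw

/-- Kronecker's lemma. -/
theorem tendsto_sum_div_of_tendsto_sum_div {b x : ℕ → ℝ} {s : ℝ} (hb : Monotone b)
    (hpos : ∀ i, 0 < b i) (hlim : Tendsto b atTop atTop)
    (h : Tendsto (fun k => ∑ i ∈ Finset.range k, x i / b i) atTop (𝓝 s)) :
    Tendsto (fun k => (∑ i ∈ Finset.range k, x i) / b k) atTop (𝓝 0) := by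
  set T : ℕ → ℝ := fun k => ∑ i ∈ Finset.range k, x i / b i - s with hT
  have hT0 : Tendsto T atTop (𝓝 0) := by simpa using h.sub_const s
  set g : ℕ → ℝ := fun i => b (i + 1) - b i with hg
  have hgs : ∀ k, ∑ i ∈ Finset.range k, g i = b k - b 0 := fun k => Finset.sum_range_sub b k
  -- Summation by parts with the tails `T → 0`; the remaining sum is negligible because `g i * T (i
  -- + 1) = o(g i)` and the `g i` sum to `b k - b 0`.
  have hid : ∀ k, ∑ i ∈ Finset.range k, x i
      = b k * T k - b 0 * T 0 - ∑ i ∈ Finset.range k, g i * T (i + 1) := by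
    intro k
    induction k with
    | zero => simp
    | succ k ih =>
      rw [Finset.sum_range_succ, Finset.sum_range_succ, ih]
      have h1 : T (k + 1) = T k + x k / b k := by
        simp only [hT, Finset.sum_range_succ]; ring
      have h2 : b k * (x k / b k) = x k := mul_div_cancel₀ _ (hpos k).ne'
      simp only [hg]
      rw [h1]
      linear_combination -h2
  have hlo : (fun i => g i * T (i + 1)) =o[atTop] g := by
    have h1 : (fun i => T (i + 1)) =o[atTop] fun _ => (1 : ℝ) :=
      (Asymptotics.isLittleO_one_iff ℝ).2 ((tendsto_add_atTop_iff_nat 1).2 hT0)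
    simpa using (Asymptotics.isBigO_refl g atTop).mul_isLittleO h1
  have hsum := hlo.sum_range (fun i => sub_nonneg.2 (hb (Nat.le_succ i)))
    (by simp only [hgs]; exact tendsto_atTop_add_const_right _ _ hlim)
  have hO : (fun k => ∑ i ∈ Finset.range k, g i) =O[atTop] b := by
    refine Asymptotics.isBigO_of_le _ fun k => ?_
    rw [hgs, Real.norm_of_nonneg (sub_nonneg.2 (hb (Nat.zero_le k))), Real.norm_of_nonneg (hpos k).le]
    linarith [hpos 0]
  have h3 := (hsum.trans_isBigO hO).tendsto_div_nhds_zero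
  have h4 : Tendsto (fun k => b 0 * T 0 / b k) atTop (𝓝 0) := hlim.const_div_atTop _
  have h5 := (hT0.sub h4).sub h3
  rw [sub_zero, sub_zero] at h5
  refine h5.congr fun k => ?_
  rw [hid k, sub_div, sub_div, mul_div_cancel_left₀ _ (hpos k).ne']

variable {Ω : Type*} [MeasurableSpace Ω] {P : Measure Ω} [IsProbabilityMeasure P]
  {y : ℕ → Ω → ℝ}

/-- A series of independent centred random variables with summable moments of order `p ∈ [1, 2]`
converges almost surely. -/
theorem ae_exists_tendsto_sum {p : ℝ} (hp : 1 ≤ p) (hp2 : p ≤ 2) (hm : ∀ i, Measurable (y i))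
    (hind : iIndepFun y P) (hint : ∀ i, Integrable (fun ω => |y i ω| ^ p) P)
    (h0 : ∀ i, ∫ ω, y i ω ∂P = 0) (hs : Summable fun i => ∫ ω, |y i ω| ^ p ∂P) :
    ∀ᵐ ω ∂P, ∃ s, Tendsto (fun k => ∑ i ∈ Finset.range k, y i ω) atTop (𝓝 s) := by
  have hsm : ∀ i, StronglyMeasurable (y i) := fun i => (hm i).stronglyMeasurable
  set ℱ := Filtration.natural y hsm with hℱ
  -- The shift to `k + 1` includes `y k`, so that `f` is adapted to the natural filtration and its
  -- next increment `y (k + 1)` is independent of the past.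
  set f : ℕ → Ω → ℝ := fun k ω => ∑ i ∈ Finset.range (k + 1), y i ω with hf
  have hyi : ∀ i, Integrable (y i) P := fun i => integrable_of_abs_rpow hp (hm i) (hint i)
  have hfi : ∀ k, Integrable (f k) P := fun k => integrable_finsetSum _ fun i _ => hyi i
  have hadapted : StronglyAdapted ℱ f := by
    intro k
    refine Finset.stronglyMeasurable_fun_sum _ fun i hi => ?_
    have h1 : StronglyMeasurable[ℱ i] (y i) := Filtration.stronglyAdapted_natural hsm i
    exact h1.mono (ℱ.mono (by simpa [Nat.lt_succ_iff] using hi))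
  have hmart : Martingale f ℱ P := by
    refine martingale_nat hadapted hfi fun k => ?_
    have e : f (k + 1) = f k + y (k + 1) := by
      ext ω; simp only [hf, Pi.add_apply]; rw [Finset.sum_range_succ]
    have h1 : P[f (k + 1)|ℱ k] =ᵐ[P] P[f k|ℱ k] + P[y (k + 1)|ℱ k] := by
      rw [e]; exact condExp_add (hfi k) (hyi (k + 1)) _
    have h2 : P[f k|ℱ k] = f k := condExp_of_stronglyMeasurable (ℱ.le k) (hadapted k) (hfi k)
    have h3 := hind.condExp_natural_ae_eq_of_lt hsm (Nat.lt_succ_self k)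
    filter_upwards [h1, h3] with ω hω1 hω3
    rw [hω1, Pi.add_apply, h2, hω3, h0, add_zero]
  set R : ℝ := 1 + 4 * ∑' i, ∫ ω, |y i ω| ^ p ∂P with hR
  have hn : ∀ i, 0 ≤ ∫ ω, |y i ω| ^ p ∂P := fun i => integral_nonneg fun ω => by positivity
  have hbdd : ∀ k, eLpNorm (f k) 1 P ≤ (Real.toNNReal R : ℝ≥0∞) := by
    intro k
    rw [eLpNorm_one_eq_lintegral_enorm, ← ofReal_integral_norm_eq_lintegral_enorm (hfi k)]
    refine ENNReal.ofReal_le_ofReal ?_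
    have hfp : Integrable (fun ω => |f k ω| ^ p) P := integrable_abs_sum_rpow hp hm hint (k + 1)
    -- Boundedness in `L¹`, via `|x| ≤ 1 + |x| ^ p` and the von Bahr–Esseen inequality, makes the
    -- martingale converge.
    calc ∫ ω, ‖f k ω‖ ∂P ≤ ∫ ω, (1 + |f k ω| ^ p) ∂P := by
          refine integral_mono (hfi k).norm ((integrable_const _).add hfp) fun ω => ?_
          rw [Real.norm_eq_abs]
          have h1 : 0 ≤ |f k ω| ^ p := by positivity
          rcases le_total |f k ω| 1 with h | h
          · linarith
          · have := Real.rpow_le_rpow_of_exponent_le h hp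
            rw [Real.rpow_one] at this
            linarith
      _ = 1 + ∫ ω, |f k ω| ^ p ∂P := by
          rw [integral_add (integrable_const _) hfp]; simp
      _ ≤ R := by
          have h1 := integral_abs_sum_rpow_le hp hp2 hm hind hint h0 (k + 1)
          have h2 := hs.sum_le_tsum (Finset.range (k + 1)) fun i _ => hn i
          linarith
  filter_upwards [hmart.submartingale.exists_ae_tendsto_of_bdd hbdd] with ω hω
  obtain ⟨s, hs⟩ := hω
  exact ⟨s, (tendsto_add_atTop_iff_nat 1).1 hs⟩

/-- A strong law of large numbers for independent centred random variables with moments of order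
`p ∈ [1, 2]`. -/
theorem ae_tendsto_sum_div {p K : ℝ} (hp : 1 ≤ p) (hp2 : p ≤ 2) (hm : ∀ i, Measurable (y i))
    (hind : iIndepFun y P) (hint : ∀ i, Integrable (fun ω => |y i ω| ^ p) P)
    (h0 : ∀ i, ∫ ω, y i ω ∂P = 0) (hK : ∀ i, ∫ ω, |y i ω| ^ p ∂P ≤ K) {b : ℕ → ℝ}
    (hb : Monotone b) (hpos : ∀ i, 0 < b i) (hlim : Tendsto b atTop atTop)
    (hs : Summable fun i => 1 / b i ^ p) :
    ∀ᵐ ω ∂P, Tendsto (fun k => (∑ i ∈ Finset.range k, y i ω) / b k) atTop (𝓝 0) := by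
  have e : ∀ i ω, |y i ω / b i| ^ p = (1 / b i ^ p) * |y i ω| ^ p := by
    intro i ω
    rw [abs_div, abs_of_pos (hpos i), Real.div_rpow (abs_nonneg _) (hpos i).le]
    ring
  have hbp : ∀ i, 0 ≤ 1 / b i ^ p := fun i => div_nonneg zero_le_one (Real.rpow_nonneg (hpos i).le _)
  have h1 := ae_exists_tendsto_sum (P := P) (y := fun i ω => y i ω / b i) hp hp2
    (fun i => (hm i).div_const _) (hind.comp (fun i t => t / b i) fun i => by fun_prop)
    (fun i => by simp only [e]; exact (hint i).const_mul _)
    (fun i => by rw [integral_div, h0, zero_div])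
    (by
      refine Summable.of_nonneg_of_le (fun i => integral_nonneg fun ω => by positivity) (fun i => ?_)
        (hs.mul_right K)
      simp only [e]
      rw [integral_const_mul]
      exact mul_le_mul_of_nonneg_left (hK i) (hbp i))
  filter_upwards [h1] with ω hω
  obtain ⟨s, hs⟩ := hω
  exact tendsto_sum_div_of_tendsto_sum_div hb hpos hlim hs

/-- Markov's inequality for absolute moments. -/
theorem measure_lt_abs_le {p t : ℝ} (hp : 0 < p) (ht : 0 < t) {X : Ω → ℝ}
    (hX : Integrable (fun ω => |X ω| ^ p) P) :
    P {ω | t < |X ω|} ≤ ENNReal.ofReal ((∫ ω, |X ω| ^ p ∂P) / t ^ p) := by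
  have htp : 0 < t ^ p := Real.rpow_pos_of_pos ht p
  have h1 := mul_meas_ge_le_integral_of_nonneg (μ := P) (ae_of_all _ fun ω => by positivity) hX (t ^ p)
  have h2 : P {ω | t < |X ω|} ≤ P {ω | t ^ p ≤ |X ω| ^ p} :=
    measure_mono fun ω hω => Real.rpow_le_rpow ht.le (le_of_lt hω) hp.le
  refine h2.trans ?_
  rw [← ofReal_measureReal]
  refine ENNReal.ofReal_le_ofReal ?_
  rw [le_div_iff₀ htp, mul_comm]
  exact h1

end StrongLaw

/-! ### Monotonicity of the least eigenvalue -/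

section Lam

variable {n : ℕ} (a : ℕ → Fin n → ℝ)

theorem A₀_mulVec_dotProduct (m : ℕ) (z : Fin n → ℝ) :
    (A₀ a m *ᵥ z) ⬝ᵥ (A₀ a m *ᵥ z) = ∑ i ∈ Finset.range m, (a i ⬝ᵥ z) ^ 2 := by
  rw [Finset.sum_range, dotProduct]
  refine Finset.sum_congr rfl fun i _ => ?_
  rw [sq]; rfl

/-- New rows add squares to the quadratic form. Kronecker's lemma needs this for the normalizing
sequence. -/
theorem lam_mono (hn : 0 < n) : Monotone (lam a) := by
  have : NeZero n := ⟨hn.ne'⟩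
  intro m m' h
  refine le_lamMin _ fun z => (lamMin_mul_le (A₀ a m) z).trans ?_
  rw [A₀_mulVec_dotProduct, A₀_mulVec_dotProduct]
  exact Finset.sum_le_sum_of_subset_of_nonneg (Finset.range_mono h) fun i _ _ => sq_nonneg _

end Lam

/-! ### Consequences of the summability conditions -/

section Analysis

/-- If `∑ 1 / l ^ r` is a convergent series of positive terms, then `l → ∞`. -/
theorem tendsto_atTop_of_summable_inv_rpow {l : ℕ → ℝ} {r : ℝ} (hr : 0 < r) (hpos : ∀ k, 0 < l k)
    (hs : Summable fun k => 1 / l k ^ r) : Tendsto l atTop atTop := by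
  refine tendsto_atTop.2 fun M => ?_
  set M' := max M 1 with hM'
  have hM0 : 0 < M' := lt_max_of_lt_right one_pos
  have h1 : 0 < 1 / M' ^ r := one_div_pos.2 (Real.rpow_pos_of_pos hM0 r)
  filter_upwards [hs.tendsto_atTop_zero.eventually_lt_const h1] with k hk
  refine (le_max_left M 1).trans (le_of_lt ?_)
  by_contra! hle
  have h2 := Real.rpow_le_rpow (hpos k).le hle hr.le
  have h3 := one_div_le_one_div_of_le (Real.rpow_pos_of_pos (hpos k) r) h2
  linarith

/-- Convergence of `∑ (√m / l_m) ^ r` with `r ≥ 2` implies convergence of `∑ 1 / l_m ^ 2`. -/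
theorem summable_inv_sq_of_summable {l : ℕ → ℝ} {r : ℝ} {m₀ : ℕ} (hm₀ : 1 ≤ m₀) (hr : 2 ≤ r)
    (hpos : ∀ k, 0 < l k)
    (hs : Summable fun k : ℕ => (Real.sqrt ((m₀ + k : ℕ) : ℝ) / l k) ^ r) :
    Summable fun k => 1 / l k ^ (2 : ℝ) := by
  have hq : ∀ k : ℕ, (0 : ℝ) < ((m₀ + k : ℕ) : ℝ) := fun k => by exact_mod_cast (by omega)
  have hq1 : ∀ k : ℕ, (1 : ℝ) ≤ ((m₀ + k : ℕ) : ℝ) := fun k => by exact_mod_cast (by omega)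
  have e : ∀ k, 1 / l k ^ (2 : ℝ) = (Real.sqrt ((m₀ + k : ℕ) : ℝ) / l k) ^ (2 : ℝ)
      * (1 / ((m₀ + k : ℕ) : ℝ)) := by
    intro k
    rw [Real.rpow_two, Real.rpow_two, div_pow, Real.sq_sqrt (hq k).le]
    have := (hq k).ne'
    have := (hpos k).ne'
    field_simp
  have hb : ∀ k, 0 ≤ Real.sqrt ((m₀ + k : ℕ) : ℝ) / l k := fun k =>
    div_nonneg (Real.sqrt_nonneg _) (hpos k).le
  rcases hr.eq_or_lt with rfl | hr2
  · refine Summable.of_nonneg_of_le (fun k => ?_) (fun k => ?_) hs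
    · have := Real.rpow_pos_of_pos (hpos k) 2
      positivity
    · rw [e]
      refine mul_le_of_le_one_right (Real.rpow_nonneg (hb k) _) ?_
      rw [div_le_one (hq k)]
      exact hq1 k
  -- Young's inequality for `(√m / l)² * (1 / m)` with exponents `r / 2` and `β`; `∑ m ^ (-β)`
  -- converges as `β > 1`.
  · set β := r / (r - 2) with hβ
    have hβ1 : 1 < β := by rw [hβ, lt_div_iff₀ (by linarith)]; linarith
    have hps : Summable fun k : ℕ => 1 / ((m₀ + k : ℕ) : ℝ) ^ β := by
      have h1 := Real.summable_one_div_nat_rpow.2 hβ1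
      have h2 := (summable_nat_add_iff m₀).2 h1
      simpa only [add_comm] using h2
    refine Summable.of_nonneg_of_le (fun k => ?_) (fun k => ?_) (hs.add hps)
    · have := Real.rpow_pos_of_pos (hpos k) 2
      positivity
    · rw [e]
      have hr0 : 0 < r := by linarith
      have h1 := Real.geom_mean_le_arith_mean2_weighted (w₁ := 2 / r) (w₂ := (r - 2) / r)
        (p₁ := (Real.sqrt ((m₀ + k : ℕ) : ℝ) / l k) ^ r) (p₂ := 1 / ((m₀ + k : ℕ) : ℝ) ^ β)
        (by positivity) (div_nonneg (by linarith) hr0.le) (Real.rpow_nonneg (hb k) _)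
        (one_div_nonneg.2 (Real.rpow_nonneg (hq k).le _)) (by field_simp; ring)
      rw [← Real.rpow_mul (hb k), mul_div_cancel₀ _ hr0.ne', Real.div_rpow zero_le_one
        (Real.rpow_nonneg (hq k).le _), Real.one_rpow, ← Real.rpow_mul (hq k).le] at h1
      have hβr : β * ((r - 2) / r) = 1 := by
        rw [hβ]
        have : r - 2 ≠ 0 := by linarith
        field_simp
      rw [hβr, Real.rpow_one] at h1
      refine h1.trans (add_le_add ?_ ?_)
      · refine mul_le_of_le_one_left (Real.rpow_nonneg (hb k) _) ?_
        rw [div_le_one hr0]; exact hr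
      · refine mul_le_of_le_one_left (one_div_nonneg.2 (Real.rpow_nonneg (hq k).le _)) ?_
        rw [div_le_one hr0]; linarith

end Analysis

/-! ### Moments of the errors and of their products -/

section Model

variable {n d : ℕ} {Ω : Type*} [MeasurableSpace Ω] {P : Measure Ω} [IsProbabilityMeasure P]
  {S : Matrix (Fin n ⊕ Fin d) (Fin n ⊕ Fin d) ℝ} {c : ℕ → Ω → (Fin n ⊕ Fin d) → ℝ}

theorem ErrorModel.measurable_apply (h : ErrorModel P S c) (i : ℕ) (j : Fin n ⊕ Fin d) :
    Measurable fun ω => c i ω j :=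
  (measurable_pi_apply j).comp (h.measurable i)

theorem BoundedMoments.exists_integrable (h : ErrorModel P S c) {p : ℝ}
    (hb : BoundedMoments P c p) :
    ∃ K : ℝ, 0 ≤ K ∧ ∀ i j, Integrable (fun ω => |c i ω j| ^ p) P ∧ ∫ ω, |c i ω j| ^ p ∂P ≤ K := by
  obtain ⟨K, hK⟩ := hb
  refine ⟨K, K.2, fun i j => ?_⟩
  have hm : AEStronglyMeasurable (fun ω => |c i ω j| ^ p) P :=
    ((h.measurable_apply i j).abs.pow_const p).aestronglyMeasurable
  have hnn : 0 ≤ᵐ[P] fun ω => |c i ω j| ^ p := ae_of_all _ fun ω => by positivity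
  refine ⟨⟨hm, ?_⟩, ?_⟩
  · rw [hasFiniteIntegral_iff_ofReal hnn]
    exact (hK i j).trans_lt ENNReal.coe_lt_top
  · rw [integral_eq_lintegral_of_nonneg_ae hnn hm]
    exact ENNReal.toReal_le_coe_of_le_coe (hK i j)

theorem BoundedMoments.mono {p q : ℝ} (hp : 0 ≤ p) (hpq : p ≤ q) (h : BoundedMoments P c q) :
    BoundedMoments P c p := by
  obtain ⟨K, hK⟩ := h
  refine ⟨1 + K, fun i j => ?_⟩
  calc ∫⁻ ω, ENNReal.ofReal (|c i ω j| ^ p) ∂P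
      ≤ ∫⁻ ω, (1 + ENNReal.ofReal (|c i ω j| ^ q)) ∂P := by
        refine lintegral_mono fun ω => ?_
        have h1 : |c i ω j| ^ p ≤ 1 + |c i ω j| ^ q := by
          have h0 : 0 ≤ |c i ω j| ^ q := by positivity
          rcases le_total |c i ω j| 1 with h | h
          · have := Real.rpow_le_one (abs_nonneg (c i ω j)) h hp
            linarith
          · have := Real.rpow_le_rpow_of_exponent_le h hpq
            linarith
        refine (ENNReal.ofReal_le_ofReal h1).trans ?_
        rw [ENNReal.ofReal_add zero_le_one (by positivity), ENNReal.ofReal_one]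
    _ = 1 + ∫⁻ ω, ENNReal.ofReal (|c i ω j| ^ q) ∂P := by
        rw [lintegral_add_left measurable_const]; simp
    _ ≤ ((1 + K : ℝ≥0) : ℝ≥0∞) := by
        push_cast
        exact add_le_add le_rfl (hK i j)

/-- The centred products of the errors. -/
def centredProd (S : Matrix (Fin n ⊕ Fin d) (Fin n ⊕ Fin d) ℝ) (c : ℕ → Ω → (Fin n ⊕ Fin d) → ℝ)
    (j k : Fin n ⊕ Fin d) (i : ℕ) (ω : Ω) : ℝ :=
  c i ω j * c i ω k - S j k

theorem ErrorModel.measurable_centredProd (h : ErrorModel P S c) (j k : Fin n ⊕ Fin d) (i : ℕ) :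
    Measurable (centredProd S c j k i) :=
  ((h.measurable_apply i j).mul (h.measurable_apply i k)).sub_const _

theorem ErrorModel.iIndepFun_centredProd (h : ErrorModel P S c) (j k : Fin n ⊕ Fin d) :
    iIndepFun (centredProd S c j k) P :=
  h.indep.comp (fun _ v => v j * v k - S j k) fun _ => by fun_prop

theorem ErrorModel.iIndepFun_apply (h : ErrorModel P S c) (j : Fin n ⊕ Fin d) :
    iIndepFun (fun i ω => c i ω j) P :=
  h.indep.comp (fun _ v => v j) fun _ => by fun_prop

theorem ErrorModel.integral_centredProd (h : ErrorModel P S c) (j k : Fin n ⊕ Fin d) (i : ℕ) :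
    ∫ ω, centredProd S c j k i ω ∂P = 0 := by
  simp only [centredProd]
  have hi : Integrable (fun ω => c i ω j * c i ω k) P := (h.memLp i j).integrable_mul (h.memLp i k)
  rw [integral_sub hi (integrable_const _), h.cov]
  simp

/-- A product of two errors has moments of half the order: `|x y| ^ r ≤ |x| ^ (2 r) + |y| ^ (2 r)`.
-/
theorem ErrorModel.exists_integrable_centredProd (h : ErrorModel P S c) {r : ℝ} (hr : 1 ≤ r)
    (hr2 : r ≤ 2) (hb : BoundedMoments P c (2 * r)) :
    ∃ K : ℝ, 0 ≤ K ∧ ∀ j k i, Integrable (fun ω => |centredProd S c j k i ω| ^ r) P ∧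
      ∫ ω, |centredProd S c j k i ω| ^ r ∂P ≤ K := by
  obtain ⟨K, hK0, hK⟩ := hb.exists_integrable h
  set M := ∑ j, ∑ k, |S j k| ^ r with hM
  have hM0 : 0 ≤ M := Finset.sum_nonneg fun j _ => Finset.sum_nonneg fun k _ => by positivity
  have hSM : ∀ j k, |S j k| ^ r ≤ M := fun j k =>
    (Finset.single_le_sum (f := fun k => |S j k| ^ r) (fun k _ => by positivity)
      (Finset.mem_univ k)).trans
    (Finset.single_le_sum (f := fun j => ∑ k, |S j k| ^ r)
      (fun j _ => Finset.sum_nonneg fun k _ => by positivity) (Finset.mem_univ j))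
  have hadd : ∀ x y : ℝ, |x - y| ^ r ≤ 4 * (|x| ^ r + |y| ^ r) := by
    intro x y
    have h4 : (2 : ℝ) ^ r ≤ 4 := by
      calc (2 : ℝ) ^ r ≤ 2 ^ (2 : ℝ) := Real.rpow_le_rpow_of_exponent_le one_le_two hr2
        _ = 4 := by norm_num
    have key : ∀ M : ℝ, 0 ≤ M → |x| ≤ M → |y| ≤ M → |x - y| ^ r ≤ 4 * M ^ r := by
      intro M hM hx hy
      calc |x - y| ^ r ≤ (2 * M) ^ r :=
            Real.rpow_le_rpow (abs_nonneg _) ((abs_sub x y).trans (by linarith)) (by linarith)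
        _ = 2 ^ r * M ^ r := Real.mul_rpow two_pos.le hM
        _ ≤ _ := mul_le_mul_of_nonneg_right h4 (by positivity)
    have hx : 0 ≤ |x| ^ r := by positivity
    have hy : 0 ≤ |y| ^ r := by positivity
    rcases le_total |x| |y| with hle | hle
    · linarith [key |y| (abs_nonneg _) hle le_rfl]
    · linarith [key |x| (abs_nonneg _) le_rfl hle]
  have hmul : ∀ x y : ℝ, |x * y| ^ r ≤ |x| ^ (2 * r) + |y| ^ (2 * r) := by
    intro x y
    have key : ∀ M : ℝ, 0 ≤ M → |x| ≤ M → |y| ≤ M → |x * y| ^ r ≤ M ^ (2 * r) := by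
      intro M hM hx hy
      rw [Real.rpow_mul hM, Real.rpow_two, sq, abs_mul]
      exact Real.rpow_le_rpow (by positivity) (mul_le_mul hx hy (abs_nonneg _) hM) (by linarith)
    have hx : 0 ≤ |x| ^ (2 * r) := by positivity
    have hy : 0 ≤ |y| ^ (2 * r) := by positivity
    rcases le_total |x| |y| with hle | hle
    · linarith [key |y| (abs_nonneg _) hle le_rfl]
    · linarith [key |x| (abs_nonneg _) le_rfl hle]
  refine ⟨4 * (K + K + M), by positivity, fun j k i => ?_⟩
  have hle : ∀ ω, |centredProd S c j k i ω| ^ r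
      ≤ 4 * (|c i ω j| ^ (2 * r) + |c i ω k| ^ (2 * r) + M) := fun ω => by
    refine (hadd _ _).trans ?_
    have h1 := hmul (c i ω j) (c i ω k)
    have h2 := hSM j k
    linarith
  have hint : Integrable (fun ω => 4 * (|c i ω j| ^ (2 * r) + |c i ω k| ^ (2 * r) + M)) P :=
    (((hK i j).1.add (hK i k).1).add (integrable_const _)).const_mul 4
  have hint' : Integrable (fun ω => |centredProd S c j k i ω| ^ r) P := by
    refine hint.mono' ?_ (ae_of_all _ fun ω => ?_)
    · have := h.measurable_centredProd j k i
      exact (by fun_prop : Measurable fun ω => |centredProd S c j k i ω| ^ r).aestronglyMeasurable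
    · rw [Real.norm_of_nonneg (by positivity)]; exact hle ω
  refine ⟨hint', (integral_mono hint' hint hle).trans ?_⟩
  rw [integral_const_mul, integral_add (f := fun ω => |c i ω j| ^ (2 * r) + |c i ω k| ^ (2 * r))
    ((hK i j).1.add (hK i k).1) (integrable_const _), integral_add (hK i j).1 (hK i k).1]
  have h1 := (hK i j).2
  have h2 := (hK i k).2
  simp only [integral_const, probReal_univ, one_smul]
  linarith

/-- The Rosenthal type inequality at order `2 r ∈ [2, 4]`, with one constant for all normalized
weights. -/
theorem ErrorModel.exists_weighted_sum_le (h : ErrorModel P S c) {r : ℝ} (hr : 1 ≤ r)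
    (hr2 : r ≤ 2) (hb : BoundedMoments P c (2 * r)) :
    ∃ K : ℝ, 0 ≤ K ∧ ∀ (j : Fin n ⊕ Fin d) (w : ℕ → ℝ) (m : ℕ),
      ∑ i ∈ Finset.range m, w i ^ 2 ≤ 1 →
      Integrable (fun ω => |∑ i ∈ Finset.range m, w i * c i ω j| ^ (2 * r)) P ∧
      ∫ ω, |∑ i ∈ Finset.range m, w i * c i ω j| ^ (2 * r) ∂P ≤ K := by
  obtain ⟨K, hK0, hK⟩ := hb.exists_integrable h
  set K' := K + ∑ j, |S j j| with hK'
  have hK'0 : 0 ≤ K' := add_nonneg hK0 (Finset.sum_nonneg fun j _ => abs_nonneg _)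
  refine ⟨60 * (1 + 4 * K') * K' + 48 * K', by positivity, fun j w m hw => ⟨?_, ?_⟩⟩
  · refine integrable_abs_sum_rpow (y := fun i ω => w i * c i ω j) (by linarith)
      (fun i => (h.measurable_apply i j).const_mul _) (fun i => ?_) m
    simp only [abs_mul, Real.mul_rpow (abs_nonneg _) (abs_nonneg _)]
    exact (hK i j).1.const_mul _
  · refine integral_abs_weighted_sum_rpow_le (y := fun i ω => c i ω j) (by linarith) (by linarith)
      (fun i => h.measurable_apply i j) (h.iIndepFun_apply j) (fun i => (hK i j).1)
      (fun i => h.mean i j) (fun i => ?_) (fun i => (hK i j).2.trans ?_) hw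
    · simp only [sq]
      rw [h.cov]
      have h1 : |S j j| ≤ ∑ j, |S j j| :=
        Finset.single_le_sum (f := fun j => |S j j|) (fun k _ => abs_nonneg _) (Finset.mem_univ j)
      linarith [le_abs_self (S j j)]
    · rw [hK']
      exact le_add_of_nonneg_right (Finset.sum_nonneg fun j _ => abs_nonneg _)

end Model

/-! ### The events on which the errors are small -/

section SmallErrors

variable {n d : ℕ} {Ω : Type*}

/-- Coordinates of an orthonormal system spanning the column space of `A₀`. -/
theorem exists_weights (a : ℕ → Fin n → ℝ) :
    ∃ w : ℕ → Fin n → ℕ → ℝ, ∀ m, n ≤ m → (∀ q, ∑ i ∈ Finset.range m, w m q i ^ 2 ≤ 1) ∧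
      ∀ (W : Matrix (Fin m) (Fin n ⊕ Fin d) ℝ) z v,
        ((A₀ a m *ᵥ z) ⬝ᵥ (W *ᵥ v)) ^ 2 ≤ ((A₀ a m *ᵥ z) ⬝ᵥ (A₀ a m *ᵥ z))
          * ((∑ q, ∑ j, (∑ i : Fin m, w m q i * W i j) ^ 2) * (v ⬝ᵥ v)) := by
  have key : ∀ m, ∃ w : Fin n → ℕ → ℝ, n ≤ m → (∀ q, ∑ i ∈ Finset.range m, w q i ^ 2 ≤ 1) ∧
      ∀ (W : Matrix (Fin m) (Fin n ⊕ Fin d) ℝ) z v,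
        ((A₀ a m *ᵥ z) ⬝ᵥ (W *ᵥ v)) ^ 2 ≤ ((A₀ a m *ᵥ z) ⬝ᵥ (A₀ a m *ᵥ z))
          * ((∑ q, ∑ j, (∑ i : Fin m, w q i * W i j) ^ 2) * (v ⬝ᵥ v)) := by
    intro m
    by_cases hm : n ≤ m
    swap
    · exact ⟨0, fun h => absurd h hm⟩
    obtain ⟨U, s, Q, hU, -, -, -, hA⟩ := exists_thin_svd (by simpa using hm) (A₀ a m)
    -- The left singular vectors of `A₀`, extended by zero. Writing `A₀ z = U x`, one has `|x| = |A₀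
    -- z|`, and Cauchy–Schwarz leaves only the entries of `Uᵀ * W`.
    set w : Fin n → ℕ → ℝ := fun q i => if hi : i < m then U ⟨i, hi⟩ q else 0 with hw
    have hwU : ∀ q (i : Fin m), w q i = U i q := fun q i => by simp [hw]
    refine ⟨w, fun _ => ⟨fun q => ?_, fun W z v => ?_⟩⟩
    · rw [Finset.sum_range]
      have := congrFun (congrFun hU q) q
      rw [Matrix.mul_apply, Matrix.one_apply_eq] at this
      simp only [hwU, sq]
      exact this.le
    · have hAz : A₀ a m *ᵥ z = U *ᵥ (Matrix.diagonal s * Qᵀ) *ᵥ z := by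
        rw [Matrix.mulVec_mulVec, ← Matrix.mul_assoc, ← hA]
      set x := (Matrix.diagonal s * Qᵀ) *ᵥ z
      have h1 : (U *ᵥ x) ⬝ᵥ (W *ᵥ v) = x ⬝ᵥ ((Uᵀ * W) *ᵥ v) := by
        rw [← Matrix.mulVec_mulVec, Matrix.dotProduct_mulVec x, Matrix.vecMul_transpose]
      have h2 := mulVec_dotProduct_le (Uᵀ * W) v
      have h3 : ∀ q j, (Uᵀ * W) q j = ∑ i : Fin m, w q i * W i j := fun q j => by
        simp only [hwU, Matrix.mul_apply, Matrix.transpose_apply]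
      simp only [h3] at h2
      rw [hAz, h1, dotProduct_mulVec_self_of_transpose_mul_self hU]
      refine le_trans ?_ (mul_le_mul_of_nonneg_left h2 (dotProduct_self_nonneg' x))
      have h4 := Finset.sum_mul_sq_le_sq_mul_sq Finset.univ x ((Uᵀ * W) *ᵥ v)
      simp only [sq] at h4
      rw [sq]
      exact h4
  choose w hw using key
  exact ⟨w, hw⟩

/-- The event that the errors are small relative to `λ_min (A₀ᵀ A₀)`. -/
def smallErrors (S : Matrix (Fin n ⊕ Fin d) (Fin n ⊕ Fin d) ℝ) (a : ℕ → Fin n → ℝ)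
    (c : ℕ → Ω → (Fin n ⊕ Fin d) → ℝ) (w : ℕ → Fin n → ℕ → ℝ) (ε : ℝ) (m : ℕ) : Set Ω :=
  {ω | (∀ j k, |∑ i ∈ Finset.range m, centredProd S c j k i ω| ≤ ε * lam a m) ∧
    ∀ q j, (∑ i ∈ Finset.range m, w m q i * c i ω j) ^ 2 ≤ ε * lam a m}

variable {S : Matrix (Fin n ⊕ Fin d) (Fin n ⊕ Fin d) ℝ} {a : ℕ → Fin n → ℝ}
  {c : ℕ → Ω → (Fin n ⊕ Fin d) → ℝ} {w : ℕ → Fin n → ℕ → ℝ}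

/-- Entrywise bounds become the quadratic form bounds of `exists_solves_and_close`, with `ε`
multiplied by the number `D` of entries involved. -/
theorem exists_of_mem_smallErrors (hn : 0 < n) (hd : 0 < d) (hS : S.PosSemidef)
    {X₀ : Matrix (Fin n) (Fin d) ℝ} (hrank : (S * ext X₀).rank = d)
    (hw : ∀ m, n ≤ m → (∀ q, ∑ i ∈ Finset.range m, w m q i ^ 2 ≤ 1) ∧
      ∀ (W : Matrix (Fin m) (Fin n ⊕ Fin d) ℝ) z v,
        ((A₀ a m *ᵥ z) ⬝ᵥ (W *ᵥ v)) ^ 2 ≤ ((A₀ a m *ᵥ z) ⬝ᵥ (A₀ a m *ᵥ z))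
          * ((∑ q, ∑ j, (∑ i : Fin m, w m q i * W i j) ^ 2) * (v ⬝ᵥ v))) :
    ∃ K : ℝ, 0 < K ∧ ∀ (m : ℕ), d ≤ m → n ≤ m → 0 < lam a m → ∀ ε, 0 ≤ ε → K * ε ≤ 1 →
      ∀ ω ∈ smallErrors S a c w ε m,
      ∀ N : Seminorm ℝ (Matrix (Fin m) (Fin n ⊕ Fin d) ℝ), IsUnitarilyInvariantNorm N →
      ∀ Δ, IsMinimizer S (obs a X₀ c m ω) (normObj S N) Δ →
        (∃ X, Solves (obs a X₀ c m ω) Δ X) ∧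
        ∀ X, Solves (obs a X₀ c m ω) Δ X → ∀ i j, (X i j - X₀ i j) ^ 2 ≤ K * ε := by
  obtain ⟨K, hK, h⟩ := exists_solves_and_close (X₀ := X₀) hn hd hS hrank
  set D : ℝ := ((n + d) * (n + d) + n * (n + d) : ℝ) with hD
  have hD0 : 0 < D := by
    have : (0 : ℝ) < n := by exact_mod_cast hn
    positivity
  refine ⟨K * D, by positivity, ?_⟩
  intro m hdm hnm hl ε hε hKε ω hω N hN Δ hΔ
  rw [mul_assoc] at hKε ⊢
  set W : Matrix (Fin m) (Fin n ⊕ Fin d) ℝ := Matrix.of fun i => c i ω with hW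
  have hl0 : 0 ≤ ε * lam a m := mul_nonneg hε hl.le
  refine h m hdm (D * ε) (lam a m) (by positivity) hl hKε (A₀ a m) W (lamMin_mul_le _) ?_ ?_ N hN Δ hΔ
  · intro v
    have hv0 := dotProduct_self_nonneg' v
    have hM : ∀ j k, (Wᵀ * W - (m : ℝ) • S) j k = ∑ i ∈ Finset.range m, centredProd S c j k i ω := by
      intro j k
      simp only [centredProd, Finset.sum_sub_distrib, Finset.sum_const, Finset.card_range,
        nsmul_eq_mul, Matrix.sub_apply, Matrix.mul_apply, Matrix.smul_apply, smul_eq_mul]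
      rw [Finset.sum_range]
      rfl
    have e : (W *ᵥ v) ⬝ᵥ (W *ᵥ v) - m * (v ⬝ᵥ (S *ᵥ v))
        = ∑ j, ∑ k, v j * ((Wᵀ * W - (m : ℝ) • S) j k * v k) := by
      have : v ⬝ᵥ ((Wᵀ * W - (m : ℝ) • S) *ᵥ v)
          = ∑ j, ∑ k, v j * ((Wᵀ * W - (m : ℝ) • S) j k * v k) := by
        simp only [dotProduct, Matrix.mulVec, Finset.mul_sum]
      rw [← this, Matrix.sub_mulVec, dotProduct_sub, ← dotProduct_mulVec_self, Matrix.smul_mulVec,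
        dotProduct_smul, smul_eq_mul]
    have hvj : ∀ j k, |v j| * |v k| ≤ v ⬝ᵥ v := by
      have hs : ∀ j, |v j| ^ 2 ≤ v ⬝ᵥ v := fun j => by
        rw [sq_abs, sq]
        exact Finset.single_le_sum (f := fun j => v j * v j) (fun k _ => mul_self_nonneg _)
          (Finset.mem_univ j)
      intro j k
      nlinarith [hs j, hs k, sq_nonneg (|v j| - |v k|)]
    rw [e]
    calc |∑ j, ∑ k, v j * ((Wᵀ * W - (m : ℝ) • S) j k * v k)|
        ≤ ∑ j, ∑ k, |v j * ((Wᵀ * W - (m : ℝ) • S) j k * v k)| :=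
          (Finset.abs_sum_le_sum_abs _ _).trans
            (Finset.sum_le_sum fun j _ => Finset.abs_sum_le_sum_abs _ _)
      _ ≤ ∑ _j : Fin n ⊕ Fin d, ∑ _k : Fin n ⊕ Fin d, (ε * lam a m) * (v ⬝ᵥ v) := by
          refine Finset.sum_le_sum fun j _ => Finset.sum_le_sum fun k _ => ?_
          rw [abs_mul, abs_mul, hM]
          calc |v j| * (|∑ i ∈ Finset.range m, centredProd S c j k i ω| * |v k|)
              = |∑ i ∈ Finset.range m, centredProd S c j k i ω| * (|v j| * |v k|) := by ring
            _ ≤ _ := mul_le_mul (hω.1 j k) (hvj j k) (by positivity) hl0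
      _ = ((n + d) * (n + d) : ℝ) * ((ε * lam a m) * (v ⬝ᵥ v)) := by
          simp; ring
      _ ≤ D * ((ε * lam a m) * (v ⬝ᵥ v)) :=
          mul_le_mul_of_nonneg_right (by rw [hD]; exact le_add_of_nonneg_right (by positivity))
            (by positivity)
      _ = _ := by ring
  · intro z v
    have hv0 := dotProduct_self_nonneg' v
    have hz0 := dotProduct_self_nonneg' (A₀ a m *ᵥ z)
    refine ((hw m hnm).2 W z v).trans ?_
    have h1 : ∑ q, ∑ j, (∑ i : Fin m, w m q i * W i j) ^ 2 ≤ D * (ε * lam a m) := by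
      calc ∑ q, ∑ j, (∑ i : Fin m, w m q i * W i j) ^ 2
          ≤ ∑ _q : Fin n, ∑ _j : Fin n ⊕ Fin d, ε * lam a m := by
            refine Finset.sum_le_sum fun q _ => Finset.sum_le_sum fun j _ => ?_
            have := hω.2 q j
            rwa [Finset.sum_range] at this
        _ = (n * (n + d) : ℝ) * (ε * lam a m) := by simp; ring
        _ ≤ _ := mul_le_mul_of_nonneg_right
            (by rw [hD]; exact le_add_of_nonneg_left (by positivity)) hl0
    have h2 := mul_le_mul_of_nonneg_left (mul_le_mul_of_nonneg_right h1 hv0) hz0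
    refine h2.trans (le_of_eq ?_)
    ring

variable [MeasurableSpace Ω] {P : Measure Ω} [IsProbabilityMeasure P]

theorem measure_iUnion₂_le_mul {α β : Type*} [Fintype α] [Fintype β] (s : α → β → Set Ω) {B : ℝ≥0∞}
    (h : ∀ x y, P (s x y) ≤ B) :
    P (⋃ x, ⋃ y, s x y) ≤ (Fintype.card α * Fintype.card β : ℕ) * B := by
  refine (measure_iUnion_fintype_le _ _).trans ?_
  refine (Finset.sum_le_sum fun x _ => (measure_iUnion_fintype_le P (s x)).trans
    (Finset.sum_le_sum fun y _ => h x y)).trans ?_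
  simp [mul_assoc]

/-- Markov's inequality of order `2 r` at level `√(ε λ)`; the moment bound is free of `m`. -/
theorem exists_measure_cross_le (h : ErrorModel P S c) {r : ℝ} (hr : 1 ≤ r) (hr2 : r ≤ 2)
    (hb : BoundedMoments P c (2 * r))
    (hw : ∀ m, n ≤ m → ∀ q, ∑ i ∈ Finset.range m, w m q i ^ 2 ≤ 1) :
    ∃ K : ℝ, 0 ≤ K ∧ ∀ m, n ≤ m → 0 < lam a m → ∀ ε, 0 < ε →
      P (⋃ q, ⋃ j, {ω | ε * lam a m < (∑ i ∈ Finset.range m, w m q i * c i ω j) ^ 2})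
        ≤ ENNReal.ofReal (K * (1 / (ε * lam a m) ^ r)) := by
  obtain ⟨K, hK0, hK⟩ := h.exists_weighted_sum_le hr hr2 hb
  refine ⟨(n * (n + d) : ℕ) * K, by positivity, fun m hm hl ε hε => ?_⟩
  have ht : 0 < ε * lam a m := mul_pos hε hl
  have h1 : ∀ q j, P {ω | ε * lam a m < (∑ i ∈ Finset.range m, w m q i * c i ω j) ^ 2}
      ≤ ENNReal.ofReal (K * (1 / (ε * lam a m) ^ r)) := by
    intro q j
    obtain ⟨hint, hle⟩ := hK j (w m q) m (hw m hm q)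
    have h2 := measure_lt_abs_le (P := P) (by linarith : 0 < 2 * r) (Real.sqrt_pos.2 ht) hint
    rw [Real.rpow_mul (Real.sqrt_nonneg _), Real.rpow_two, Real.sq_sqrt ht.le] at h2
    refine (measure_mono fun ω hω => ?_).trans (h2.trans (ENNReal.ofReal_le_ofReal ?_))
    · change √_ < _
      rw [← Real.sqrt_sq_eq_abs]
      exact Real.sqrt_lt_sqrt ht.le hω
    · rw [← div_eq_mul_one_div]
      exact div_le_div_of_nonneg_right hle (Real.rpow_nonneg ht.le _)
  refine (measure_iUnion₂_le_mul _ h1).trans (le_of_eq ?_)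
  rw [mul_assoc, ENNReal.ofReal_mul (by positivity : (0 : ℝ) ≤ ((n * (n + d) : ℕ) : ℝ)),
    ENNReal.ofReal_natCast]
  simp

/-- Markov's inequality of order `r`; the von Bahr–Esseen inequality brings in the number `m` of
summands. -/
theorem exists_measure_prod_le (h : ErrorModel P S c) {r : ℝ} (hr : 1 ≤ r) (hr2 : r ≤ 2)
    (hb : BoundedMoments P c (2 * r)) :
    ∃ K : ℝ, 0 ≤ K ∧ ∀ m, 0 < lam a m → ∀ ε, 0 < ε →
      P (⋃ j, ⋃ k, {ω | ε * lam a m < |∑ i ∈ Finset.range m, centredProd S c j k i ω|})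
        ≤ ENNReal.ofReal (K * (m / (ε * lam a m) ^ r)) := by
  obtain ⟨K, hK0, hK⟩ := h.exists_integrable_centredProd hr hr2 hb
  refine ⟨((n + d) * (n + d) : ℕ) * (4 * K), by positivity, fun m hl ε hε => ?_⟩
  have ht : 0 < ε * lam a m := mul_pos hε hl
  have h1 : ∀ j k, P {ω | ε * lam a m < |∑ i ∈ Finset.range m, centredProd S c j k i ω|}
      ≤ ENNReal.ofReal (4 * K * (m / (ε * lam a m) ^ r)) := by
    intro j k
    have hint := integrable_abs_sum_rpow hr (h.measurable_centredProd j k)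
      (fun i => (hK j k i).1) m
    refine (measure_lt_abs_le (P := P) (by linarith) ht hint).trans (ENNReal.ofReal_le_ofReal ?_)
    have h2 := integral_abs_sum_rpow_le hr hr2 (h.measurable_centredProd j k)
      (h.iIndepFun_centredProd j k) (fun i => (hK j k i).1) (h.integral_centredProd j k) m
    have h3 : ∑ i ∈ Finset.range m, ∫ ω, |centredProd S c j k i ω| ^ r ∂P ≤ m * K := by
      refine (Finset.sum_le_sum fun i _ => (hK j k i).2).trans ?_
      simp
    rw [← mul_div_assoc]
    exact div_le_div_of_nonneg_right (by linarith) (Real.rpow_nonneg ht.le _)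
  refine (measure_iUnion₂_le_mul _ h1).trans (le_of_eq ?_)
  rw [mul_assoc (((n + d) * (n + d) : ℕ) : ℝ),
    ENNReal.ofReal_mul (by positivity : (0 : ℝ) ≤ (((n + d) * (n + d) : ℕ) : ℝ)),
    ENNReal.ofReal_natCast]
  simp

theorem compl_smallErrors (ε : ℝ) (m : ℕ) :
    (smallErrors S a c w ε m)ᶜ
      = (⋃ j, ⋃ k, {ω | ε * lam a m < |∑ i ∈ Finset.range m, centredProd S c j k i ω|})
        ∪ ⋃ q, ⋃ j, {ω | ε * lam a m < (∑ i ∈ Finset.range m, w m q i * c i ω j) ^ 2} := by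
  ext ω
  simp only [smallErrors, Set.mem_compl_iff, Set.mem_ofPred_eq, Set.mem_union, Set.mem_iUnion,
    not_and_or, not_forall, not_le]

/-- Both failure probabilities are at most a multiple of `m / (ε λ) ^ r`, which is `ε ^ (-r)` times
the power `-r` of `m ^ (-1 / r) λ`. -/
theorem WeakCond.tendsto_compl_smallErrors (h : ErrorModel P S c) (hc : WeakCond P a c)
    (hw : ∀ m, n ≤ m → ∀ q, ∑ i ∈ Finset.range m, w m q i ^ 2 ≤ 1) :
    (∀ᶠ m in atTop, 0 < lam a m) ∧
      ∀ ε, 0 < ε → Tendsto (fun m => P (smallErrors S a c w ε m)ᶜ) atTop (𝓝 0) := by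
  obtain ⟨r, hr, hr2, hb, ht⟩ := hc
  have hr0 : 0 < r := by linarith
  have hpos : ∀ᶠ m in atTop, 0 < lam a m := by
    filter_upwards [ht.eventually_gt_atTop 0] with m hm
    by_contra hl
    exact absurd (mul_nonpos_of_nonneg_of_nonpos (by positivity) (not_lt.1 hl)) (not_le.2 hm)
  refine ⟨hpos, fun ε hε => ?_⟩
  obtain ⟨K₁, hK₁, h1⟩ := exists_measure_prod_le (a := a) h hr hr2 hb
  obtain ⟨K₂, hK₂, h2⟩ := exists_measure_cross_le (a := a) (w := w) h hr hr2 hb hw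
  have hlim : Tendsto (fun m : ℕ => (m : ℝ) / (ε * lam a m) ^ r) atTop (𝓝 0) := by
    have h3 := ((tendsto_rpow_atTop hr0).comp ht).inv_tendsto_atTop.const_mul (1 / ε ^ r)
    rw [mul_zero] at h3
    refine h3.congr' ?_
    filter_upwards [hpos, eventually_ge_atTop 1] with m hm hm1
    have hm0 : (0 : ℝ) < m := by exact_mod_cast hm1
    simp only [Pi.inv_apply, Function.comp_apply]
    rw [Real.mul_rpow (by positivity) hm.le, Real.mul_rpow hε.le hm.le, ← Real.rpow_mul hm0.le,
      neg_mul, one_div_mul_cancel hr0.ne', Real.rpow_neg_one]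
    have := (Real.rpow_pos_of_pos hε r).ne'
    have := (Real.rpow_pos_of_pos hm r).ne'
    field_simp
  have hlim2 : Tendsto (fun m : ℕ => ENNReal.ofReal ((K₁ + K₂) * ((m : ℝ) / (ε * lam a m) ^ r)))
      atTop (𝓝 0) := by
    have := ENNReal.tendsto_ofReal (hlim.const_mul (K₁ + K₂))
    simpa using this
  refine tendsto_of_tendsto_of_tendsto_of_le_of_le' tendsto_const_nhds hlim2
    (Eventually.of_forall fun m => zero_le) ?_
  filter_upwards [hpos, eventually_ge_atTop 1, eventually_ge_atTop n] with m hm hm1 hmn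
  have ht : 0 < (ε * lam a m) ^ r := Real.rpow_pos_of_pos (mul_pos hε hm) r
  have hm1' : (1 : ℝ) ≤ m := by exact_mod_cast hm1
  rw [compl_smallErrors]
  refine (measure_union_le _ _).trans ((add_le_add (h1 m hm ε hε) (h2 m hmn hm ε hε)).trans ?_)
  rw [← ENNReal.ofReal_add (by positivity) (by positivity), add_mul]
  refine ENNReal.ofReal_le_ofReal (add_le_add le_rfl ?_)
  exact mul_le_mul_of_nonneg_left (div_le_div_of_nonneg_right hm1' ht.le) hK₂

theorem StrongCondA.strongCondB (hc : StrongCondA P a c) : StrongCondB P a c := by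
  obtain ⟨r, hr, hb, m₀, hm₀, hpos, hs⟩ := hc
  refine ⟨2, one_le_two, le_rfl, hb.mono (by norm_num) (by linarith), m₀, hm₀, hpos, ?_⟩
  exact summable_inv_sq_of_summable hm₀ hr (fun k => hpos _ (Nat.le_add_right _ _)) hs

/-- The weights change with `m`, so the weighted sums are not partial sums of one series;
Borel–Cantelli applies, as their failure probabilities are summable. For the products the extra
factor `m` would spoil summability, and the strong law with normalization `λ` is used instead. -/
theorem StrongCondB.ae_mem_smallErrors (hn : 0 < n) (h : ErrorModel P S c) (hc : StrongCondB P a c)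
    (hw : ∀ m, n ≤ m → ∀ q, ∑ i ∈ Finset.range m, w m q i ^ 2 ≤ 1) :
    (∀ᶠ m in atTop, 0 < lam a m) ∧
      ∀ ε, 0 < ε → ∀ᵐ ω ∂P, ∀ᶠ m in atTop, ω ∈ smallErrors S a c w ε m := by
  obtain ⟨r, hr, hr2, hb, m₀, hm₀, hpos, hs⟩ := hc
  have hr0 : 0 < r := by linarith
  refine ⟨(eventually_ge_atTop m₀).mono hpos, fun ε hε => ?_⟩
  -- Freezing the initial values makes the normalizing sequence positive everywhere.
  set b : ℕ → ℝ := fun i => lam a (max i m₀) with hb'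
  have hbpos : ∀ i, 0 < b i := fun i => hpos _ (le_max_right _ _)
  have hbmono : Monotone b := fun i j hij => lam_mono a hn (max_le_max hij le_rfl)
  have hbs : Summable fun i => 1 / b i ^ r := by
    refine (summable_nat_add_iff m₀).1 (hs.congr fun k => ?_)
    simp only [hb']
    rw [max_eq_left (Nat.le_add_left _ _), add_comm]
  have hblim := tendsto_atTop_of_summable_inv_rpow hr0 hbpos hbs
  obtain ⟨K₁, hK₁, h1⟩ := h.exists_integrable_centredProd hr hr2 hb
  obtain ⟨K₂, hK₂, h2⟩ := exists_measure_cross_le (a := a) (w := w) h hr hr2 hb hw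
  have hA : ∀ᵐ ω ∂P, ∀ j k, ∀ᶠ m in atTop,
      |∑ i ∈ Finset.range m, centredProd S c j k i ω| ≤ ε * lam a m := by
    refine ae_all_iff.2 fun j => ae_all_iff.2 fun k => ?_
    filter_upwards [ae_tendsto_sum_div hr hr2 (h.measurable_centredProd j k)
      (h.iIndepFun_centredProd j k) (fun i => (h1 j k i).1) (h.integral_centredProd j k)
      (fun i => (h1 j k i).2) hbmono hbpos hblim hbs] with ω hω
    have h3 := hω.abs
    rw [abs_zero] at h3
    filter_upwards [h3.eventually_le_const hε, eventually_ge_atTop m₀] with m hm hm0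
    rw [abs_div, abs_of_pos (hbpos m), div_le_iff₀ (hbpos m)] at hm
    simpa only [hb', max_eq_left hm0] using hm
  have hB : ∀ᵐ ω ∂P, ∀ᶠ m in atTop,
      ω ∉ ⋃ q, ⋃ j, {ω | ε * lam a m < (∑ i ∈ Finset.range m, w m q i * c i ω j) ^ 2} := by
    set M := max m₀ n with hM
    have hsum : ∑' k, P (⋃ q, ⋃ j, {ω | ε * lam a (k + M)
        < (∑ i ∈ Finset.range (k + M), w (k + M) q i * c i ω j) ^ 2}) ≠ ⊤ := by
      have hs2 : Summable fun k => K₂ * (1 / (ε * lam a (k + M)) ^ r) := by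
        have h3 := ((summable_nat_add_iff M).2 hbs).mul_left (K₂ * (1 / ε ^ r))
        refine h3.congr fun k => ?_
        have hk : m₀ ≤ k + M := (le_max_left _ _).trans (Nat.le_add_left _ _)
        simp only [hb']
        rw [max_eq_left hk, Real.mul_rpow hε.le (hpos _ hk).le]
        ring
      refine ne_top_of_le_ne_top hs2.tsum_ofReal_ne_top (ENNReal.tsum_le_tsum fun k => ?_)
      exact h2 _ ((le_max_right _ _).trans (Nat.le_add_left _ _))
        (hpos _ ((le_max_left _ _).trans (Nat.le_add_left _ _))) ε hε
    filter_upwards [ae_eventually_notMem hsum] with ω hω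
    obtain ⟨k₀, hk₀⟩ := eventually_atTop.1 hω
    filter_upwards [eventually_ge_atTop (k₀ + M)] with m hm
    have := hk₀ (m - M) (by omega)
    rwa [Nat.sub_add_cancel (by omega)] at this
  filter_upwards [hA, hB] with ω hωA hωB
  have hωA' : ∀ᶠ m in atTop, ∀ j k,
      |∑ i ∈ Finset.range m, centredProd S c j k i ω| ≤ ε * lam a m :=
    eventually_all.2 fun j => eventually_all.2 fun k => hωA j k
  filter_upwards [hωA', hωB] with m h3 h4
  by_contra hcon
  rw [← Set.mem_compl_iff, compl_smallErrors] at hcon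
  rcases hcon with hcon | hcon
  · simp only [Set.mem_iUnion, Set.mem_ofPred_eq] at hcon
    obtain ⟨j, k, hjk⟩ := hcon
    exact absurd (h3 j k) (not_le.2 hjk)
  · exact h4 hcon

end SmallErrors

/-! ### Weak and strong consistency -/

section Consistency

variable {n d : ℕ} {Ω : Type*} [MeasurableSpace Ω] {P : Measure Ω} [IsProbabilityMeasure P]
  {S : Matrix (Fin n ⊕ Fin d) (Fin n ⊕ Fin d) ℝ} {a : ℕ → Fin n → ℝ}
  {c : ℕ → Ω → (Fin n ⊕ Fin d) → ℝ} {X₀ : Matrix (Fin n) (Fin d) ℝ}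
  {f : ∀ m, Matrix (Fin m) (Fin n ⊕ Fin d) ℝ → ℝ}

/-- On the events `smallErrors` all estimators exist and are close to `X₀`. -/
theorem exists_of_mem_smallErrors_of_isMinimizer (hn : 0 < n) (hd : 0 < d) (hS : S.PosSemidef)
    (hrank : (S * ext X₀).rank = d) (a : ℕ → Fin n → ℝ) (c : ℕ → Ω → (Fin n ⊕ Fin d) → ℝ)
    (hf : ∀ m C Δ, IsMinimizer S C (f m) Δ →
      ∃ N, IsUnitarilyInvariantNorm N ∧ IsMinimizer S C (normObj S N) Δ) :
    ∃ w : ℕ → Fin n → ℕ → ℝ,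
      (∀ m, n ≤ m → ∀ q, ∑ i ∈ Finset.range m, w m q i ^ 2 ≤ 1) ∧
      ∃ K : ℝ, 0 < K ∧ ∀ m, d ≤ m → n ≤ m → 0 < lam a m → ∀ ε, 0 < ε → K * ε ≤ 1 →
        ∀ ω ∈ smallErrors S a c w ε m, ω ∈ solvableEvent S f (obs a X₀ c) m ∧
          ∀ Xhat, IsEstimator S f (obs a X₀ c) Xhat →
            ∀ i j, (Xhat m ω i j - X₀ i j) ^ 2 ≤ K * ε := by
  obtain ⟨w, hw⟩ := exists_weights (d := d) a
  obtain ⟨K, hK, h⟩ := exists_of_mem_smallErrors (c := c) hn hd hS hrank hw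
  refine ⟨w, fun m hm => (hw m hm).1, K, hK, fun m h1 h2 hl ε hε hKε ω hω => ⟨?_, ?_⟩⟩
  · intro Δ hΔ
    obtain ⟨N, hN, hΔ'⟩ := hf m _ Δ hΔ
    exact (h m h1 h2 hl ε hε.le hKε ω hω N hN Δ hΔ').1
  · intro Xhat hX
    obtain ⟨Δ, hΔ, hsol⟩ := hX m ω
    obtain ⟨N, hN, hΔ'⟩ := hf m _ Δ hΔ
    obtain ⟨h3, h4⟩ := h m h1 h2 hl ε hε.le hKε ω hω N hN Δ hΔ'
    exact h4 _ (hsol h3)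

theorem WeakCond.weaklyConsistent (hc : WeakCond P a c) (hn : 0 < n) (hd : 0 < d)
    (hS : S.PosSemidef) (hrank : (S * ext X₀).rank = d) (h : ErrorModel P S c)
    (hf : ∀ m C Δ, IsMinimizer S C (f m) Δ →
      ∃ N, IsUnitarilyInvariantNorm N ∧ IsMinimizer S C (normObj S N) Δ) :
    WeaklyConsistent P S X₀ f (obs a X₀ c) := by
  obtain ⟨w, hw, K, hK, key⟩ := exists_of_mem_smallErrors_of_isMinimizer hn hd hS hrank a c hf
  obtain ⟨hl, hlim⟩ := hc.tendsto_compl_smallErrors h hw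
  -- The sets `E m` need not be measurable; monotonicity of the outer measure suffices. The choice
  -- of `ε` makes `K ε = min 1 η`.
  have main : ∀ η, 0 < η → ∀ E : ℕ → Set Ω,
      (∀ m, d ≤ m → n ≤ m → 0 < lam a m → K * (min 1 η / K) ≤ 1 →
        ∀ ω ∈ smallErrors S a c w (min 1 η / K) m, ω ∉ E m) →
      Tendsto (fun m => P (E m)) atTop (𝓝 0) := by
    intro η hη E hE
    have hη1 : 0 < min 1 η / K := div_pos (lt_min one_pos hη) hK
    refine tendsto_of_tendsto_of_tendsto_of_le_of_le' tendsto_const_nhds (hlim _ hη1)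
      (Eventually.of_forall fun _ => zero_le) ?_
    filter_upwards [hl, eventually_ge_atTop d, eventually_ge_atTop n] with m h1 h2 h3
    refine measure_mono fun ω hω hs => hE m h2 h3 h1 ?_ ω hs hω
    rw [mul_div_cancel₀ _ hK.ne']
    exact min_le_left _ _
  constructor
  · refine main 1 one_pos _ fun m h1 h2 h3 h4 ω hω hω' => hω' ?_
    exact (key m h1 h2 h3 _ (div_pos (lt_min one_pos one_pos) hK) h4 ω hω).1
  · intro Xhat hX i j ε hε
    obtain ⟨δ, hδ, hδε⟩ : ∃ δ : ℝ, 0 < δ ∧ ENNReal.ofReal δ < ε := by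
      obtain ⟨q, hq0, hq⟩ := ENNReal.lt_iff_exists_nnreal_btwn.1 hε
      exact ⟨q, by exact_mod_cast hq0, by rwa [ENNReal.ofReal_coe_nnreal]⟩
    refine main (δ ^ 2) (by positivity) _ fun m h1 h2 h3 h4 ω hω hω' => ?_
    have h5 := (key m h1 h2 h3 _ (div_pos (lt_min one_pos (by positivity)) hK) h4 ω hω).2 Xhat hX i j
    rw [mul_div_cancel₀ _ hK.ne'] at h5
    have h6 := abs_le_of_sq_le_sq (h5.trans (min_le_right _ _)) hδ.le
    have h7 : edist (Xhat m ω i j) (X₀ i j) ≤ ENNReal.ofReal δ := by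
      rw [edist_dist, Real.dist_eq]
      exact ENNReal.ofReal_le_ofReal h6
    exact absurd (h7.trans_lt hδε) (not_lt.2 hω')

theorem StrongCondB.stronglyConsistent (hc : StrongCondB P a c) (hn : 0 < n) (hd : 0 < d)
    (hS : S.PosSemidef) (hrank : (S * ext X₀).rank = d) (h : ErrorModel P S c)
    (hf : ∀ m C Δ, IsMinimizer S C (f m) Δ →
      ∃ N, IsUnitarilyInvariantNorm N ∧ IsMinimizer S C (normObj S N) Δ) :
    StronglyConsistent P S X₀ f (obs a X₀ c) := by
  obtain ⟨w, hw, K, hK, key⟩ := exists_of_mem_smallErrors_of_isMinimizer hn hd hS hrank a c hf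
  obtain ⟨hl, hae⟩ := hc.ae_mem_smallErrors hn h hw
  -- Countably many levels `1 / (k + 1)` give one null set, which serves all `η` and all estimators.
  have main : ∀ᵐ ω ∂P, ∀ η, 0 < η → ∀ᶠ m in atTop, ω ∈ solvableEvent S f (obs a X₀ c) m ∧
      ∀ Xhat, IsEstimator S f (obs a X₀ c) Xhat → ∀ i j, (Xhat m ω i j - X₀ i j) ^ 2 ≤ η := by
    have h1 : ∀ᵐ ω ∂P, ∀ k : ℕ, ∀ᶠ m in atTop, ω ∈ smallErrors S a c w (1 / (k + 1) / K) m :=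
      ae_all_iff.2 fun k => hae _ (by positivity)
    filter_upwards [h1] with ω hω η hη
    obtain ⟨k, hk⟩ := exists_nat_one_div_lt hη
    filter_upwards [hω k, hl, eventually_ge_atTop d, eventually_ge_atTop n] with m h2 h3 h4 h5
    have h6 : K * (1 / ((k : ℝ) + 1) / K) = 1 / ((k : ℝ) + 1) := mul_div_cancel₀ _ hK.ne'
    have h7 := key m h4 h5 h3 _ (by positivity)
      (h6.le.trans ((div_le_one (by positivity)).2 (by simp))) ω h2
    rw [h6] at h7
    exact ⟨h7.1, fun Xhat hX i j => (h7.2 Xhat hX i j).trans hk.le⟩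
  constructor
  · filter_upwards [main] with ω hω
    exact (hω 1 one_pos).mono fun m hm => hm.1
  · intro Xhat hX
    filter_upwards [main] with ω hω
    refine tendsto_pi_nhds.2 fun i => tendsto_pi_nhds.2 fun j => Metric.tendsto_nhds.2 fun ε hε => ?_
    filter_upwards [hω ((ε / 2) ^ 2) (by positivity)] with m hm
    rw [Real.dist_eq]
    have := abs_le_of_sq_le_sq (hm.2 Xhat hX i j) (by positivity)
    linarith

end Consistency

/-! ### Nonuniqueness for data with orthonormal columns -/

section Nonuniqueness

variable {m n d : ℕ} {C Δ : Matrix (Fin m) (Fin n ⊕ Fin d) ℝ}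

theorem rank_ext (X : Matrix (Fin n) (Fin d) ℝ) : (ext X).rank = d := by
  refine le_antisymm (by simpa using (ext X).rank_le_card_width) ?_
  have h : Matrix.fromCols (0 : Matrix (Fin d) (Fin n) ℝ) (-1 : Matrix (Fin d) (Fin d) ℝ) * ext X = 1 := by
    rw [ext, Matrix.fromCols_mul_fromRows]
    simp
  have h1 := Matrix.rank_mul_le_right (Matrix.fromCols (0 : Matrix (Fin d) (Fin n) ℝ) (-1 : Matrix (Fin d) (Fin d) ℝ)) (ext X)
  rw [h, Matrix.rank_one] at h1
  simpa using h1

theorem normObj_one (N : Seminorm ℝ (Matrix (Fin m) (Fin n ⊕ Fin d) ℝ)) : normObj 1 N Δ = N Δ := by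
  rw [normObj, sqrtM_one, pinv_one, Matrix.mul_one]

/-- Every feasible matrix agrees with `C` on some orthonormal system of size `d`. -/
theorem Feasible.exists_orthonormal (hd : 0 < d) {S : Matrix (Fin n ⊕ Fin d) (Fin n ⊕ Fin d) ℝ}
    (h : Feasible S C Δ) :
    ∃ Y : Matrix (Fin n ⊕ Fin d) (Fin d) ℝ, Yᵀ * Y = 1 ∧ Δ * Y = C * Y := by
  have hk := le_finrank_ker h
  obtain ⟨v, hv⟩ := Module.finrank_pos_iff_exists_ne_zero.1 (hd.trans_le hk)
  obtain ⟨Y, hY, hYk, -⟩ := exists_orthonormal_columns hd _ hk v.2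
    (fun h0 => hv (Subtype.ext h0))
  refine ⟨Y, hY, ?_⟩
  refine Matrix.ext_of_mulVec_single fun e => ?_
  have h1 : (C - Δ) *ᵥ Y *ᵥ Pi.single e 1 = 0 := hYk _
  rw [Matrix.sub_mulVec, sub_eq_zero] at h1
  rw [← Matrix.mulVec_mulVec, ← Matrix.mulVec_mulVec, h1]

/-- If `C` has orthonormal columns and `S = 1`, then every `X` is a solution of the problem with
a unitarily invariant norm. -/
theorem exists_isMinimizer_solves (hd : 0 < d) (hC : Cᵀ * C = 1)
    {N : Seminorm ℝ (Matrix (Fin m) (Fin n ⊕ Fin d) ℝ)} (hN : IsUnitarilyInvariantNorm N)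
    (X : Matrix (Fin n) (Fin d) ℝ) : ∃ Δ, IsMinimizer 1 C (normObj 1 N) Δ ∧ Solves C Δ X := by
  obtain ⟨B, hB⟩ := exists_ext_mul_normalized (Matrix.PosSemidef.one (n := Fin n ⊕ Fin d) (R := ℝ))
    X (by rw [Matrix.one_mul, rank_ext])
  have hfeas := feasible_mul_of_normalized Matrix.PosSemidef.one hB C
  have hB' : B * (Bᵀ * (ext X)ᵀ * ext X) = 1 := by
    rw [mul_eq_one_comm]
    rw [Matrix.mul_one, Matrix.transpose_mul] at hB
    rw [← hB]
    simp only [Matrix.mul_assoc]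
  set Y := ext X * B with hY
  rw [Matrix.mul_one] at hB hfeas
  have hXY : ext X = Y * (Bᵀ * (ext X)ᵀ * ext X) := by
    rw [hY, Matrix.mul_assoc, hB', Matrix.mul_one]
  have horth : ∀ {Z : Matrix (Fin n ⊕ Fin d) (Fin d) ℝ}, Zᵀ * Z = 1 → (C * Z)ᵀ * (C * Z) = 1 := by
    intro Z hZ
    rw [Matrix.transpose_mul, Matrix.mul_assoc, ← Matrix.mul_assoc Cᵀ, hC, Matrix.one_mul, hZ]
  refine ⟨C * Y * Yᵀ, ⟨hfeas, fun Δ' hΔ' => ?_⟩, ?_⟩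
  -- Any feasible `Δ'` agrees with the isometry `C` on some `Y'`, so its compression `C * Y' * Y'ᵀ`
  -- is a partial isometry of rank `d`, with the same norm as `C * Y * Yᵀ`.
  · obtain ⟨Y', hY', he⟩ := hΔ'.exists_orthonormal hd
    rw [normObj_one, normObj_one]
    have h1 := hN.apply_congr (horth hB) (horth hY') hB hY' 1
    have h2 := hN.mul_mul_transpose_le hY' Δ'
    rw [Matrix.mul_one, Matrix.mul_one] at h1
    rw [h1, ← he]
    exact h2
  · have h1 : (C - C * Y * Yᵀ) * Y = 0 := by
      rw [Matrix.sub_mul, Matrix.mul_assoc _ Yᵀ, hB, Matrix.mul_one, sub_self]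
    rw [Solves, hXY, ← Matrix.mul_assoc, h1, Matrix.zero_mul]

open scoped Matrix.Norms.L2Operator in
/-- If `C` has orthonormal columns, then `Δ = C` is a solution of the spectral problem. -/
theorem isMinimizer_specObj_self (hd : 0 < d) (hC : Cᵀ * C = 1) :
    IsMinimizer 1 C (specObj 1) C := by
  rw [isMinimizer_specObj_iff Matrix.PosSemidef.one]
  refine ⟨⟨?_, by simp⟩, fun Δ' hΔ' => ?_⟩
  · rw [projCol, pinv_one, Matrix.mul_one, sub_self, Matrix.mul_zero]
  rw [normObj_one, normObj_one]
  obtain ⟨Y, hY, he⟩ := hΔ'.exists_orthonormal hd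
  have hle : ∀ {ι κ : Type} [Fintype ι] [Fintype κ] [DecidableEq κ] (A : Matrix ι κ ℝ),
      Aᵀ * A = 1 → ‖A‖ ≤ 1 := by
    intro ι κ _ _ _ A hA
    have h1 := Matrix.l2_opNorm_conjTranspose_mul_self A
    rw [Matrix.conjTranspose_eq_transpose_of_trivial, hA, ← Matrix.diagonal_one,
      Matrix.l2_opNorm_diagonal] at h1
    have h2 : ‖(fun _ => 1 : κ → ℝ)‖ ≤ 1 := pi_norm_le_iff_of_nonneg zero_le_one |>.2 (by simp)
    nlinarith [norm_nonneg A]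
  have hCY : (C * Y)ᵀ * (C * Y) = 1 := by
    rw [Matrix.transpose_mul, Matrix.mul_assoc, ← Matrix.mul_assoc Cᵀ, hC, Matrix.one_mul, hY]
  -- A feasible `Δ'` is isometric on a nonzero subspace, so its norm is at least `1`, while `‖C‖ ≤
  -- 1`.
  have h1 : 1 ≤ ‖C * Y‖ := by
    have h1 := Matrix.l2_opNorm_conjTranspose_mul_self (C * Y)
    rw [Matrix.conjTranspose_eq_transpose_of_trivial, hCY, ← Matrix.diagonal_one,
      Matrix.l2_opNorm_diagonal] at h1
    have h2 : (1 : ℝ) ≤ ‖(fun _ => 1 : Fin d → ℝ)‖ := by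
      simpa using norm_le_pi_norm (fun _ => 1 : Fin d → ℝ) ⟨0, hd⟩
    nlinarith [norm_nonneg (C * Y)]
  have h2 : ‖C * Y‖ ≤ ‖Δ'‖ := by
    rw [← he]
    refine (Matrix.l2_opNorm_mul _ _).trans ?_
    exact mul_le_of_le_one_right (norm_nonneg _) (hle Y hY)
  exact (hle C hC).trans (h1.trans h2)

theorem exists_transpose_mul_self_eq_one (n d : ℕ) :
    ∃ C : Matrix (Fin (n + d)) (Fin n ⊕ Fin d) ℝ, Cᵀ * C = 1 ∧ C.rank = n + d := by
  refine ⟨(1 : Matrix (Fin n ⊕ Fin d) (Fin n ⊕ Fin d) ℝ).submatrix finSumFinEquiv.symm id, ?_, ?_⟩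
  · rw [Matrix.transpose_submatrix, Matrix.submatrix_mul_equiv]
    simp
  · have := Matrix.rank_submatrix (1 : Matrix (Fin n ⊕ Fin d) (Fin n ⊕ Fin d) ℝ)
      finSumFinEquiv.symm (Equiv.refl _)
    rw [Matrix.rank_one] at this
    simpa using this

/-- In the spectral problem `Δ = C` is optimal and `C - Δ = 0`, so every `X` solves the equation
with this one `Δ`. For a general norm the two solutions come from possibly different minimizers. -/
theorem exists_nonunique (hn : 0 < n) (hd : 0 < d) :
    ∃ (m : ℕ) (C : Matrix (Fin m) (Fin n ⊕ Fin d) ℝ), C.rank = n + d ∧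
      (∃ Δ X₁ X₂, IsMinimizer 1 C (specObj 1) Δ ∧ Solves C Δ X₁ ∧ Solves C Δ X₂ ∧ X₁ ≠ X₂) ∧
      (∀ N : Seminorm ℝ (Matrix (Fin m) (Fin n ⊕ Fin d) ℝ), IsUnitarilyInvariantNorm N →
        ∃ Δ₁ X₁ Δ₂ X₂, IsMinimizer 1 C (normObj 1 N) Δ₁ ∧ Solves C Δ₁ X₁ ∧
          IsMinimizer 1 C (normObj 1 N) Δ₂ ∧ Solves C Δ₂ X₂ ∧ X₁ ≠ X₂) := by
  obtain ⟨C, hC, hr⟩ := exists_transpose_mul_self_eq_one n d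
  have hne : (0 : Matrix (Fin n) (Fin d) ℝ) ≠ Matrix.of fun _ _ => 1 := fun h =>
    zero_ne_one (congrFun (congrFun h ⟨0, hn⟩) ⟨0, hd⟩)
  refine ⟨n + d, C, hr, ⟨C, 0, _, isMinimizer_specObj_self hd hC, ?_, ?_, hne⟩, fun N hN => ?_⟩
  · simp [Solves]
  · simp [Solves]
  · obtain ⟨Δ₁, h₁, h₁'⟩ := exists_isMinimizer_solves hd hC hN 0
    obtain ⟨Δ₂, h₂, h₂'⟩ := exists_isMinimizer_solves hd hC hN (Matrix.of fun _ _ => 1)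
    exact ⟨Δ₁, _, Δ₂, _, h₁, h₁', h₂, h₂', hne⟩

end Nonuniqueness

end TLS

theorem mainTheorem5 {n d : ℕ} (hn : 0 < n) (hd : 0 < d)
    (S : Matrix (Fin n ⊕ Fin d) (Fin n ⊕ Fin d) ℝ) (hS : S.PosSemidef)
    (X₀ : Matrix (Fin n) (Fin d) ℝ) (hrank : (S * TLS.ext X₀).rank = d) :
    -- Part 1: attainment (spectral norm and unitarily invariant norms), full-rank solutions
    (∀ (m : ℕ) (C : Matrix (Fin m) (Fin n ⊕ Fin d) ℝ),
      (∃ Δ, IsMinimizer S C (specObj S) Δ) ∧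
      (∀ N : Seminorm ℝ (Matrix (Fin m) (Fin n ⊕ Fin d) ℝ), IsUnitarilyInvariantNorm N →
        ∃ Δ, IsMinimizer S C (normObj S N) Δ) ∧
      (∀ Δ, Feasible S C Δ → ∃ Xext : Matrix (Fin n ⊕ Fin d) (Fin d) ℝ,
        (C - Δ) * Xext = 0 ∧ Xext.rank = d)) ∧
    -- Parts 2 and 3: solvability and consistency
    (∀ (Ω : Type*) [MeasurableSpace Ω] (P : Measure Ω) [IsProbabilityMeasure P]
      (a : ℕ → Fin n → ℝ) (c : ℕ → Ω → (Fin n ⊕ Fin d) → ℝ), ErrorModel P S c →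
      (WeakCond P a c →
        WeaklyConsistent P S X₀ (fun _ => specObj S) (obs a X₀ c) ∧
        ∀ N : ∀ m, Seminorm ℝ (Matrix (Fin m) (Fin n ⊕ Fin d) ℝ),
          (∀ m, IsUnitarilyInvariantNorm (N m)) →
            WeaklyConsistent P S X₀ (fun m => normObj S (N m)) (obs a X₀ c)) ∧
      (StrongCondA P a c ∨ StrongCondB P a c →
        StronglyConsistent P S X₀ (fun _ => specObj S) (obs a X₀ c) ∧
        ∀ N : ∀ m, Seminorm ℝ (Matrix (Fin m) (Fin n ⊕ Fin d) ℝ),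
          (∀ m, IsUnitarilyInvariantNorm (N m)) →
            StronglyConsistent P S X₀ (fun m => normObj S (N m)) (obs a X₀ c))) ∧
    -- The solution need not be unique, even for data of full column rank and `S = I`
    (∃ (m : ℕ) (C : Matrix (Fin m) (Fin n ⊕ Fin d) ℝ), C.rank = n + d ∧
      (∃ Δ X₁ X₂, IsMinimizer 1 C (specObj 1) Δ ∧ Solves C Δ X₁ ∧ Solves C Δ X₂ ∧ X₁ ≠ X₂) ∧
      (∀ N : Seminorm ℝ (Matrix (Fin m) (Fin n ⊕ Fin d) ℝ), IsUnitarilyInvariantNorm N →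
        ∃ Δ₁ X₁ Δ₂ X₂, IsMinimizer 1 C (normObj 1 N) Δ₁ ∧ Solves C Δ₁ X₁ ∧
          IsMinimizer 1 C (normObj 1 N) Δ₂ ∧ Solves C Δ₂ X₂ ∧ X₁ ≠ X₂)) := by
  -- The original problem enters the consistency theorems through the spectral norm.
  have hspec : ∀ (m : ℕ) (C Δ : Matrix (Fin m) (Fin n ⊕ Fin d) ℝ), IsMinimizer S C (specObj S) Δ →
      ∃ N, IsUnitarilyInvariantNorm N ∧ IsMinimizer S C (normObj S N) Δ := fun m C Δ h =>
    ⟨_, isUnitarilyInvariantNorm_specSeminorm, (isMinimizer_specObj_iff hS).1 h⟩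
  refine ⟨fun m C => ⟨?_, fun N hN => exists_isMinimizer_normObj hS X₀ hrank C N hN.definite,
    fun Δ h => exists_full_rank_solution h⟩, ?_, exists_nonunique hn hd⟩
  · obtain ⟨Δ, h⟩ := exists_isMinimizer_normObj hS X₀ hrank C (specSeminorm _ _)
      isUnitarilyInvariantNorm_specSeminorm.definite
    exact ⟨Δ, (isMinimizer_specObj_iff hS).2 h⟩
  · intro Ω _ P _ a c h
    refine ⟨fun hc => ⟨hc.weaklyConsistent hn hd hS hrank h hspec, fun N hN =>
      hc.weaklyConsistent hn hd hS hrank h fun m C Δ hΔ => ⟨N m, hN m, hΔ⟩⟩, fun hc => ?_⟩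
    have hc' : StrongCondB P a c := hc.elim (fun hA => hA.strongCondB) id
    exact ⟨hc'.stronglyConsistent hn hd hS hrank h hspec, fun N hN =>
      hc'.stronglyConsistent hn hd hS hrank h fun m C Δ hΔ => ⟨N m, hN m, hΔ⟩⟩
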